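/- **Theorem 2.10.** Let $1<p<\infty$ and $\frac1p+\frac1q=1$. For $0<\gamma<1$ let $\|\cdot\|$ be the norm on the space $c_{00}$ of finitely supported real sequences determined by the implicit equation $$\|a\|=\max\Big\{\|a\|_\infty,\ \gamma\sup\frac{\sum_{j=1}^n\|E_ja\|}{n^{1/q}}\Big\},$$ where the supremum is over all $n\ge1$ and all nonempty finite sets $E_1<\dots<E_n$ of natural numbers ($E<F$ means $\max E<\min F$), and $Ea$ is the restriction of $a$ to the coordinates in $E$; it is the limit of the increasing sequence of norms given by $\|a\|_0=\|a\|_\infty$, $\|a\|_{m+1}=\max\{\|a\|_\infty,\gamma\sup n^{-1/q}\sum_{j=1}^n\|E_ja\|_m\}$. The Tirilman space $Ti(p,\gamma)$ is the completion of $(c_{00},\|\cdot\|)$, $Ti^*(p,\gamma)$ is its dual space, and $e^*_j\in Ti^*(p,\gamma)$ is the $j$-th coordinate functional. A sequence in a Banach space is basic if it is a Schauder basis of its closed linear span. Two sequences $(x_j)$, $(y_j)$ are equivalent if, for all real scalars $(a_j)$, $\sum a_jx_j$ converges if and only if $\sum a_jy_j$ converges. A basic sequence is subsymmetric if it is unconditional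 and equivalent to each of its subsequences, and symmetric if it is equivalent to each of its rearrangements $(x_{\pi(j)})$, $\pi$ a permutation of $\mathbb N$. Then there is $\gamma_0=\gamma_0(p)>0$ such that for all $0<\gamma<1$ with $\gamma<\gamma_0$: 1. $(e^*_j)_{j=1}^\infty$ is a Schauder basis of $Ti^*(p,\gamma)$, and it is subsymmetric but not symmetric; 2. every subsymmetric basic sequence in $Ti^*(p,\gamma)$ is equivalent to $(e^*_j)_{j=1}^\infty$. In particular, $Ti^*(p,\gamma)$ has, up to equivalence, a unique subsymmetric basic sequence. -/

import Mathlib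

open Filter Topology

/-! ### Sequences in Banach spaces -/

section BasicSequences

variable {X Y : Type*} [NormedAddCommGroup X] [NormedSpace ℝ X]
  [NormedAddCommGroup Y] [NormedSpace ℝ Y]

/-- The series `∑ xⱼ` converges, i.e. its sequence of partial sums has a limit. -/
def SeriesConverges (x : ℕ → X) : Prop :=
  ∃ s : X, Tendsto (fun n => ∑ j ∈ Finset.range n, x j) atTop (𝓝 s)

/-- `(xⱼ)` is a basic sequence: it is a Schauder basis of its closed linear span. -/
def IsBasicSequence (x : ℕ → X) : Prop :=
  ∃ b : SchauderBasis ℝ (Submodule.span ℝ (Set.range x)).topologicalClosure,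
    ∀ j, ((b j : (Submodule.span ℝ (Set.range x)).topologicalClosure) : X) = x j

/-- Two sequences are equivalent if `∑ aⱼ xⱼ` converges exactly when `∑ aⱼ yⱼ` does. -/
def SeqEquivalent (x : ℕ → X) (y : ℕ → Y) : Prop :=
  ∀ a : ℕ → ℝ, SeriesConverges (fun j => a j • x j) ↔ SeriesConverges (fun j => a j • y j)

/-- `(xⱼ)` is an unconditional basic sequence: a basic sequence for which every convergent
expansion `∑ aⱼ xⱼ` converges unconditionally. -/
def IsUnconditionalBasicSequence (x : ℕ → X) : Prop :=
  IsBasicSequence x ∧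
    ∀ a : ℕ → ℝ, SeriesConverges (fun j => a j • x j) → Summable (fun j => a j • x j)

/-- `(xⱼ)` is a subsymmetric basic sequence: an unconditional basic sequence that is equivalent
to each of its subsequences. -/
def IsSubsymmetric (x : ℕ → X) : Prop :=
  IsUnconditionalBasicSequence x ∧ ∀ φ : ℕ → ℕ, StrictMono φ → SeqEquivalent x (x ∘ φ)

/-- `(xⱼ)` is a symmetric basic sequence: a basic sequence that is equivalent to each of its
rearrangements. -/
def IsSymmetricSeq (x : ℕ → X) : Prop :=
  IsBasicSequence x ∧ ∀ σ : Equiv.Perm ℕ, SeqEquivalent x (x ∘ σ)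

end BasicSequences

/-! ### The Tirilman norm on finitely supported sequences -/

noncomputable section Tirilman

/-- The norm `‖a‖_∞ = sup |aᵢ|` on `c₀₀`. -/
def c00Sup (a : ℕ →₀ ℝ) : ℝ := ⨆ i, |a i|

/-- The restriction `E a` of `a` to the coordinates in `E`. -/
def c00Restrict (E : Finset ℕ) (a : ℕ →₀ ℝ) : ℕ →₀ ℝ := a.filter (· ∈ E)

/-- `E₁ < ⋯ < Eₙ`: nonempty finite sets with `max Eᵢ < min Eⱼ` for `i < j`. -/
def IsSuccessive {n : ℕ} (E : Fin n → Finset ℕ) : Prop :=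
  (∀ i, (E i).Nonempty) ∧ ∀ i j, i < j → ∀ k ∈ E i, ∀ l ∈ E j, k < l

/-- The set of all averages `(∑ⱼ N (Eⱼ a)) / n ^ (1 / q)` over `n ≥ 1` and `E₁ < ⋯ < Eₙ`, where
`q = p / (p - 1)` is the exponent conjugate to `p`. -/
def tirilmanAverages (p : ℝ) (N : (ℕ →₀ ℝ) → ℝ) (a : ℕ →₀ ℝ) : Set ℝ :=
  {r | ∃ n : ℕ, 1 ≤ n ∧ ∃ E : Fin n → Finset ℕ, IsSuccessive E ∧
    r = (∑ j, N (c00Restrict (E j) a)) / (n : ℝ) ^ (1 / p.conjExponent)}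

/-- The recursive sequence of norms `‖a‖₀ = ‖a‖_∞`,
`‖a‖ₘ₊₁ = max {‖a‖_∞, γ sup (∑ⱼ ‖Eⱼ a‖ₘ) / n ^ (1 / q)}`. -/
def tirilmanIter (p γ : ℝ) : ℕ → (ℕ →₀ ℝ) → ℝ
  | 0, a => c00Sup a
  | m + 1, a => max (c00Sup a) (γ * sSup (tirilmanAverages p (tirilmanIter p γ m) a))

/-- The Tirilman norm, the limit (and supremum) of the increasing sequence `tirilmanIter`. The
implicit equation that defines it is `tirilmanNorm_eq` below. -/
def tirilmanNorm (p γ : ℝ) (a : ℕ →₀ ℝ) : ℝ := ⨆ m, tirilmanIter p γ m a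

/-- The parameters `1 < p < ∞` and `0 < γ < 1` of a Tirilman space. -/
structure TirilmanParam where
  p : ℝ
  γ : ℝ
  one_lt_p : 1 < p
  γ_pos : 0 < γ
  γ_lt_one : γ < 1

/-! The facts below show that `tirilmanNorm` is a norm satisfying the implicit equation. -/

/-- The `ℓ₁` norm on `c₀₀`. -/
def c00L1 (a : ℕ →₀ ℝ) : ℝ := ∑ i ∈ a.support, |a i|

lemma abs_le_c00L1 (a : ℕ →₀ ℝ) (i : ℕ) : |a i| ≤ c00L1 a := by
  by_cases h : i ∈ a.support
  · exact Finset.single_le_sum (f := fun i => |a i|) (fun _ _ => abs_nonneg _) h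
  · rw [Finsupp.notMem_support_iff.1 h, abs_zero]
    exact Finset.sum_nonneg fun _ _ => abs_nonneg _

lemma c00Sup_bdd (a : ℕ →₀ ℝ) : BddAbove (Set.range fun i => |a i|) :=
  ⟨c00L1 a, by rintro _ ⟨i, rfl⟩; exact abs_le_c00L1 a i⟩

lemma abs_le_c00Sup (a : ℕ →₀ ℝ) (i : ℕ) : |a i| ≤ c00Sup a := le_ciSup (c00Sup_bdd a) i

lemma c00Sup_nonneg (a : ℕ →₀ ℝ) : 0 ≤ c00Sup a := (abs_nonneg _).trans (abs_le_c00Sup a 0)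

lemma c00Sup_le_c00L1 (a : ℕ →₀ ℝ) : c00Sup a ≤ c00L1 a := ciSup_le (abs_le_c00L1 a)

lemma c00L1_nonneg (a : ℕ →₀ ℝ) : 0 ≤ c00L1 a := (c00Sup_nonneg a).trans (c00Sup_le_c00L1 a)

lemma c00Sup_add (a b : ℕ →₀ ℝ) : c00Sup (a + b) ≤ c00Sup a + c00Sup b :=
  ciSup_le fun i => (abs_add_le (a i) (b i)).trans
    (add_le_add (abs_le_c00Sup a i) (abs_le_c00Sup b i))

lemma c00Sup_smul (c : ℝ) (a : ℕ →₀ ℝ) : c00Sup (c • a) = |c| * c00Sup a := by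
  simp only [c00Sup, Finsupp.smul_apply, smul_eq_mul, abs_mul]
  exact (Real.mul_iSup_of_nonneg (abs_nonneg c) _).symm

lemma sum_c00L1_restrict_le {n : ℕ} {E : Fin n → Finset ℕ} (hE : IsSuccessive E)
    (a : ℕ →₀ ℝ) : ∑ j, c00L1 (c00Restrict (E j) a) ≤ c00L1 a := by
  have h1 : ∀ j, c00L1 (c00Restrict (E j) a) = ∑ i ∈ a.support.filter (· ∈ E j), |a i| := by
    intro j
    unfold c00L1 c00Restrict
    rw [Finsupp.support_filter]
    refine Finset.sum_congr rfl fun i hi => ?_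
    rw [Finsupp.filter_apply_pos _ _ (Finset.mem_filter.1 hi).2]
  simp only [h1]
  rw [← Finset.sum_biUnion]
  · refine Finset.sum_le_sum_of_subset_of_nonneg ?_ fun _ _ _ => abs_nonneg _
    intro i hi
    obtain ⟨j, -, hj⟩ := Finset.mem_biUnion.1 hi
    exact (Finset.mem_filter.1 hj).1
  · intro i _ j _ hij
    refine Finset.disjoint_left.2 fun k hk hk' => ?_
    have hi := (Finset.mem_filter.1 hk).2
    have hj := (Finset.mem_filter.1 hk').2
    rcases lt_or_gt_of_ne hij with h | h
    · exact lt_irrefl _ (hE.2 i j h k hi k hj)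
    · exact lt_irrefl _ (hE.2 j i h k hj k hi)

lemma one_le_tirilman_weight {p : ℝ} (hp : 1 < p) {n : ℕ} (hn : 1 ≤ n) :
    1 ≤ (n : ℝ) ^ (1 / p.conjExponent) := by
  have := (Real.HolderConjugate.conjExponent hp).symm.pos
  exact Real.one_le_rpow (by exact_mod_cast hn) (by positivity)

lemma tirilmanAverages_le {p : ℝ} (hp : 1 < p) {N : (ℕ →₀ ℝ) → ℝ} (hN : ∀ a, N a ≤ c00L1 a)
    (a : ℕ →₀ ℝ) : ∀ r ∈ tirilmanAverages p N a, r ≤ c00L1 a := by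
  rintro r ⟨n, hn, E, hE, rfl⟩
  have hw := one_le_tirilman_weight hp hn
  rw [div_le_iff₀ (by linarith)]
  calc ∑ j, N (c00Restrict (E j) a) ≤ ∑ j, c00L1 (c00Restrict (E j) a) :=
        Finset.sum_le_sum fun j _ => hN _
    _ ≤ c00L1 a := sum_c00L1_restrict_le hE a
    _ ≤ c00L1 a * _ := le_mul_of_one_le_right (c00L1_nonneg a) hw

lemma tirilmanAverages_bdd {p : ℝ} (hp : 1 < p) {N : (ℕ →₀ ℝ) → ℝ} (hN : ∀ a, N a ≤ c00L1 a)
    (a : ℕ →₀ ℝ) : BddAbove (tirilmanAverages p N a) :=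
  ⟨_, tirilmanAverages_le hp hN a⟩

lemma tirilmanAverages_nonempty (p : ℝ) (N : (ℕ →₀ ℝ) → ℝ) (a : ℕ →₀ ℝ) :
    (tirilmanAverages p N a).Nonempty := by
  refine ⟨_, 1, le_rfl, fun _ => {0}, ⟨fun _ => ⟨0, by simp⟩, ?_⟩, rfl⟩
  intro i j h
  exact absurd h (by omega)

namespace TirilmanParam

variable (P : TirilmanParam)

lemma iter_nonneg (m : ℕ) (a : ℕ →₀ ℝ) : 0 ≤ tirilmanIter P.p P.γ m a := by
  cases m with
  | zero => exact c00Sup_nonneg a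
  | succ m => exact (c00Sup_nonneg a).trans (le_max_left _ _)

lemma c00Sup_le_iter (m : ℕ) (a : ℕ →₀ ℝ) : c00Sup a ≤ tirilmanIter P.p P.γ m a := by
  cases m with
  | zero => exact le_rfl
  | succ m => exact le_max_left _ _

lemma iter_le_c00L1 (m : ℕ) : ∀ a, tirilmanIter P.p P.γ m a ≤ c00L1 a := by
  induction m with
  | zero => exact c00Sup_le_c00L1
  | succ m ih =>
    intro a
    refine max_le (c00Sup_le_c00L1 a) ?_
    have h := csSup_le (tirilmanAverages_nonempty P.p _ a) (tirilmanAverages_le P.one_lt_p ih a)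
    have h0 := c00L1_nonneg a
    have := P.γ_pos
    have := P.γ_lt_one
    nlinarith

lemma iter_bdd (a : ℕ →₀ ℝ) : BddAbove (Set.range fun m => tirilmanIter P.p P.γ m a) :=
  ⟨c00L1 a, by rintro _ ⟨m, rfl⟩; exact P.iter_le_c00L1 m a⟩

lemma iter_le_norm (m : ℕ) (a : ℕ →₀ ℝ) :
    tirilmanIter P.p P.γ m a ≤ tirilmanNorm P.p P.γ a := le_ciSup (P.iter_bdd a) m

lemma norm_le_c00L1 (a : ℕ →₀ ℝ) : tirilmanNorm P.p P.γ a ≤ c00L1 a :=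
  ciSup_le fun m => P.iter_le_c00L1 m a

lemma csSup_averages_mono {N N' : (ℕ →₀ ℝ) → ℝ} (h : ∀ a, N a ≤ N' a)
    (hN' : ∀ a, N' a ≤ c00L1 a) (a : ℕ →₀ ℝ) :
    sSup (tirilmanAverages P.p N a) ≤ sSup (tirilmanAverages P.p N' a) := by
  refine csSup_le (tirilmanAverages_nonempty _ _ _) ?_
  rintro r ⟨n, hn, E, hE, rfl⟩
  refine le_csSup_of_le (tirilmanAverages_bdd P.one_lt_p hN' a) ⟨n, hn, E, hE, rfl⟩ ?_
  have hw := one_le_tirilman_weight P.one_lt_p hn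
  gcongr
  exact h _

lemma iter_mono_succ (m : ℕ) :
    ∀ a, tirilmanIter P.p P.γ m a ≤ tirilmanIter P.p P.γ (m + 1) a := by
  induction m with
  | zero => exact fun a => le_max_left _ _
  | succ m ih =>
    intro a
    exact max_le_max le_rfl (mul_le_mul_of_nonneg_left
      (P.csSup_averages_mono ih (P.iter_le_c00L1 _) a) P.γ_pos.le)

lemma iter_tendsto (a : ℕ →₀ ℝ) :
    Tendsto (fun m => tirilmanIter P.p P.γ m a) atTop (𝓝 (tirilmanNorm P.p P.γ a)) :=
  tendsto_atTop_ciSup (monotone_nat_of_le_succ fun m => P.iter_mono_succ m a) (P.iter_bdd a)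

/-- The implicit equation defining the Tirilman norm:
`‖a‖ = max {‖a‖_∞, γ sup (∑ⱼ ‖Eⱼ a‖) / n ^ (1 / q)}`. -/
theorem tirilmanNorm_eq (a : ℕ →₀ ℝ) :
    tirilmanNorm P.p P.γ a =
      max (c00Sup a) (P.γ * sSup (tirilmanAverages P.p (tirilmanNorm P.p P.γ) a)) := by
  apply le_antisymm
  · refine ciSup_le fun m => (P.iter_mono_succ m a).trans ?_
    exact max_le_max le_rfl (mul_le_mul_of_nonneg_left
      (P.csSup_averages_mono (P.iter_le_norm m) P.norm_le_c00L1 a) P.γ_pos.le)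
  · refine max_le (P.iter_le_norm 0 a) ?_
    rw [← le_div_iff₀' P.γ_pos]
    refine csSup_le (tirilmanAverages_nonempty _ _ _) ?_
    rintro r ⟨n, hn, E, hE, rfl⟩
    have ht : Tendsto (fun m => (∑ j, tirilmanIter P.p P.γ m (c00Restrict (E j) a)) /
        (n : ℝ) ^ (1 / P.p.conjExponent)) atTop (𝓝 ((∑ j, tirilmanNorm P.p P.γ
        (c00Restrict (E j) a)) / (n : ℝ) ^ (1 / P.p.conjExponent))) :=
      (tendsto_finsetSum _ fun j _ => P.iter_tendsto _).div_const _
    refine le_of_tendsto' ht fun m => ?_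
    rw [le_div_iff₀' P.γ_pos]
    refine le_trans ?_ (P.iter_le_norm (m + 1) a)
    refine le_trans ?_ (le_max_right _ _)
    exact mul_le_mul_of_nonneg_left
      (le_csSup (tirilmanAverages_bdd P.one_lt_p (P.iter_le_c00L1 m) a) ⟨n, hn, E, hE, rfl⟩)
      P.γ_pos.le

lemma iter_add (m : ℕ) : ∀ a b, tirilmanIter P.p P.γ m (a + b) ≤
    tirilmanIter P.p P.γ m a + tirilmanIter P.p P.γ m b := by
  induction m with
  | zero => exact c00Sup_add
  | succ m ih =>
    intro a b
    refine max_le ((c00Sup_add a b).trans (add_le_add (le_max_left _ _) (le_max_left _ _))) ?_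
    refine le_trans ?_ (add_le_add (le_max_right _ _) (le_max_right _ _))
    rw [← mul_add]
    refine mul_le_mul_of_nonneg_left ?_ P.γ_pos.le
    refine csSup_le (tirilmanAverages_nonempty _ _ _) ?_
    rintro r ⟨n, hn, E, hE, rfl⟩
    have hbd := fun c => tirilmanAverages_bdd P.one_lt_p (P.iter_le_c00L1 m) c
    refine le_trans ?_ (add_le_add (le_csSup (hbd a) ⟨n, hn, E, hE, rfl⟩)
      (le_csSup (hbd b) ⟨n, hn, E, hE, rfl⟩))
    have hw := one_le_tirilman_weight P.one_lt_p hn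
    rw [← add_div, ← Finset.sum_add_distrib]
    gcongr with j
    simp only [c00Restrict, Finsupp.filter_add]
    exact ih _ _

open scoped Pointwise in
lemma iter_smul (c : ℝ) (m : ℕ) : ∀ a, tirilmanIter P.p P.γ m (c • a) =
    |c| * tirilmanIter P.p P.γ m a := by
  induction m with
  | zero => exact c00Sup_smul c
  | succ m ih =>
    intro a
    have h : tirilmanAverages P.p (tirilmanIter P.p P.γ m) (c • a) =
        |c| • tirilmanAverages P.p (tirilmanIter P.p P.γ m) a := by
      ext r
      simp only [Set.mem_smul_set, tirilmanAverages, Set.mem_setOf_eq, c00Restrict,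
        Finsupp.filter_smul, ih, ← Finset.mul_sum, smul_eq_mul, mul_div_assoc]
      constructor
      · rintro ⟨n, hn, E, hE, rfl⟩
        exact ⟨_, ⟨n, hn, E, hE, rfl⟩, rfl⟩
      · rintro ⟨_, ⟨n, hn, E, hE, rfl⟩, rfl⟩
        exact ⟨n, hn, E, hE, rfl⟩
    simp only [tirilmanIter]
    rw [h, Real.sSup_smul_of_nonneg (abs_nonneg c), c00Sup_smul,
      mul_max_of_nonneg _ _ (abs_nonneg c), smul_eq_mul]
    ring_nf

/-- The space `c₀₀` of finitely supported real sequences, to carry the Tirilman norm. -/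
def C00 (_P : TirilmanParam) : Type := ℕ →₀ ℝ

instance : AddCommGroup P.C00 := inferInstanceAs (AddCommGroup (ℕ →₀ ℝ))

instance : Module ℝ P.C00 := inferInstanceAs (Module ℝ (ℕ →₀ ℝ))

instance : Norm P.C00 := ⟨fun a => tirilmanNorm P.p P.γ a⟩

lemma abs_le_norm (a : P.C00) (j : ℕ) : |(show ℕ →₀ ℝ from a) j| ≤ ‖a‖ :=
  (abs_le_c00Sup _ j).trans (P.iter_le_norm 0 _)

lemma normCore : NormedSpace.Core ℝ P.C00 where
  norm_nonneg a := (abs_nonneg _).trans (P.abs_le_norm a 0)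
  norm_smul c a := by
    change (⨆ m, tirilmanIter P.p P.γ m (c • (show ℕ →₀ ℝ from a))) = |c| * ⨆ m, _
    rw [Real.mul_iSup_of_nonneg (abs_nonneg c)]
    exact iSup_congr fun m => P.iter_smul c m _
  norm_triangle a b :=
    ciSup_le fun m => (P.iter_add m _ _).trans
      (add_le_add (P.iter_le_norm m _) (P.iter_le_norm m _))
  norm_eq_zero_iff a := by
    constructor
    · intro h
      refine Finsupp.ext fun j => ?_
      have := P.abs_le_norm a j
      rw [h] at this
      exact abs_nonpos_iff.1 this
    · rintro rfl
      refine le_antisymm ((P.norm_le_c00L1 _).trans ?_) ((abs_nonneg _).trans (P.abs_le_norm 0 0))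
      exact (Finset.sum_eq_zero fun i _ => abs_zero).le

instance : NormedAddCommGroup P.C00 := NormedAddCommGroup.ofCore P.normCore

instance : NormedSpace ℝ P.C00 := NormedSpace.ofCore P.normCore

/-- The `j`-th coordinate functional on `c₀₀`, which is continuous for the Tirilman norm. -/
def coordC00 (j : ℕ) : P.C00 →L[ℝ] ℝ :=
  LinearMap.mkContinuous (Finsupp.lapply j : (ℕ →₀ ℝ) →ₗ[ℝ] ℝ) 1 fun a => by
    rw [one_mul]
    exact P.abs_le_norm a j

end TirilmanParam

/-- The Tirilman space `Ti(p, γ)`: the completion of `c₀₀` with the Tirilman norm. -/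
abbrev TirilmanSpace (P : TirilmanParam) : Type := UniformSpace.Completion P.C00

/-- The canonical basis `(eⱼ)` of `Ti(p, γ)`, consisting of the unit vectors of `c₀₀`. -/
def tirilmanBasis (P : TirilmanParam) (j : ℕ) : TirilmanSpace P :=
  ((show P.C00 from Finsupp.single j 1 : P.C00) : UniformSpace.Completion P.C00)

/-- The dual Tirilman space `Ti*(p, γ)` of bounded linear functionals on `Ti(p, γ)`, with the
operator norm. -/
abbrev DualTirilmanSpace (P : TirilmanParam) : Type := StrongDual ℝ (TirilmanSpace P)

/-- The canonical basis `(e*ⱼ)` of `Ti*(p, γ)`: `e*ⱼ` is the `j`-th coordinate functional, the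
continuous extension of `a ↦ aⱼ` from `c₀₀` to its completion. -/
def dualTirilmanBasis (P : TirilmanParam) (j : ℕ) : DualTirilmanSpace P :=
  (P.coordC00 j).extend (UniformSpace.Completion.toComplL : P.C00 →L[ℝ] TirilmanSpace P)

lemma dualTirilmanBasis_coe (P : TirilmanParam) (j : ℕ) (a : P.C00) :
    dualTirilmanBasis P j (a : UniformSpace.Completion P.C00) = (show ℕ →₀ ℝ from a) j :=
  ContinuousLinearMap.extend_eq (P.coordC00 j)
    (e := (UniformSpace.Completion.toComplL : P.C00 →L[ℝ] TirilmanSpace P))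
    UniformSpace.Completion.denseRange_coe
    (UniformSpace.Completion.isUniformInducing_coe P.C00) a

/-- The sequences `(eⱼ)` and `(e*ⱼ)` are biorthogonal. -/
lemma dualTirilmanBasis_basis (P : TirilmanParam) (i j : ℕ) :
    dualTirilmanBasis P j (tirilmanBasis P i) = if i = j then 1 else 0 := by
  rw [tirilmanBasis, dualTirilmanBasis_coe]
  exact Finsupp.single_apply

end Tirilman

/-!
Everything rests on the behaviour of block sequences in `Ti(p, γ)` and, by duality, in
`Ti*(p, γ)`. Functionals are handled through their coefficients `f (e i)`, for which the dual norm
is a lattice norm.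

*The basis.* In `Ti(p, γ)` blocks of norm at most `1` satisfy an upper `ℓ_p` estimate with
constant `4` (`nrm_sum_block_le`): a splitting into `n` successive sets cuts only about `n` of the
blocks, and the uncut ones are handled by induction with the factor `γ`. So the basis of
`Ti(p, γ)` is shrinking, and the coordinate functionals are a Schauder basis of the dual
(`tendsto_partialSum`). They are `1`-unconditional and isometrically equivalent to their
subsequences, because spreading the coordinates and replacing blocks by unit vectors do not
increase the norm of `Ti(p, γ)` (`nrm_mapDomain_le`, `nrm_sum_single_restrict_le`).

*No symmetry.* On a dyadic interval of length `2 ^ R`, take the vector with about `2 ^ (R - v)`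
coordinates of size `2 ^ (v / p)` for each `v < R`. If the coordinates of different sizes are
interleaved, at the positions given by divisibility by powers of `2`, then the norm is of order
`2 ^ (R / p)`; if they are sorted, the `R` levels are successive vectors of norm of order
`2 ^ (R / p)`, and the norm gains a factor of order `R ^ (1 / p)` (`exists_perm_not_dominated`).

*Uniqueness.* In the dual, `K` successive functionals in the unit ball have a sum of norm at most
`K ^ (1 / q) / γ` (`norm_ofCoef_sum_le`). Together with a compactness argument this excludes lower
`ℓ₁` estimates (`not_lower_l1_estimate`), whereas a subsymmetric sequence that is not
coordinatewise null would satisfy one (`IsSubsymmetric.exists_lower_l1`). Hence a subsymmetric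
sequence is equivalent to a block sequence `h k` of norms between a positive constant and `1`, and
`h` is equivalent to its subsequences. Such a block sequence is dominated by the basis
(`norm_ofCoef_sum_block_le`). If its coefficients do not tend to `0` uniformly, then a subsequence
of it dominates a subsequence of the basis, and `h` is equivalent to the basis. The other case is
impossible. A finite combination of blocks with sufficiently small coefficients satisfies an upper
`ℓ_q` estimate, because the blocks can be cut into few pieces of about the same norm
(`exists_norm_sum_flat_le`), so all coefficient sequences that are `ℓ_q`-small on successive
intervals give convergent series along a sparse subsequence of `h`. But `h` itself has no upper
`ℓ_q` estimate (`not_upper_q_estimate`): a normalized block sequence in `Ti(p, γ)` has a normalized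
`ℓ_p` combination of norm at most `8 γ` (`exists_combination_nrm_le`), and for `γ < 1 / 32` this
contradicts, by duality, the existence of a best constant in such an estimate.
-/

noncomputable section

/-! ### Block sequences in `c₀₀` -/

/-- Finite sets `E i` such that every element of `E i` precedes every element of `E j` for `i < j`.
Unlike in `IsSuccessive`, the sets may be empty. -/
def Successive {ι : Type*} [LT ι] (E : ι → Finset ℕ) : Prop :=
  ∀ i j, i < j → ∀ k ∈ E i, ∀ l ∈ E j, k < l

/-- A block sequence: finitely supported vectors with successive supports. -/
def IsBlockSeq (x : ℕ → ℕ →₀ ℝ) : Prop := Successive fun k => (x k).support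

/-- The `ℓ_r` norm of the coefficients `b k`, `k ∈ S`. -/
def coeffNorm (r : ℝ) (S : Finset ℕ) (b : ℕ → ℝ) : ℝ := (∑ k ∈ S, |b k| ^ r) ^ (1 / r)

lemma c00Restrict_apply (E : Finset ℕ) (a : ℕ →₀ ℝ) (i : ℕ) :
    c00Restrict E a i = if i ∈ E then a i else 0 := by
  simp [c00Restrict, Finsupp.filter_apply]

lemma c00Restrict_support (E : Finset ℕ) (a : ℕ →₀ ℝ) :
    (c00Restrict E a).support = a.support.filter (· ∈ E) := Finsupp.support_filter _ _

lemma c00Restrict_sum {ι : Type*} (E : Finset ℕ) (S : Finset ι) (f : ι → ℕ →₀ ℝ) :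
    c00Restrict E (∑ k ∈ S, f k) = ∑ k ∈ S, c00Restrict E (f k) := by
  ext i
  simp only [c00Restrict_apply, Finsupp.finsetSum_apply]
  split_ifs <;> simp

lemma c00Restrict_add (E : Finset ℕ) (a b : ℕ →₀ ℝ) :
    c00Restrict E (a + b) = c00Restrict E a + c00Restrict E b := Finsupp.filter_add

lemma c00Restrict_smul (E : Finset ℕ) (c : ℝ) (a : ℕ →₀ ℝ) :
    c00Restrict E (c • a) = c • c00Restrict E a := Finsupp.filter_smul

lemma abs_c00Restrict_le (E : Finset ℕ) (a : ℕ →₀ ℝ) (i : ℕ) : |c00Restrict E a i| ≤ |a i| := by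
  rw [c00Restrict_apply]; split_ifs <;> simp

lemma c00Restrict_eq_zero {E : Finset ℕ} {a : ℕ →₀ ℝ} (h : ∀ i ∈ E, a i = 0) :
    c00Restrict E a = 0 := by
  ext i; rw [c00Restrict_apply]; split_ifs with hi
  · simpa using h i hi
  · rfl

lemma c00Restrict_eq_self {E : Finset ℕ} {a : ℕ →₀ ℝ} (h : a.support ⊆ E) :
    c00Restrict E a = a := by
  ext i; rw [c00Restrict_apply]; split_ifs with hi
  · rfl
  · exact (Finsupp.notMem_support_iff.1 fun h' => hi (h h')).symm

lemma c00L1_eq_sum {S : Finset ℕ} {a : ℕ →₀ ℝ} (h : a.support ⊆ S) :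
    c00L1 a = ∑ i ∈ S, |a i| :=
  Finset.sum_subset h fun i _ hi => by rw [Finsupp.notMem_support_iff.1 hi, abs_zero]

lemma c00L1_add_le (a b : ℕ →₀ ℝ) : c00L1 (a + b) ≤ c00L1 a + c00L1 b := by
  classical
  rw [c00L1_eq_sum (Finsupp.support_add (g₁ := a) (g₂ := b)),
    c00L1_eq_sum (Finset.subset_union_left (s₁ := a.support) (s₂ := b.support)),
    c00L1_eq_sum (Finset.subset_union_right (s₁ := a.support) (s₂ := b.support)),
    ← Finset.sum_add_distrib]
  exact Finset.sum_le_sum fun i _ => abs_add_le _ _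

lemma c00L1_zero : c00L1 0 = 0 := by simp [c00L1]

lemma c00L1_smul (c : ℝ) (a : ℕ →₀ ℝ) : c00L1 (c • a) = |c| * c00L1 a := by
  rw [c00L1_eq_sum (Finsupp.support_smul (b := c) (g := a)), c00L1, Finset.mul_sum]
  simp [abs_mul]

lemma c00L1_sum_le {ι : Type*} (S : Finset ι) (f : ι → ℕ →₀ ℝ) :
    c00L1 (∑ k ∈ S, f k) ≤ ∑ k ∈ S, c00L1 (f k) :=
  Finset.le_sum_of_subadditive c00L1 c00L1_zero.le c00L1_add_le S f

lemma c00Sup_mono {a b : ℕ →₀ ℝ} (h : ∀ i, |a i| ≤ |b i|) : c00Sup a ≤ c00Sup b :=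
  ciSup_le fun i => (h i).trans (abs_le_c00Sup b i)

lemma coeffNorm_nonneg (r : ℝ) (S : Finset ℕ) (b : ℕ → ℝ) : 0 ≤ coeffNorm r S b :=
  Real.rpow_nonneg (Finset.sum_nonneg fun _ _ => Real.rpow_nonneg (abs_nonneg _) _) _

lemma coeffNorm_mono {r : ℝ} (hr : 0 < r) {S T : Finset ℕ} (h : S ⊆ T) (b : ℕ → ℝ) :
    coeffNorm r S b ≤ coeffNorm r T b := by
  have h0 : ∀ k, 0 ≤ |b k| ^ r := fun k => Real.rpow_nonneg (abs_nonneg _) _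
  exact Real.rpow_le_rpow (Finset.sum_nonneg fun k _ => h0 k)
    (Finset.sum_le_sum_of_subset_of_nonneg h fun k _ _ => h0 k) (by positivity)

lemma abs_le_coeffNorm {r : ℝ} (hr : 0 < r) {S : Finset ℕ} (b : ℕ → ℝ) {k : ℕ} (hk : k ∈ S) :
    |b k| ≤ coeffNorm r S b := by
  have := coeffNorm_mono hr (Finset.singleton_subset_iff.2 hk) b
  rwa [coeffNorm, Finset.sum_singleton, one_div, Real.rpow_rpow_inv (abs_nonneg _) hr.ne'] at this

lemma coeffNorm_smul {r : ℝ} (hr : 0 < r) (S : Finset ℕ) (c : ℝ) (b : ℕ → ℝ) :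
    coeffNorm r S (fun k => c * b k) = |c| * coeffNorm r S b := by
  simp only [coeffNorm, abs_mul, Real.mul_rpow (abs_nonneg _) (abs_nonneg _), ← Finset.mul_sum]
  rw [Real.mul_rpow (by positivity) (Finset.sum_nonneg fun _ _ => by positivity), one_div,
    Real.rpow_rpow_inv (abs_nonneg _) hr.ne']

/-- A block sequence has at most one member that does not vanish at a given coordinate. -/
lemma IsBlockSeq.eq_of_apply_ne_zero {x : ℕ → ℕ →₀ ℝ} (hx : IsBlockSeq x) {k l i : ℕ}
    (hk : x k i ≠ 0) (hl : x l i ≠ 0) : k = l := by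
  rcases lt_trichotomy k l with h | h | h
  · exact absurd (hx k l h i (Finsupp.mem_support_iff.2 hk) i (Finsupp.mem_support_iff.2 hl))
      (lt_irrefl _)
  · exact h
  · exact absurd (hx l k h i (Finsupp.mem_support_iff.2 hl) i (Finsupp.mem_support_iff.2 hk))
      (lt_irrefl _)

lemma IsBlockSeq.comp {x : ℕ → ℕ →₀ ℝ} (hx : IsBlockSeq x) {φ : ℕ → ℕ} (hφ : StrictMono φ) :
    IsBlockSeq (x ∘ φ) := fun _ _ hij => hx _ _ (hφ hij)

lemma IsBlockSeq.mono {x y : ℕ → ℕ →₀ ℝ} (hx : IsBlockSeq x)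
    (h : ∀ k, (y k).support ⊆ (x k).support) : IsBlockSeq y :=
  fun i j hij k hk l hl => hx i j hij k (h _ hk) l (h _ hl)

lemma IsBlockSeq.restrict {x : ℕ → ℕ →₀ ℝ} (hx : IsBlockSeq x) (E : Finset ℕ) :
    IsBlockSeq fun k => c00Restrict E (x k) :=
  hx.mono fun k => by rw [c00Restrict_support]; exact Finset.filter_subset _ _

/-- The value of a block combination at a coordinate where the block `x k` does not vanish. -/
lemma IsBlockSeq.sum_apply {x : ℕ → ℕ →₀ ℝ} (hx : IsBlockSeq x) (S : Finset ℕ) (b : ℕ → ℝ)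
    {k i : ℕ} (hk : x k i ≠ 0) :
    (∑ l ∈ S, b l • x l) i = if k ∈ S then b k * x k i else 0 := by
  rw [Finsupp.finsetSum_apply]
  have h : ∀ l ∈ S, l ≠ k → (b l • x l) i = 0 := by
    intro l _ hl
    have : x l i = 0 := by
      by_contra h
      exact hl (hx.eq_of_apply_ne_zero h hk)
    simp [this]
  split_ifs with hkS
  · rw [Finset.sum_eq_single_of_mem k hkS h]; rfl
  · exact Finset.sum_eq_zero fun l hl => h l hl fun e => hkS (e ▸ hl)

/-- Pointwise comparison of block combinations. -/
lemma IsBlockSeq.abs_sum_apply_le {α β : ℕ → ℕ →₀ ℝ} (hβ : IsBlockSeq β)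
    (h : ∀ k i, |α k i| ≤ |β k i|) {S T : Finset ℕ} (hST : S ⊆ T) {a b : ℕ → ℝ}
    (hab : ∀ k ∈ S, |a k| ≤ |b k|) (i : ℕ) :
    |(∑ k ∈ S, a k • α k) i| ≤ |(∑ k ∈ T, b k • β k) i| := by
  have hne : ∀ k i, α k i ≠ 0 → β k i ≠ 0 := fun k i hk h0 => hk (by
    have := h k i
    rwa [h0, abs_zero, abs_nonpos_iff] at this)
  have hα : IsBlockSeq α := hβ.mono fun k i hi =>
    Finsupp.mem_support_iff.2 (hne k i (Finsupp.mem_support_iff.1 hi))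
  by_cases hex : ∃ k, α k i ≠ 0
  · obtain ⟨k, hk⟩ := hex
    rw [hα.sum_apply S a hk, hβ.sum_apply T b (hne k i hk)]
    by_cases hkS : k ∈ S
    · rw [if_pos hkS, if_pos (hST hkS), abs_mul, abs_mul]
      exact mul_le_mul (hab k hkS) (h k i) (abs_nonneg _) (abs_nonneg _)
    · rw [if_neg hkS, abs_zero]
      exact abs_nonneg _
  · push Not at hex
    rw [Finsupp.finsetSum_apply, Finset.sum_eq_zero fun k _ => ?_, abs_zero]
    · exact abs_nonneg _
    · rw [Finsupp.smul_apply, hex k, smul_zero]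

namespace TirilmanParam

variable (P : TirilmanParam)

/-! ### The Tirilman norm as a lattice norm -/

/-- The exponent conjugate to `p`. -/
abbrev q : ℝ := P.p.conjExponent

/-- The Tirilman norm with parameters `P`. -/
abbrev nrm (a : ℕ →₀ ℝ) : ℝ := tirilmanNorm P.p P.γ a

lemma holder : P.p.HolderConjugate P.q := Real.HolderConjugate.conjExponent P.one_lt_p

lemma p_pos : 0 < P.p := by linarith [P.one_lt_p]

lemma q_pos : 0 < P.q := P.holder.symm.pos

lemma one_lt_q : 1 < P.q := P.holder.symm.lt

lemma one_div_p_add_q : 1 / P.p + 1 / P.q = 1 := by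
  have := P.holder.inv_add_inv_eq_one
  simpa [one_div] using this

lemma nrm_nonneg (a : ℕ →₀ ℝ) : 0 ≤ P.nrm a := P.normCore.norm_nonneg a

lemma nrm_add_le (a b : ℕ →₀ ℝ) : P.nrm (a + b) ≤ P.nrm a + P.nrm b :=
  P.normCore.norm_triangle a b

lemma nrm_smul (c : ℝ) (a : ℕ →₀ ℝ) : P.nrm (c • a) = |c| * P.nrm a := P.normCore.norm_smul c a

lemma nrm_zero : P.nrm 0 = 0 := (P.normCore.norm_eq_zero_iff 0).2 rfl

lemma c00Sup_le_nrm (a : ℕ →₀ ℝ) : c00Sup a ≤ P.nrm a := P.iter_le_norm 0 a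

lemma abs_le_nrm (a : ℕ →₀ ℝ) (i : ℕ) : |a i| ≤ P.nrm a := P.abs_le_norm a i

lemma nrm_le_of_iter_le {a : ℕ →₀ ℝ} {C : ℝ} (h : ∀ m, tirilmanIter P.p P.γ m a ≤ C) :
    P.nrm a ≤ C := ciSup_le h

/-- How to bound the next norm in the recursion. -/
lemma iter_succ_le {m : ℕ} {a : ℕ →₀ ℝ} {C : ℝ} (h0 : c00Sup a ≤ C)
    (h : ∀ n : ℕ, 1 ≤ n → ∀ E : Fin n → Finset ℕ, IsSuccessive E →
      P.γ * ∑ j, tirilmanIter P.p P.γ m (c00Restrict (E j) a) ≤ (n : ℝ) ^ (1 / P.q) * C) :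
    tirilmanIter P.p P.γ (m + 1) a ≤ C := by
  refine max_le h0 ?_
  rw [← le_div_iff₀' P.γ_pos]
  refine csSup_le (tirilmanAverages_nonempty _ _ _) ?_
  rintro r ⟨n, hn, E, hE, rfl⟩
  have hw : 0 < (n : ℝ) ^ (1 / P.q) := by
    have : (0 : ℝ) < n := by exact_mod_cast hn
    positivity
  rw [le_div_iff₀' P.γ_pos, ← mul_div_assoc, div_le_iff₀' hw]
  exact h n hn E hE

/-- How to bound the Tirilman norm by the implicit equation. -/
lemma nrm_le {a : ℕ →₀ ℝ} {C : ℝ} (h0 : c00Sup a ≤ C)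
    (h : ∀ n : ℕ, 1 ≤ n → ∀ E : Fin n → Finset ℕ, IsSuccessive E →
      P.γ * ∑ j, P.nrm (c00Restrict (E j) a) ≤ (n : ℝ) ^ (1 / P.q) * C) :
    P.nrm a ≤ C := by
  refine P.nrm_le_of_iter_le fun m => ?_
  refine (P.iter_mono_succ m a).trans (P.iter_succ_le h0 fun n hn E hE => ?_)
  refine le_trans (mul_le_mul_of_nonneg_left ?_ P.γ_pos.le) (h n hn E hE)
  exact Finset.sum_le_sum fun j _ => P.iter_le_norm m _

lemma iter_mono_abs (m : ℕ) : ∀ {a b : ℕ →₀ ℝ}, (∀ i, |a i| ≤ |b i|) →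
    tirilmanIter P.p P.γ m a ≤ tirilmanIter P.p P.γ m b := by
  induction m with
  | zero => exact fun h => c00Sup_mono h
  | succ m ih =>
    intro a b h
    refine P.iter_succ_le ((c00Sup_mono h).trans (le_max_left _ _)) fun n hn E hE => ?_
    have hw := one_le_tirilman_weight P.one_lt_p hn
    have h1 : (∑ j, tirilmanIter P.p P.γ m (c00Restrict (E j) b)) / (n : ℝ) ^ (1 / P.q) ≤
        sSup (tirilmanAverages P.p (tirilmanIter P.p P.γ m) b) :=
      le_csSup (tirilmanAverages_bdd P.one_lt_p (P.iter_le_c00L1 m) b) ⟨n, hn, E, hE, rfl⟩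
    rw [div_le_iff₀' (by linarith)] at h1
    calc P.γ * ∑ j, tirilmanIter P.p P.γ m (c00Restrict (E j) a)
        ≤ P.γ * ∑ j, tirilmanIter P.p P.γ m (c00Restrict (E j) b) := by
          refine mul_le_mul_of_nonneg_left (Finset.sum_le_sum fun j _ => ih fun i => ?_) P.γ_pos.le
          simp only [c00Restrict_apply]
          split_ifs
          · exact h i
          · simp
      _ ≤ P.γ * ((n : ℝ) ^ (1 / P.q) * sSup (tirilmanAverages P.p (tirilmanIter P.p P.γ m) b)) :=
          mul_le_mul_of_nonneg_left h1 P.γ_pos.le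
      _ = (n : ℝ) ^ (1 / P.q) * (P.γ * sSup (tirilmanAverages P.p (tirilmanIter P.p P.γ m) b)) := by
          ring
      _ ≤ _ := mul_le_mul_of_nonneg_left (le_max_right _ _) (by linarith)

/-- The Tirilman norm is a lattice norm. -/
lemma nrm_mono_abs {a b : ℕ →₀ ℝ} (h : ∀ i, |a i| ≤ |b i|) : P.nrm a ≤ P.nrm b :=
  P.nrm_le_of_iter_le fun m => (P.iter_mono_abs m h).trans (P.iter_le_norm m b)

lemma nrm_restrict_le (E : Finset ℕ) (a : ℕ →₀ ℝ) : P.nrm (c00Restrict E a) ≤ P.nrm a :=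
  P.nrm_mono_abs (abs_c00Restrict_le E a)

lemma nrm_single (i : ℕ) (c : ℝ) : P.nrm (Finsupp.single i c) = |c| := by
  refine le_antisymm ((P.norm_le_c00L1 _).trans ?_) ?_
  · rw [c00L1_eq_sum (Finsupp.support_single_subset (a := i) (b := c))]
    simp
  · simpa using P.abs_le_nrm (Finsupp.single i c) i

/-- The lower estimate in the implicit equation, for successive and possibly empty sets. -/
lemma sum_nrm_restrict_le {ι : Type*} [LinearOrder ι] (J : Finset ι) {E : ι → Finset ℕ}
    (hE : ∀ i ∈ J, ∀ j ∈ J, i < j → ∀ k ∈ E i, ∀ l ∈ E j, k < l) (a : ℕ →₀ ℝ) :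
    P.γ * ∑ j ∈ J, P.nrm (c00Restrict (E j) a) ≤ (J.card : ℝ) ^ (1 / P.q) * P.nrm a := by
  classical
  have hq := P.q_pos
  set J' := J.filter fun j => (E j).Nonempty with hJ'
  have hsum : ∑ j ∈ J, P.nrm (c00Restrict (E j) a) = ∑ j ∈ J', P.nrm (c00Restrict (E j) a) := by
    refine (Finset.sum_subset (Finset.filter_subset _ _) fun j hj hj' => ?_).symm
    have : E j = ∅ := by
      by_contra h
      exact hj' (Finset.mem_filter.2 ⟨hj, Finset.nonempty_iff_ne_empty.2 h⟩)
    rw [c00Restrict_eq_zero (by simp [this]), P.nrm_zero]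
  have hcard : (J'.card : ℝ) ^ (1 / P.q) ≤ (J.card : ℝ) ^ (1 / P.q) :=
    Real.rpow_le_rpow (by positivity) (by exact_mod_cast Finset.card_filter_le _ _) (by positivity)
  refine le_trans ?_ (mul_le_mul_of_nonneg_right hcard (P.nrm_nonneg a))
  rw [hsum]
  rcases Nat.eq_zero_or_pos J'.card with h0 | hpos
  · rw [Finset.card_eq_zero.1 h0]
    simp only [Finset.sum_empty, mul_zero]
    exact mul_nonneg (by positivity) (P.nrm_nonneg a)
  · let e := J'.orderEmbOfFin rfl
    have hmem : ∀ i, e i ∈ J' := fun i => J'.orderEmbOfFin_mem rfl i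
    have hsucc : IsSuccessive fun i => E (e i) :=
      ⟨fun i => (Finset.mem_filter.1 (hmem i)).2, fun i j hij =>
        hE _ (Finset.mem_filter.1 (hmem i)).1 _ (Finset.mem_filter.1 (hmem j)).1
          (e.strictMono hij)⟩
    have hre : ∑ j ∈ J', P.nrm (c00Restrict (E j) a) =
        ∑ i, P.nrm (c00Restrict (E (e i)) a) := by
      have himg : Finset.univ.image e = J' := by
        rw [← Finset.coe_inj, Finset.coe_image, Finset.coe_univ, Set.image_univ]
        exact J'.range_orderEmbOfFin rfl
      conv_lhs => rw [← himg]
      exact Finset.sum_image fun i _ j _ h => e.injective h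
    have h1 : (∑ i, P.nrm (c00Restrict (E (e i)) a)) / (J'.card : ℝ) ^ (1 / P.q) ≤
        sSup (tirilmanAverages P.p P.nrm a) :=
      le_csSup (tirilmanAverages_bdd P.one_lt_p P.norm_le_c00L1 a) ⟨_, hpos, _, hsucc, rfl⟩
    have hw := one_le_tirilman_weight P.one_lt_p hpos
    rw [div_le_iff₀' (by linarith)] at h1
    have h2 : P.γ * sSup (tirilmanAverages P.p P.nrm a) ≤ P.nrm a := by
      conv_rhs => rw [nrm, P.tirilmanNorm_eq a]
      exact le_max_right _ _
    rw [hre]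
    calc _ ≤ P.γ * ((J'.card : ℝ) ^ (1 / P.q) * sSup (tirilmanAverages P.p P.nrm a)) :=
          mul_le_mul_of_nonneg_left h1 P.γ_pos.le
      _ = (J'.card : ℝ) ^ (1 / P.q) * (P.γ * sSup (tirilmanAverages P.p P.nrm a)) := by ring
      _ ≤ _ := mul_le_mul_of_nonneg_left h2 (by linarith)

/-! ### The upper `p`-estimate -/

lemma sum_mul_rpow_le {ι : Type*} (S : Finset ι) {f c : ι → ℝ} (hf : ∀ k ∈ S, 0 ≤ f k)
    (hc : ∀ k ∈ S, 0 ≤ c k) :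
    ∑ k ∈ S, f k * c k ^ (1 / P.q) ≤
      (∑ k ∈ S, f k ^ P.p) ^ (1 / P.p) * (∑ k ∈ S, c k) ^ (1 / P.q) := by
  refine (Real.inner_le_Lp_mul_Lq_of_nonneg S P.holder hf
    (fun k hk => Real.rpow_nonneg (hc k hk) _)).trans_eq ?_
  congr 2
  exact Finset.sum_congr rfl fun k hk => by
    rw [one_div, Real.rpow_inv_rpow (hc k hk) P.q_pos.ne']

lemma sum_rpow_le {ι : Type*} (S : Finset ι) {c : ι → ℝ} (hc : ∀ k ∈ S, 0 ≤ c k) :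
    ∑ k ∈ S, c k ^ (1 / P.p) ≤ (S.card : ℝ) ^ (1 / P.q) * (∑ k ∈ S, c k) ^ (1 / P.p) := by
  have := Real.inner_le_Lp_mul_Lq_of_nonneg S P.holder.symm (f := fun _ => 1)
    (g := fun k => c k ^ (1 / P.p)) (fun _ _ => zero_le_one) (fun k hk => Real.rpow_nonneg (hc k hk) _)
  simp only [one_mul, Real.one_rpow, Finset.sum_const, nsmul_eq_mul, mul_one] at this
  refine this.trans_eq ?_
  congr 2
  exact Finset.sum_congr rfl fun k hk => by
    rw [one_div, Real.rpow_inv_rpow (hc k hk) P.p_pos.ne']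

/-- Successive sets split few members of a block sequence: if `J k` is the set of those `j` for
which `E j` meets the support of `x k`, then `∑ (|J k| - 1) ≤ n`. -/
lemma exists_split_count {x : ℕ → ℕ →₀ ℝ} (hx : IsBlockSeq x) {n : ℕ} {E : Fin n → Finset ℕ}
    (hE : Successive E) (J : ℕ → Finset (Fin n)) (hJ : ∀ k j, j ∈ J k ↔ ∃ i ∈ E j, x k i ≠ 0)
    (S : Finset ℕ) (h2 : ∀ k ∈ S, 2 ≤ (J k).card) :
    S.card ≤ n ∧ ∑ k ∈ S, (J k).card ≤ 2 * n := by
  classical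
  set J' : ℕ → Finset (Fin n) := fun k => (J k).filter fun j => ∃ j' ∈ J k, j' < j with hJ'
  have hcard : ∀ k, (J k).card ≤ (J' k).card + 1 := by
    intro k
    rcases (J k).eq_empty_or_nonempty with h | h
    · simp [h]
    · refine (Finset.card_le_card (t := insert ((J k).min' h) (J' k)) fun j hj => ?_).trans
        (Finset.card_insert_le _ _)
      rcases eq_or_ne j ((J k).min' h) with h' | h'
      · exact Finset.mem_insert.2 (Or.inl h')
      · exact Finset.mem_insert_of_mem (Finset.mem_filter.2 ⟨hj, _, (J k).min'_mem h,
          lt_of_le_of_ne ((J k).min'_le j hj) h'.symm⟩)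
  have key : ∀ k l, k < l → ∀ j ∈ J' k, j ∉ J' l := by
    intro k l hkl j hj hj'
    obtain ⟨b, hb, hxb⟩ := (hJ k j).1 (Finset.mem_filter.1 hj).1
    obtain ⟨-, j', hj'l, hlt⟩ := Finset.mem_filter.1 hj'
    obtain ⟨a, ha, hxa⟩ := (hJ l j').1 hj'l
    have h1 := hx k l hkl b (Finsupp.mem_support_iff.2 hxb) a (Finsupp.mem_support_iff.2 hxa)
    have h2 := hE j' j hlt a ha b hb
    omega
  have hdisj : (S : Set ℕ).PairwiseDisjoint J' := by
    intro k _ l _ hkl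
    refine Finset.disjoint_left.2 fun j hj hj' => ?_
    rcases lt_or_gt_of_ne hkl with h | h
    · exact key k l h j hj hj'
    · exact key l k h j hj' hj
  have hn : ∑ k ∈ S, (J' k).card ≤ n := by
    rw [← Finset.card_biUnion hdisj]
    exact (Finset.card_le_univ _).trans_eq (Fintype.card_fin n)
  constructor
  · refine le_trans ?_ hn
    rw [Finset.card_eq_sum_ones]
    exact Finset.sum_le_sum fun k hk => by have := hcard k; have := h2 k hk; omega
  · refine le_trans ?_ (Nat.mul_le_mul_left 2 hn)
    rw [Finset.mul_sum]
    exact Finset.sum_le_sum fun k hk => by have := hcard k; have := h2 k hk; omega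

/-- The contribution of the blocks `x k`, `k ∈ T`, each of which is met by the sets `E j` with
`j ∈ J k`. -/
lemma sum_split_blocks_le {x : ℕ → ℕ →₀ ℝ} (hx1 : ∀ k, P.nrm (x k) ≤ 1)
    (T : Finset ℕ) (b : ℕ → ℝ) {n : ℕ} {E : Fin n → Finset ℕ}
    (hE : Successive E) (J : ℕ → Finset (Fin n)) (hT2 : ∑ k ∈ T, (J k).card ≤ 2 * n) :
    P.γ * ∑ j, ∑ k ∈ T, (if j ∈ J k then |b k| * P.nrm (c00Restrict (E j) (x k)) else 0) ≤
      (n : ℝ) ^ (1 / P.q) * (2 * coeffNorm P.p T b) := by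
  have hq := P.q_pos
  rw [Finset.sum_comm]
  have h3 : ∀ k ∈ T, P.γ * ∑ j, (if j ∈ J k then |b k| * P.nrm (c00Restrict (E j) (x k)) else 0)
      ≤ |b k| * ((J k).card : ℝ) ^ (1 / P.q) := by
    intro k _
    rw [← Finset.sum_filter, Finset.filter_univ_mem, ← Finset.mul_sum]
    have := P.sum_nrm_restrict_le (J k) (fun i _ j _ hij => hE i j hij) (x k)
    calc _ = |b k| * (P.γ * ∑ j ∈ J k, P.nrm (c00Restrict (E j) (x k))) := by
          rw [mul_left_comm]
      _ ≤ |b k| * (((J k).card : ℝ) ^ (1 / P.q) * 1) := by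
        refine mul_le_mul_of_nonneg_left (this.trans ?_) (abs_nonneg _)
        exact mul_le_mul_of_nonneg_left (hx1 k) (by positivity)
      _ = _ := by rw [mul_one]
  rw [Finset.mul_sum]
  refine (Finset.sum_le_sum h3).trans ((P.sum_mul_rpow_le T (fun k _ => abs_nonneg _)
    (fun k _ => by positivity)).trans ?_)
  have h4 : (∑ k ∈ T, ((J k).card : ℝ)) ^ (1 / P.q) ≤ 2 * (n : ℝ) ^ (1 / P.q) := by
    have h5 : (∑ k ∈ T, ((J k).card : ℝ)) ≤ 2 * n := by exact_mod_cast hT2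
    refine (Real.rpow_le_rpow (by positivity) h5 (by positivity)).trans ?_
    rw [Real.mul_rpow (by norm_num) (by positivity)]
    refine mul_le_mul_of_nonneg_right ?_ (by positivity)
    refine (Real.rpow_le_rpow_of_exponent_le (by norm_num) (y := 1 / P.q) (z := 1) ?_).trans_eq
      (Real.rpow_one 2)
    rw [div_le_one hq]
    exact P.one_lt_q.le
  calc _ ≤ coeffNorm P.p T b * (2 * (n : ℝ) ^ (1 / P.q)) :=
        mul_le_mul_of_nonneg_left h4 (coeffNorm_nonneg _ _ _)
    _ = _ := by ring

/-- The basic estimate for a block combination under a splitting into successive sets. The blocks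
that are not split contribute an `ℓ_p` sum with a factor `γ`; the split blocks, of which there are
at most `n`, contribute an `ℓ_p` sum without that factor. -/
lemma exists_sum_restrict_le {N : (ℕ →₀ ℝ) → ℝ} (hN0 : N 0 = 0)
    (hNadd : ∀ a b, N (a + b) ≤ N a + N b) (hNsmul : ∀ (c : ℝ) a, N (c • a) = |c| * N a)
    (hNle : ∀ a, N a ≤ P.nrm a) {x : ℕ → ℕ →₀ ℝ} (hx : IsBlockSeq x) (hx1 : ∀ k, P.nrm (x k) ≤ 1)
    (S : Finset ℕ) (b : ℕ → ℝ) {n : ℕ} {E : Fin n → Finset ℕ}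
    (hE : Successive E) {C : ℝ} (hC : 0 ≤ C)
    (hNC : ∀ j, ∀ A ⊆ S, N (c00Restrict (E j) (∑ k ∈ A, b k • x k)) ≤ C * coeffNorm P.p A b) :
    ∃ T ⊆ S, T.card ≤ n ∧ P.γ * ∑ j, N (c00Restrict (E j) (∑ k ∈ S, b k • x k)) ≤
      (n : ℝ) ^ (1 / P.q) * (P.γ * C * coeffNorm P.p S b + 2 * coeffNorm P.p T b) := by
  classical
  have hp := P.p_pos
  have hq := P.q_pos
  have hγ := P.γ_pos
  set J : ℕ → Finset (Fin n) := fun k => Finset.univ.filter fun j => ∃ i ∈ E j, x k i ≠ 0 with hJ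
  have hJm : ∀ k j, j ∈ J k ↔ ∃ i ∈ E j, x k i ≠ 0 := fun k j => by simp [hJ]
  have hJ0 : ∀ k j, j ∉ J k → c00Restrict (E j) (x k) = 0 := by
    intro k j hj
    refine c00Restrict_eq_zero fun i hi => ?_
    by_contra h
    exact hj ((hJm k j).2 ⟨i, hi, h⟩)
  set T := S.filter fun k => 2 ≤ (J k).card with hT
  obtain ⟨hT1, hT2⟩ := exists_split_count hx hE J hJm T fun k hk => (Finset.mem_filter.1 hk).2
  refine ⟨T, Finset.filter_subset _ _, hT1, ?_⟩
  set A : Fin n → Finset ℕ := fun j => S.filter fun k => ¬ 2 ≤ (J k).card ∧ j ∈ J k with hA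
  have hNsum : ∀ (U : Finset ℕ) (f : ℕ → ℕ →₀ ℝ), N (∑ k ∈ U, f k) ≤ ∑ k ∈ U, N (f k) :=
    fun U f => Finset.le_sum_of_subadditive N hN0.le hNadd U f
  have hsplit : ∀ j, N (c00Restrict (E j) (∑ k ∈ S, b k • x k)) ≤
      C * coeffNorm P.p (A j) b +
        ∑ k ∈ T, if j ∈ J k then |b k| * P.nrm (c00Restrict (E j) (x k)) else 0 := by
    intro j
    have hAS : A j ⊆ S := Finset.filter_subset _ _
    have hdec : c00Restrict (E j) (∑ k ∈ S, b k • x k) =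
        c00Restrict (E j) (∑ k ∈ A j, b k • x k) +
          ∑ k ∈ T, b k • c00Restrict (E j) (x k) := by
      simp only [c00Restrict_sum, c00Restrict_smul]
      rw [← Finset.sum_filter_add_sum_filter_not S (fun k => ¬ 2 ≤ (J k).card)]
      congr 1
      · refine (Finset.sum_subset (fun k hk => ?_) fun k hk hk' => ?_).symm
        · have := Finset.mem_filter.1 hk
          exact Finset.mem_filter.2 ⟨this.1, this.2.1⟩
        · have := Finset.mem_filter.1 hk
          rw [hJ0 k j fun h => hk' (Finset.mem_filter.2 ⟨this.1, this.2, h⟩), smul_zero]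
      · simp only [not_not]; rfl
    rw [hdec]
    refine (hNadd _ _).trans (add_le_add (hNC j _ hAS) ((hNsum _ _).trans ?_))
    refine Finset.sum_le_sum fun k _ => ?_
    rw [hNsmul]
    split_ifs with h
    · exact mul_le_mul_of_nonneg_left (hNle _) (abs_nonneg _)
    · rw [hJ0 k j h, hN0, mul_zero]
  have hAdisj : ((Finset.univ : Finset (Fin n)) : Set (Fin n)).PairwiseDisjoint A := by
    intro i _ j _ hij
    refine Finset.disjoint_left.2 fun k hk hk' => ?_
    have h1 := Finset.mem_filter.1 hk
    have h2 := Finset.mem_filter.1 hk'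
    exact h1.2.1 (Finset.one_lt_card.2 ⟨i, h1.2.2, j, h2.2.2, hij⟩)
  have hpow : ∀ k, 0 ≤ |b k| ^ P.p := fun k => Real.rpow_nonneg (abs_nonneg _) _
  have h1 : ∑ j, coeffNorm P.p (A j) b ≤ (n : ℝ) ^ (1 / P.q) * coeffNorm P.p S b := by
    refine (P.sum_rpow_le Finset.univ fun j _ => Finset.sum_nonneg fun k _ => hpow k).trans ?_
    rw [Finset.card_univ, Fintype.card_fin, ← Finset.sum_biUnion hAdisj]
    refine mul_le_mul_of_nonneg_left (coeffNorm_mono hp (fun k hk => ?_) b) (by positivity)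
    obtain ⟨j, -, hj⟩ := Finset.mem_biUnion.1 hk
    exact (Finset.mem_filter.1 hj).1
  have h2 := P.sum_split_blocks_le hx1 T b hE J hT2
  calc _ ≤ P.γ * ∑ j, (C * coeffNorm P.p (A j) b +
        ∑ k ∈ T, if j ∈ J k then |b k| * P.nrm (c00Restrict (E j) (x k)) else 0) :=
        mul_le_mul_of_nonneg_left (Finset.sum_le_sum fun j _ => hsplit j) hγ.le
    _ = P.γ * C * ∑ j, coeffNorm P.p (A j) b + P.γ * ∑ j, ∑ k ∈ T,
        (if j ∈ J k then |b k| * P.nrm (c00Restrict (E j) (x k)) else 0) := by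
        rw [Finset.sum_add_distrib, ← Finset.mul_sum]; ring
    _ ≤ P.γ * C * ((n : ℝ) ^ (1 / P.q) * coeffNorm P.p S b) +
        (n : ℝ) ^ (1 / P.q) * (2 * coeffNorm P.p T b) :=
        add_le_add (mul_le_mul_of_nonneg_left h1 (by positivity)) h2
    _ = _ := by ring

lemma c00Sup_sum_block_le {x : ℕ → ℕ →₀ ℝ} (hx : IsBlockSeq x) (hx1 : ∀ k, P.nrm (x k) ≤ 1)
    (S : Finset ℕ) (b : ℕ → ℝ) {C : ℝ} (hC : 0 ≤ C) (hb : ∀ k ∈ S, |b k| ≤ C) :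
    c00Sup (∑ k ∈ S, b k • x k) ≤ C := by
  refine ciSup_le fun i => ?_
  by_cases h : ∃ k, x k i ≠ 0
  · obtain ⟨k, hk⟩ := h
    rw [hx.sum_apply S b hk]
    split_ifs with hkS
    · rw [abs_mul]
      have h1 := (P.abs_le_nrm (x k) i).trans (hx1 k)
      calc |b k| * |x k i| ≤ C * 1 := mul_le_mul (hb k hkS) h1 (abs_nonneg _) hC
        _ = C := mul_one C
    · simpa using hC
  · push Not at h
    rw [Finsupp.finsetSum_apply, Finset.sum_eq_zero fun k _ => by simp [h k]]
    simpa using hC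

/-- Blocks of norm at most one satisfy an upper `p`-estimate. -/
theorem nrm_sum_block_le (hγ : P.γ ≤ 1 / 2) {x : ℕ → ℕ →₀ ℝ} (hx : IsBlockSeq x)
    (hx1 : ∀ k, P.nrm (x k) ≤ 1) (S : Finset ℕ) (b : ℕ → ℝ) :
    P.nrm (∑ k ∈ S, b k • x k) ≤ 4 * coeffNorm P.p S b := by
  refine P.nrm_le_of_iter_le fun m => ?_
  induction m generalizing x S with
  | zero =>
    have h0 := coeffNorm_nonneg P.p S b
    exact P.c00Sup_sum_block_le hx hx1 S b (by linarith) fun k hk =>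
      (abs_le_coeffNorm P.p_pos b hk).trans (by linarith)
  | succ m ih =>
    have h0 := coeffNorm_nonneg P.p S b
    refine P.iter_succ_le ?_ fun n hn E hE => ?_
    · exact P.c00Sup_sum_block_le hx hx1 S b (by linarith) fun k hk =>
        (abs_le_coeffNorm P.p_pos b hk).trans (by linarith)
    · have hz : tirilmanIter P.p P.γ m 0 = 0 :=
        le_antisymm ((P.iter_le_norm m 0).trans P.nrm_zero.le) (P.iter_nonneg m 0)
      obtain ⟨T, hT, -, h⟩ := P.exists_sum_restrict_le hz (P.iter_add m) (fun c => P.iter_smul c m)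
        (P.iter_le_norm m) hx hx1 S b hE.2 (C := 4) (by norm_num) fun j A _ => by
          rw [c00Restrict_sum]
          simp only [c00Restrict_smul]
          exact ih (hx.restrict _) (fun k => (P.nrm_restrict_le _ _).trans (hx1 k)) A
      refine h.trans (mul_le_mul_of_nonneg_left ?_ (by positivity))
      have h1 := coeffNorm_mono P.p_pos hT b
      nlinarith

/-! ### Averages at rapidly increasing scales -/

/-- A sequence of cut points starting at `0`, the lengths of whose gaps are prescribed by the left
end points. -/
def cutPoints (d : ℕ → ℕ) : ℕ → ℕ
  | 0 => 0
  | t + 1 => cutPoints d t + d (cutPoints d t)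

lemma cutPoints_strictMono {d : ℕ → ℕ} (hd : ∀ m, 0 < d m) : StrictMono (cutPoints d) :=
  strictMono_nat_of_lt_succ fun _ => Nat.lt_add_of_pos_right (hd _)

lemma exists_index_of_strictMono {c : ℕ → ℕ} (hc : StrictMono c) (h0 : c 0 = 0) :
    ∃ τ : ℕ → ℕ, (∀ i, c (τ i) ≤ i ∧ i < c (τ i + 1)) ∧
      ∀ t i, i ∈ Finset.Ico (c t) (c (t + 1)) → τ i = t := by
  have h : ∀ i, ∃ t, c t ≤ i ∧ i < c (t + 1) := by
    intro i
    have hex : ∃ t, i < c (t + 1) := ⟨i, lt_of_lt_of_le (Nat.lt_succ_self i) (hc.id_le _)⟩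
    refine ⟨Nat.find hex, ?_, Nat.find_spec hex⟩
    rcases Nat.eq_zero_or_pos (Nat.find hex) with h | h
    · rw [h, h0]; exact Nat.zero_le _
    · have := Nat.find_min hex (Nat.sub_lt h one_pos)
      rw [show Nat.find hex - 1 + 1 = Nat.find hex from Nat.sub_add_cancel h] at this
      omega
  choose τ h1 h2 using h
  refine ⟨τ, fun i => ⟨h1 i, h2 i⟩, fun t i hi => ?_⟩
  rw [Finset.mem_Ico] at hi
  have h3 : τ i < t + 1 := hc.lt_iff_lt.1 ((h1 i).trans_lt hi.2)
  have h4 : t < τ i + 1 := hc.lt_iff_lt.1 (hi.1.trans_lt (h2 i))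
  omega

/-- Some normalized `ℓ_p` combination of the members of a normalized block sequence has norm at
most `8 γ`. The combination is an `ℓ_p` average of `R` flat vectors of rapidly increasing lengths.
A splitting into `n` sets can split, with a loss of the factor `γ`, only the blocks in at most one
of these flat vectors: those of length at least `n` have too many blocks, and those followed by
another one of length less than `n` have a small `ℓ₁` norm. -/
theorem exists_combination_nrm_le (hγ : P.γ ≤ 1 / 2) {u : ℕ → ℕ →₀ ℝ} (hu : IsBlockSeq u)
    (hu1 : ∀ k, P.nrm (u k) ≤ 1) :
    ∃ (S : Finset ℕ) (β : ℕ → ℝ), (∀ k, 0 ≤ β k) ∧ ∑ k ∈ S, β k ^ P.p = 1 ∧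
      P.nrm (∑ k ∈ S, β k • u k) ≤ 8 * P.γ := by
  have hp := P.p_pos
  have hq := P.q_pos
  have hγ0 := P.γ_pos
  obtain ⟨R, hR0, hR⟩ : ∃ R : ℕ, 0 < R ∧ (1 / (R : ℝ)) ^ (1 / P.p) ≤ P.γ / 2 := by
    obtain ⟨R, hR⟩ := exists_nat_gt (1 / (P.γ / 2) ^ P.p)
    have hpos : (0 : ℝ) < 1 / (P.γ / 2) ^ P.p := by positivity
    have hR0 : (0 : ℝ) < R := hpos.trans hR
    refine ⟨R, by exact_mod_cast hR0, ?_⟩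
    have h1 : 1 / (R : ℝ) ≤ (P.γ / 2) ^ P.p := by
      rw [div_lt_iff₀ (by positivity)] at hR
      rw [div_le_iff₀ hR0]
      linarith
    calc (1 / (R : ℝ)) ^ (1 / P.p) ≤ ((P.γ / 2) ^ P.p) ^ (1 / P.p) :=
          Real.rpow_le_rpow (by positivity) h1 (by positivity)
      _ = P.γ / 2 := by rw [one_div, Real.rpow_rpow_inv (by positivity) hp.ne']
  have hRr : (0 : ℝ) < R := by exact_mod_cast hR0
  set d : ℕ → ℕ := fun m => ⌈(∑ i ∈ Finset.range m, c00L1 (u i)) ^ P.q⌉₊ + 1 with hd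
  set c := cutPoints d with hc
  have hcm : StrictMono c := cutPoints_strictMono fun m => Nat.succ_pos _
  have hcs : ∀ t, c (t + 1) = c t + d (c t) := fun t => rfl
  obtain ⟨τ, hτ', hτ⟩ := exists_index_of_strictMono hcm rfl
  set β : ℕ → ℝ := fun i => (1 / (R * d (c (τ i)) : ℝ)) ^ (1 / P.p) with hβ
  have hβ0 : ∀ k, 0 ≤ β k := fun k => by positivity
  have hdpos : ∀ m, (1 : ℝ) ≤ d m := fun m => by
    have : 1 ≤ d m := Nat.succ_le_succ (Nat.zero_le _)
    exact_mod_cast this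
  have hβp : ∀ t, ∀ i ∈ Finset.Ico (c t) (c (t + 1)), β i ^ P.p = 1 / (R * d (c t)) := by
    intro t i hi
    simp only [hβ, hτ t i hi]
    rw [one_div P.p, Real.rpow_inv_rpow (by positivity) hp.ne']
  have hβpR : ∀ i, β i ^ P.p ≤ 1 / R := by
    intro i
    simp only [hβ]
    rw [one_div P.p, Real.rpow_inv_rpow (by positivity) hp.ne']
    refine one_div_le_one_div_of_le hRr (le_mul_of_one_le_right hRr.le (hdpos _))
  have hβR : ∀ i, β i ≤ P.γ / 2 := by
    intro i
    refine le_trans ?_ hR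
    rw [one_div P.p, Real.le_rpow_inv_iff_of_pos (hβ0 i) (by positivity) hp]
    exact hβpR i
  have hsumt : ∀ t, ∑ i ∈ Finset.Ico (c t) (c (t + 1)), β i ^ P.p = 1 / R := by
    intro t
    rw [Finset.sum_congr rfl (hβp t), Finset.sum_const, Nat.card_Ico, hcs, Nat.add_sub_cancel_left,
      nsmul_eq_mul]
    have := hdpos (c t)
    field_simp
  have hsum : ∀ r, ∑ i ∈ Finset.range (c r), β i ^ P.p = r / R := by
    intro r
    induction r with
    | zero => simp [hc, cutPoints]
    | succ r ih =>
      rw [Finset.range_eq_Ico, ← Finset.sum_Ico_consecutive _ (Nat.zero_le _)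
        (hcm.monotone (Nat.le_succ r)), ← Finset.range_eq_Ico, ih, hsumt]
      push_cast
      ring
  have habs : ∀ k, |β k| = β k := fun k => abs_of_nonneg (hβ0 k)
  refine ⟨Finset.range (c R), β, hβ0, by rw [hsum, div_self hRr.ne'], ?_⟩
  refine P.nrm_le ?_ fun n hn E hE => ?_
  · exact P.c00Sup_sum_block_le hu hu1 _ β (by positivity) fun k _ => by
      rw [habs]; linarith [hβR k]
  have hn0 : (0 : ℝ) < n := by exact_mod_cast hn
  have hw0 : 0 < (n : ℝ) ^ (1 / P.q) := by positivity
  -- `T` separates the flat vectors of length at least `n` from the earlier ones.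
  obtain ⟨T, hTR, hT1, hT2⟩ : ∃ T ≤ R, (∀ t, T ≤ t → t < R → n ≤ d (c t)) ∧
      ∀ t, T = t + 1 → d (c t) < n := by
    classical
    have hex : ∃ T, ∀ t, T ≤ t → t < R → n ≤ d (c t) := ⟨R, fun t h1 h2 => by omega⟩
    refine ⟨Nat.find hex, Nat.find_min' hex fun t h1 h2 => by omega, Nat.find_spec hex, ?_⟩
    intro t ht
    have h1 := Nat.find_min hex (m := t) (by omega)
    push Not at h1
    obtain ⟨s, hs1, hs2, hs3⟩ := h1
    have h2 := Nat.find_spec hex s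
    rcases eq_or_lt_of_le hs1 with h | h
    · rwa [h]
    · exact absurd (h2 (by omega) hs2) (by omega)
  have hlow : P.γ * ∑ j, P.nrm (c00Restrict (E j) (∑ k ∈ Finset.range (c T), β k • u k)) ≤
      (n : ℝ) ^ (1 / P.q) * (3 * P.γ) := by
    rcases T with _ | t
    · have : c 0 = 0 := rfl
      rw [this]
      simp only [Finset.range_zero, Finset.sum_empty]
      rw [Finset.sum_eq_zero fun j _ => by rw [c00Restrict_eq_zero (by simp), P.nrm_zero]]
      rw [mul_zero]
      positivity
    have hlt : (d (c t) : ℝ) ≤ n := by exact_mod_cast (hT2 t rfl).le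
    rw [Finset.range_eq_Ico, ← Finset.sum_Ico_consecutive _ (Nat.zero_le _)
        (hcm.monotone (Nat.le_succ t)), ← Finset.range_eq_Ico]
    simp only [c00Restrict_add]
    have hA : ∑ j, P.nrm (c00Restrict (E j) (∑ k ∈ Finset.range (c t), β k • u k)) ≤
        (n : ℝ) ^ (1 / P.q) := by
      refine (Finset.sum_le_sum fun j _ => P.norm_le_c00L1 _).trans
        ((sum_c00L1_restrict_le hE _).trans ((c00L1_sum_le _ _).trans ?_))
      have h1 : ∑ k ∈ Finset.range (c t), c00L1 (β k • u k) ≤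
          ∑ k ∈ Finset.range (c t), c00L1 (u k) := by
        refine Finset.sum_le_sum fun k _ => ?_
        rw [c00L1_smul, habs]
        exact mul_le_of_le_one_left (c00L1_nonneg _) (by linarith [hβR k, P.γ_lt_one])
      refine h1.trans ?_
      have h0 : 0 ≤ ∑ k ∈ Finset.range (c t), c00L1 (u k) :=
        Finset.sum_nonneg fun k _ => c00L1_nonneg _
      rw [one_div, Real.le_rpow_inv_iff_of_pos h0 hn0.le hq]
      refine le_trans ?_ hlt
      refine (Nat.le_ceil _).trans ?_
      simp only [hd]
      push_cast
      linarith
    have hB : P.γ * ∑ j, P.nrm (c00Restrict (E j)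
        (∑ k ∈ Finset.Ico (c t) (c (t + 1)), β k • u k)) ≤ (n : ℝ) ^ (1 / P.q) * (2 * P.γ) := by
      refine (P.sum_nrm_restrict_le Finset.univ (fun i _ j _ h => hE.2 i j h) _).trans ?_
      rw [Finset.card_univ, Fintype.card_fin]
      refine mul_le_mul_of_nonneg_left ((P.nrm_sum_block_le hγ hu hu1 _ _).trans ?_) hw0.le
      rw [coeffNorm]
      simp only [habs]
      rw [hsumt]
      linarith
    calc _ ≤ P.γ * ∑ j, (P.nrm (c00Restrict (E j) (∑ k ∈ Finset.range (c t), β k • u k)) +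
          P.nrm (c00Restrict (E j) (∑ k ∈ Finset.Ico (c t) (c (t + 1)), β k • u k))) :=
          mul_le_mul_of_nonneg_left (Finset.sum_le_sum fun j _ => P.nrm_add_le _ _) hγ0.le
      _ ≤ P.γ * (n : ℝ) ^ (1 / P.q) + (n : ℝ) ^ (1 / P.q) * (2 * P.γ) := by
          rw [Finset.sum_add_distrib, mul_add]
          exact add_le_add (mul_le_mul_of_nonneg_left hA hγ0.le) hB
      _ = _ := by ring
  have hhigh : P.γ * ∑ j, P.nrm (c00Restrict (E j) (∑ k ∈ Finset.Ico (c T) (c R), β k • u k)) ≤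
      (n : ℝ) ^ (1 / P.q) * (5 * P.γ) := by
    obtain ⟨T', hT', hcard, h⟩ := P.exists_sum_restrict_le P.nrm_zero P.nrm_add_le P.nrm_smul
      (fun _ => le_rfl) hu hu1 (Finset.Ico (c T) (c R)) β hE.2 (C := 4) (by norm_num) fun j A _ =>
        (P.nrm_restrict_le _ _).trans (P.nrm_sum_block_le hγ hu hu1 A β)
    refine h.trans (mul_le_mul_of_nonneg_left ?_ hw0.le)
    have h1 : coeffNorm P.p (Finset.Ico (c T) (c R)) β ≤ 1 := by
      refine (coeffNorm_mono hp (T := Finset.range (c R)) (fun i hi => ?_) β).trans_eq ?_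
      · exact Finset.mem_range.2 (Finset.mem_Ico.1 hi).2
      · rw [coeffNorm]; simp only [habs]; rw [hsum, div_self hRr.ne', Real.one_rpow]
    have h2 : coeffNorm P.p T' β ≤ P.γ / 2 := by
      refine le_trans ?_ hR
      refine Real.rpow_le_rpow (Finset.sum_nonneg fun k _ => by positivity) ?_ (by positivity)
      have h3 : ∀ i ∈ T', |β i| ^ P.p ≤ 1 / (R * n) := by
        intro i hi
        rw [habs]
        obtain ⟨hi1, hi2⟩ := Finset.mem_Ico.1 (hT' hi)
        obtain ⟨ht1, ht2⟩ := hτ' i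
        set t := τ i
        have h4 : T < t + 1 := hcm.lt_iff_lt.1 (hi1.trans_lt ht2)
        have h5 : t < R := hcm.lt_iff_lt.1 (ht1.trans_lt hi2)
        rw [hβp t i (Finset.mem_Ico.2 ⟨ht1, ht2⟩)]
        have h6 : (n : ℝ) ≤ d (c t) := by exact_mod_cast hT1 t (by omega) h5
        exact one_div_le_one_div_of_le (by positivity) (mul_le_mul_of_nonneg_left h6 hRr.le)
      calc ∑ k ∈ T', |β k| ^ P.p ≤ T'.card • (1 / (R * n : ℝ)) := Finset.sum_le_card_nsmul _ _ _ h3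
        _ ≤ n * (1 / (R * n : ℝ)) := by
          rw [nsmul_eq_mul]
          refine mul_le_mul_of_nonneg_right ?_ (by positivity)
          exact_mod_cast hcard
        _ = 1 / R := by field_simp
    nlinarith
  rw [Finset.range_eq_Ico, ← Finset.sum_Ico_consecutive _ (Nat.zero_le _)
    (hcm.monotone hTR), ← Finset.range_eq_Ico]
  simp only [c00Restrict_add]
  calc _ ≤ P.γ * ∑ j, (P.nrm (c00Restrict (E j) (∑ k ∈ Finset.range (c T), β k • u k)) +
        P.nrm (c00Restrict (E j) (∑ k ∈ Finset.Ico (c T) (c R), β k • u k))) :=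
        mul_le_mul_of_nonneg_left (Finset.sum_le_sum fun j _ => P.nrm_add_le _ _) hγ0.le
    _ ≤ (n : ℝ) ^ (1 / P.q) * (3 * P.γ) + (n : ℝ) ^ (1 / P.q) * (5 * P.γ) := by
        rw [Finset.sum_add_distrib, mul_add]
        exact add_le_add hlow hhigh
    _ = _ := by ring

/-! ### Blocks dominate the basis, and the basis is spreading -/

/-- Replacing successive pieces of a vector by unit vectors multiplied by the norms of these pieces
does not increase the norm. Hence the basis is dominated by every normalized block sequence. -/
theorem nrm_sum_single_restrict_le {E : ℕ → Finset ℕ} (hE : Successive E) (S : Finset ℕ)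
    (a : ℕ →₀ ℝ) :
    P.nrm (∑ k ∈ S, Finsupp.single k (P.nrm (c00Restrict (E k) a))) ≤ P.nrm a := by
  classical
  refine P.nrm_le_of_iter_le fun m => ?_
  have happ : ∀ (S : Finset ℕ) (f : ℕ → ℝ) i,
      (∑ k ∈ S, Finsupp.single k (f k)) i = if i ∈ S then f i else 0 := by
    intro S f i
    simp [Finsupp.finsetSum_apply, Finsupp.single_apply]
  have hsup : ∀ (S : Finset ℕ) (a : ℕ →₀ ℝ),
      c00Sup (∑ k ∈ S, Finsupp.single k (P.nrm (c00Restrict (E k) a))) ≤ P.nrm a := by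
    intro S a
    refine ciSup_le fun i => ?_
    rw [happ]
    split_ifs
    · rw [abs_of_nonneg (P.nrm_nonneg _)]; exact P.nrm_restrict_le _ _
    · simpa using P.nrm_nonneg a
  induction m generalizing S a with
  | zero => exact hsup S a
  | succ m ih =>
    refine P.iter_succ_le (hsup S a) fun n hn F hF => ?_
    -- The coordinates in `F j` correspond to the union of the blocks `E k` with `k ∈ F j`.
    set G : Fin n → Finset ℕ := fun j => (F j).biUnion E with hG
    have h1 : ∀ j, tirilmanIter P.p P.γ m (c00Restrict (F j)
        (∑ k ∈ S, Finsupp.single k (P.nrm (c00Restrict (E k) a)))) ≤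
          P.nrm (c00Restrict (G j) a) := by
      intro j
      refine le_trans (P.iter_mono_abs m fun i => ?_) (ih (S ∩ F j) (c00Restrict (G j) a))
      rw [c00Restrict_apply, happ, happ]
      by_cases hiF : i ∈ F j
      · by_cases hiS : i ∈ S
        · rw [if_pos hiF, if_pos hiS, if_pos (Finset.mem_inter.2 ⟨hiS, hiF⟩)]
          have : c00Restrict (E i) (c00Restrict (G j) a) = c00Restrict (E i) a := by
            ext l
            simp only [c00Restrict_apply]
            by_cases hl : l ∈ E i
            · rw [if_pos hl, if_pos hl, if_pos (Finset.mem_biUnion.2 ⟨i, hiF, hl⟩)]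
            · rw [if_neg hl, if_neg hl]
          rw [this]
        · rw [if_pos hiF, if_neg hiS]; simp
      · rw [if_neg hiF]; simp
    refine (mul_le_mul_of_nonneg_left (Finset.sum_le_sum fun j _ => h1 j) P.γ_pos.le).trans ?_
    refine (P.sum_nrm_restrict_le Finset.univ (fun i _ j _ hij k hk l hl => ?_) a).trans_eq (by simp)
    obtain ⟨k', hk', hk⟩ := Finset.mem_biUnion.1 hk
    obtain ⟨l', hl', hl⟩ := Finset.mem_biUnion.1 hl
    exact hE k' l' (hF.2 i j hij k' hk' l' hl') k hk l hl

/-- Spreading the coordinates of a vector does not increase the norm. -/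
lemma nrm_mapDomain_le {φ : ℕ → ℕ} (hφ : StrictMono φ) (a : ℕ →₀ ℝ) :
    P.nrm (Finsupp.mapDomain φ a) ≤ P.nrm a := by
  classical
  refine P.nrm_le_of_iter_le fun m => ?_
  have happ : ∀ (a : ℕ →₀ ℝ) i, |Finsupp.mapDomain φ a i| ≤ c00Sup a := by
    intro a i
    by_cases h : i ∈ Set.range φ
    · obtain ⟨k, rfl⟩ := h
      rw [Finsupp.mapDomain_apply hφ.injective]
      exact abs_le_c00Sup a k
    · rw [Finsupp.mapDomain_of_notMem_range _ _ h]
      simpa using c00Sup_nonneg a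
  induction m generalizing a with
  | zero => exact (ciSup_le (happ a)).trans (P.c00Sup_le_nrm a)
  | succ m ih =>
    refine P.iter_succ_le ((ciSup_le (happ a)).trans (P.c00Sup_le_nrm a)) fun n hn F hF => ?_
    set G : Fin n → Finset ℕ := fun j => (F j).preimage φ hφ.injective.injOn with hG
    have h1 : ∀ j, c00Restrict (F j) (Finsupp.mapDomain φ a) =
        Finsupp.mapDomain φ (c00Restrict (G j) a) := by
      intro j
      ext i
      rw [c00Restrict_apply]
      by_cases h : i ∈ Set.range φ
      · obtain ⟨k, rfl⟩ := h
        rw [Finsupp.mapDomain_apply hφ.injective, Finsupp.mapDomain_apply hφ.injective,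
          c00Restrict_apply]
        simp [hG]
      · rw [Finsupp.mapDomain_of_notMem_range _ _ h, Finsupp.mapDomain_of_notMem_range _ _ h, ite_self]
    simp only [h1]
    refine (mul_le_mul_of_nonneg_left (Finset.sum_le_sum fun j _ => ih _) P.γ_pos.le).trans ?_
    refine (P.sum_nrm_restrict_le Finset.univ (fun i _ j _ hij k hk l hl => ?_) a).trans_eq (by simp)
    exact hφ.lt_iff_lt.1 (hF.2 i j hij _ (Finset.mem_preimage.1 hk) _ (Finset.mem_preimage.1 hl))

end TirilmanParam

/-! ### Interleaved and sorted levels -/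

/-- The vector with coordinates `w i` for `i ∈ J`. -/
def vecOn (J : Finset ℕ) (w : ℕ → ℝ) : ℕ →₀ ℝ := ∑ i ∈ J, Finsupp.single i (w i)

lemma vecOn_apply (J : Finset ℕ) (w : ℕ → ℝ) (i : ℕ) :
    vecOn J w i = if i ∈ J then w i else 0 := by
  classical
  simp [vecOn, Finsupp.finsetSum_apply, Finsupp.single_apply]

lemma c00Restrict_vecOn (E J : Finset ℕ) (w : ℕ → ℝ) :
    c00Restrict E (vecOn J w) = vecOn (J ∩ E) w := by
  ext i
  simp only [c00Restrict_apply, vecOn_apply, Finset.mem_inter]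
  split_ifs <;> simp_all

lemma c00L1_vecOn (J : Finset ℕ) (w : ℕ → ℝ) : c00L1 (vecOn J w) = ∑ i ∈ J, |w i| := by
  rw [c00L1_eq_sum (S := J)]
  · exact Finset.sum_congr rfl fun i hi => by rw [vecOn_apply, if_pos hi]
  · intro i hi
    by_contra h
    rw [Finsupp.mem_support_iff, vecOn_apply, if_neg h] at hi
    exact hi rfl

lemma two_pow_mul_odd_inj {v w j k : ℕ} (h : 2 ^ v * (2 * j + 1) = 2 ^ w * (2 * k + 1)) :
    v = w ∧ j = k := by
  have key : ∀ {v w j k : ℕ}, v < w → 2 ^ v * (2 * j + 1) ≠ 2 ^ w * (2 * k + 1) := by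
    intro v w j k hvw h
    obtain ⟨d, rfl⟩ := Nat.exists_eq_add_of_lt hvw
    have h1 : 2 * j + 1 = 2 * (2 ^ d * (2 * k + 1)) := by
      apply Nat.eq_of_mul_eq_mul_left (pow_pos two_pos v)
      rw [h, pow_succ, pow_add]; ring
    omega
  rcases lt_trichotomy v w with h1 | rfl | h1
  · exact absurd h (key h1)
  · have := Nat.eq_of_mul_eq_mul_left (pow_pos two_pos v) h
    exact ⟨rfl, by omega⟩
  · exact absurd h.symm (key h1)

/-- A permutation which, within each dyadic interval `[2 ^ R, 2 ^ (R + 1))`, takes sorted levels of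
divisibility by powers of `2` to their natural positions. It maps `2 ^ R + j` to
`2 ^ v * (2 * j + 1)`, with the `v` for which the image lies in the same dyadic interval. -/
lemma exists_perm_unsort : ∃ σ : Equiv.Perm ℕ, ∀ R t k, t < R → 2 ^ R + 2 ^ t ≤ k →
    k < 2 ^ R + 2 ^ (t + 1) → 2 ^ R ≤ σ k ∧ σ k < 2 ^ R + 2 ^ R ∧ 2 ^ (R - 1 - t) ∣ σ k := by
  classical
  set ex : ℕ → ℕ := fun k =>
    if k - 2 ^ Nat.log 2 k = 0 then Nat.log 2 k
      else Nat.log 2 k - 1 - Nat.log 2 (k - 2 ^ Nat.log 2 k) with hex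
  set f : ℕ → ℕ := fun k => if k = 0 then 0 else 2 ^ ex k * (2 * (k - 2 ^ Nat.log 2 k) + 1) with hf
  have hlow : ∀ k, k ≠ 0 → 2 ^ Nat.log 2 k ≤ k := fun k hk => Nat.pow_log_le_self 2 hk
  have hhigh : ∀ k, k < 2 ^ (Nat.log 2 k + 1) := fun k => Nat.lt_pow_succ_log_self one_lt_two k
  -- the image lies in the same dyadic interval
  have hlog : ∀ k, k ≠ 0 → 2 ^ Nat.log 2 k ≤ f k ∧ f k < 2 ^ (Nat.log 2 k + 1) := by
    intro k hk
    simp only [hf, if_neg hk, hex]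
    have h1 := hlow k hk
    have h2 := hhigh k
    set R := Nat.log 2 k
    rw [pow_succ] at h2
    split_ifs with hj
    · rw [hj, pow_succ]; have := pow_pos (two_pos (α := ℕ)) R; omega
    · have h3 := hlow _ hj
      have h4 := hhigh (k - 2 ^ R)
      have h5 : k - 2 ^ R < 2 ^ R := by omega
      generalize k - 2 ^ R = j at *
      set l := Nat.log 2 j
      have hlR : l < R := (Nat.pow_lt_pow_iff_right one_lt_two).1 (lt_of_le_of_lt h3 h5)
      have e1 : 2 ^ R = 2 ^ (R - 1 - l) * 2 ^ (l + 1) := by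
        rw [← pow_add]; congr 1; omega
      rw [pow_succ 2 R, e1, mul_assoc]
      rw [pow_succ] at h4 ⊢
      exact ⟨Nat.mul_le_mul_left _ (by omega),
        Nat.mul_lt_mul_of_pos_left (by omega) (pow_pos two_pos _)⟩
  have hf0 : ∀ k, k ≠ 0 → f k ≠ 0 := fun k hk => by
    have := (hlog k hk).1
    have := pow_pos (two_pos (α := ℕ)) (Nat.log 2 k)
    omega
  have hlogf : ∀ k, Nat.log 2 (f k) = Nat.log 2 k := by
    intro k
    rcases eq_or_ne k 0 with rfl | hk
    · simp [hf]
    · exact (Nat.log_eq_iff (Or.inr ⟨one_lt_two, hf0 k hk⟩)).2 (hlog k hk)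
  have hinj : Function.Injective f := by
    intro k l hkl
    have h1 : Nat.log 2 k = Nat.log 2 l := by rw [← hlogf k, ← hlogf l, hkl]
    rcases eq_or_ne k 0 with rfl | hk
    · by_contra hl
      exact hf0 l (Ne.symm hl) (by rw [← hkl]; simp [hf])
    · rcases eq_or_ne l 0 with rfl | hl
      · exact absurd (by rw [hkl]; simp [hf]) (hf0 k hk)
      · simp only [hf, if_neg hk, if_neg hl] at hkl
        have h2 := (two_pow_mul_odd_inj hkl).2
        have h3 := hlow k hk
        have h4 := hlow l hl
        rw [h1] at h2 h3
        omega
  have hsurj : Function.Surjective f := by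
    intro i
    set I := (Finset.range (2 ^ (Nat.log 2 i + 1))).filter fun k => Nat.log 2 k = Nat.log 2 i
    have hmap : ∀ k ∈ I, f k ∈ I := by
      intro k hk
      have hk2 := (Finset.mem_filter.1 hk).2
      refine Finset.mem_filter.2 ⟨Finset.mem_range.2 ?_, by rw [hlogf, hk2]⟩
      rw [← hk2, ← hlogf k]
      exact hhigh _
    have himg : I.image f = I := Finset.eq_of_subset_of_card_le
      (Finset.image_subset_iff.2 hmap) (Finset.card_image_of_injective I hinj).ge
    have hi : i ∈ I := Finset.mem_filter.2 ⟨Finset.mem_range.2 (hhigh i), rfl⟩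
    rw [← himg] at hi
    obtain ⟨k, -, hk⟩ := Finset.mem_image.1 hi
    exact ⟨k, hk⟩
  refine ⟨Equiv.ofBijective f ⟨hinj, hsurj⟩, fun R t k ht h1 h2 => ?_⟩
  have hp1 := pow_pos (two_pos (α := ℕ)) R
  have hp2 := pow_pos (two_pos (α := ℕ)) t
  have hk : k ≠ 0 := by omega
  have ht2 : 2 ^ (t + 1) ≤ 2 ^ R := Nat.pow_le_pow_right two_pos ht
  have hR : Nat.log 2 k = R :=
    (Nat.log_eq_iff (Or.inr ⟨one_lt_two, hk⟩)).2 ⟨by omega, by rw [pow_succ]; omega⟩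
  have hj : k - 2 ^ R ≠ 0 := by omega
  have ht' : Nat.log 2 (k - 2 ^ R) = t :=
    (Nat.log_eq_iff (Or.inr ⟨one_lt_two, hj⟩)).2 ⟨by omega, by omega⟩
  have h3 := hlog k hk
  rw [hR, pow_succ] at h3
  refine ⟨h3.1, by change f k < _; omega, ?_⟩
  change _ ∣ f k
  simp only [hf, hex, if_neg hk, hR, if_neg hj, ht']
  exact Dvd.intro _ rfl

lemma card_filter_dvd_le {s ℓ m : ℕ} (hm : 0 < m) {J : Finset ℕ} (hJ : J ⊆ Finset.Ico s (s + ℓ)) :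
    (((J.filter fun i => m ∣ i).card : ℕ) : ℝ) ≤ ℓ / m + 1 := by
  have hinj : (J.filter fun i => m ∣ i).card ≤ (Finset.range (ℓ / m + 1)).card := by
    -- `i ↦ (i - s) / m` is injective on the multiples of `m`
    refine Finset.card_le_card_of_injOn (fun i => (i - s) / m) (fun i hi => ?_) ?_
    · have := Finset.mem_Ico.1 (hJ (Finset.mem_filter.1 hi).1)
      exact Finset.mem_coe.2 (Finset.mem_range.2 (Nat.lt_succ_of_le
        (Nat.div_le_div_right (by omega))))
    · intro i hi i' hi' h
      have a1 := Finset.mem_Ico.1 (hJ (Finset.mem_filter.1 hi).1)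
      have a2 := Finset.mem_Ico.1 (hJ (Finset.mem_filter.1 hi').1)
      obtain ⟨x, rfl⟩ := (Finset.mem_filter.1 hi).2
      obtain ⟨y, rfl⟩ := (Finset.mem_filter.1 hi').2
      simp only at h
      have b1 := Nat.div_add_mod (m * x - s) m
      have b2 := Nat.div_add_mod (m * y - s) m
      have c1 := Nat.mod_lt (m * x - s) hm
      have c2 := Nat.mod_lt (m * y - s) hm
      rw [h] at b1
      have d1 : m * x < m * (y + 1) := by rw [mul_add]; omega
      have d2 : m * y < m * (x + 1) := by rw [mul_add]; omega
      have e1 := Nat.lt_of_mul_lt_mul_left d1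
      have e2 := Nat.lt_of_mul_lt_mul_left d2
      have : x = y := by omega
      rw [this]
  rw [Finset.card_range] at hinj
  calc (((J.filter fun i => m ∣ i).card : ℕ) : ℝ) ≤ ((ℓ / m + 1 : ℕ) : ℝ) := by exact_mod_cast hinj
    _ ≤ ℓ / m + 1 := by push_cast; linarith [Nat.cast_div_le (α := ℝ) (m := ℓ) (n := m)]

/-! ### The interleaved vector has a small norm -/

lemma rpow_two_pow (r : ℝ) (v : ℕ) : ((2 : ℝ) ^ v) ^ r = ((2 : ℝ) ^ r) ^ v := by
  rw [← Real.rpow_natCast, ← Real.rpow_natCast, ← Real.rpow_mul (by norm_num),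
    ← Real.rpow_mul (by norm_num), mul_comm]

/-- A geometric sum over the powers of `2` that are at most `y`. -/
lemma sum_two_pow_rpow_le {r : ℝ} (hr : 0 < r) (V : ℕ) {y : ℝ} (hy : 0 < y) :
    ∑ v ∈ (Finset.range V).filter (fun v => (2 : ℝ) ^ v ≤ y), ((2 : ℝ) ^ v) ^ r ≤
      (2 : ℝ) ^ r / ((2 : ℝ) ^ r - 1) * y ^ r := by
  have h1 : (1 : ℝ) < 2 ^ r := Real.one_lt_rpow (by norm_num) hr
  rcases ((Finset.range V).filter (fun v => (2 : ℝ) ^ v ≤ y)).eq_empty_or_nonempty with h | h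
  · rw [h, Finset.sum_empty]
    have : 0 < (2 : ℝ) ^ r - 1 := by linarith
    positivity
  · set S := (Finset.range V).filter (fun v => (2 : ℝ) ^ v ≤ y)
    set w := S.max' h
    have hw : (2 : ℝ) ^ w ≤ y := (Finset.mem_filter.1 (S.max'_mem h)).2
    have hsub : S ⊆ Finset.range (w + 1) := fun v hv =>
      Finset.mem_range.2 (Nat.lt_succ_of_le (S.le_max' v hv))
    simp only [rpow_two_pow]
    calc ∑ v ∈ S, ((2 : ℝ) ^ r) ^ v ≤ ∑ v ∈ Finset.range (w + 1), ((2 : ℝ) ^ r) ^ v :=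
          Finset.sum_le_sum_of_subset_of_nonneg hsub fun v _ _ => by positivity
      _ = (((2 : ℝ) ^ r) ^ (w + 1) - 1) / ((2 : ℝ) ^ r - 1) := geom_sum_eq h1.ne' _
      _ ≤ (2 : ℝ) ^ r / ((2 : ℝ) ^ r - 1) * ((2 : ℝ) ^ r) ^ w := by
          rw [div_mul_eq_mul_div, pow_succ']
          exact div_le_div_of_nonneg_right (by linarith) (by linarith)
      _ ≤ _ := by
          refine mul_le_mul_of_nonneg_left ?_ (div_nonneg (by positivity) (by linarith))
          rw [← rpow_two_pow]
          exact Real.rpow_le_rpow (by positivity) hw hr.le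

/-- A geometric sum over the powers of `2` that are larger than `y`. -/
lemma sum_two_pow_neg_rpow_le {r : ℝ} (hr : 0 < r) (V : ℕ) {y : ℝ} (hy : 0 < y) :
    ∑ v ∈ (Finset.range V).filter (fun v => y < (2 : ℝ) ^ v), ((2 : ℝ) ^ v) ^ (-r) ≤
      1 / (1 - (2 : ℝ) ^ (-r)) * y ^ (-r) := by
  have h1 : (2 : ℝ) ^ (-r) < 1 := Real.rpow_lt_one_of_one_lt_of_neg (by norm_num) (by linarith)
  rcases ((Finset.range V).filter (fun v => y < (2 : ℝ) ^ v)).eq_empty_or_nonempty with h | h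
  · rw [h, Finset.sum_empty]
    have : 0 < 1 - (2 : ℝ) ^ (-r) := by linarith
    positivity
  · set S := (Finset.range V).filter (fun v => y < (2 : ℝ) ^ v)
    set w := S.min' h
    have hw : y < (2 : ℝ) ^ w := (Finset.mem_filter.1 (S.min'_mem h)).2
    have hsub : S ⊆ Finset.Ico w V := fun v hv =>
      Finset.mem_Ico.2 ⟨S.min'_le v hv, Finset.mem_range.1 (Finset.mem_filter.1 hv).1⟩
    simp only [rpow_two_pow]
    calc ∑ v ∈ S, ((2 : ℝ) ^ (-r)) ^ v ≤ ∑ v ∈ Finset.Ico w V, ((2 : ℝ) ^ (-r)) ^ v :=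
          Finset.sum_le_sum_of_subset_of_nonneg hsub fun v _ _ => by positivity
      _ ≤ ((2 : ℝ) ^ (-r)) ^ w / (1 - (2 : ℝ) ^ (-r)) :=
          geom_sum_Ico_le_of_lt_one (by positivity) h1
      _ = 1 / (1 - (2 : ℝ) ^ (-r)) * ((2 : ℝ) ^ w) ^ (-r) := by rw [rpow_two_pow]; ring
      _ ≤ _ := by
          refine mul_le_mul_of_nonneg_left ?_ (div_nonneg (by positivity) (by linarith))
          exact Real.rpow_le_rpow_of_nonpos hy hw.le (by linarith)

namespace TirilmanParam

variable (P : TirilmanParam)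

/-- The sum of `2 ^ (v / p)` over those `v ∈ A` for which `2 ^ v` divides `i`. -/
def dyadicWeight (A : Finset ℕ) (i : ℕ) : ℝ :=
  ∑ v ∈ A.filter (fun v => 2 ^ v ∣ i), ((2 : ℝ) ^ v) ^ (1 / P.p)

lemma dyadicWeight_nonneg (A : Finset ℕ) (i : ℕ) : 0 ≤ P.dyadicWeight A i :=
  Finset.sum_nonneg fun _ _ => by positivity

lemma dyadicWeight_mono {A B : Finset ℕ} (h : A ⊆ B) (i : ℕ) :
    P.dyadicWeight A i ≤ P.dyadicWeight B i :=
  Finset.sum_le_sum_of_subset_of_nonneg (Finset.filter_subset_filter _ h) fun _ _ _ => by positivity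

lemma dyadicWeight_le_sum (A : Finset ℕ) (i : ℕ) :
    P.dyadicWeight A i ≤ ∑ v ∈ A, ((2 : ℝ) ^ v) ^ (1 / P.p) :=
  Finset.sum_le_sum_of_subset_of_nonneg (Finset.filter_subset _ _) fun _ _ _ => by positivity

/-- The `ℓ₁` norm of the coarse levels, those `v` with `y < 2 ^ v ≤ L`, on an interval of length at
most `L`. -/
lemma sum_dyadicWeight_le {V : ℕ} {y L : ℝ} (hy : 0 < y) {s ℓ : ℕ} (hℓ : (ℓ : ℝ) ≤ L)
    {J : Finset ℕ} (hJ : J ⊆ Finset.Ico s (s + ℓ)) :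
    ∑ i ∈ J, P.dyadicWeight ((Finset.range V).filter fun v => y < (2 : ℝ) ^ v ∧ (2 : ℝ) ^ v ≤ L) i ≤
      2 * L * (1 / (1 - (2 : ℝ) ^ (-(1 / P.q))) * y ^ (-(1 / P.q))) := by
  have hq := P.q_pos
  have hL : 0 ≤ L := le_trans (by positivity) hℓ
  have h1 : ∑ i ∈ J, P.dyadicWeight
      ((Finset.range V).filter fun v => y < (2 : ℝ) ^ v ∧ (2 : ℝ) ^ v ≤ L) i =
      ∑ v ∈ (Finset.range V).filter (fun v => y < (2 : ℝ) ^ v ∧ (2 : ℝ) ^ v ≤ L),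
        ((J.filter fun i => 2 ^ v ∣ i).card : ℝ) * ((2 : ℝ) ^ v) ^ (1 / P.p) := by
    simp only [dyadicWeight, Finset.sum_filter (fun v => 2 ^ v ∣ _)]
    rw [Finset.sum_comm]
    refine Finset.sum_congr rfl fun v _ => ?_
    rw [← Finset.sum_filter, Finset.sum_const, nsmul_eq_mul]
  rw [h1]
  have h2 : ∀ v ∈ (Finset.range V).filter (fun v => y < (2 : ℝ) ^ v ∧ (2 : ℝ) ^ v ≤ L),
      ((J.filter fun i => 2 ^ v ∣ i).card : ℝ) * ((2 : ℝ) ^ v) ^ (1 / P.p) ≤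
        2 * L * ((2 : ℝ) ^ v) ^ (-(1 / P.q)) := by
    intro v hv
    have hvL := (Finset.mem_filter.1 hv).2.2
    have h3 := card_filter_dvd_le (pow_pos two_pos v) hJ
    push_cast at h3
    have h2v : (0 : ℝ) < 2 ^ v := by positivity
    have h4 : ((J.filter fun i => 2 ^ v ∣ i).card : ℝ) ≤ 2 * L / 2 ^ v := by
      rw [le_div_iff₀ h2v]
      have : (ℓ : ℝ) / 2 ^ v * 2 ^ v = ℓ := by field_simp
      nlinarith
    have h5 : ((2 : ℝ) ^ v) ^ (-(1 / P.q)) = ((2 : ℝ) ^ v) ^ (1 / P.p) / 2 ^ v := by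
      rw [show -(1 / P.q) = 1 / P.p - 1 by linarith [P.one_div_p_add_q], Real.rpow_sub h2v,
        Real.rpow_one]
    rw [h5]
    calc _ ≤ 2 * L / 2 ^ v * ((2 : ℝ) ^ v) ^ (1 / P.p) :=
          mul_le_mul_of_nonneg_right h4 (by positivity)
      _ = _ := by ring
  refine (Finset.sum_le_sum h2).trans ?_
  rw [← Finset.mul_sum]
  refine mul_le_mul_of_nonneg_left (le_trans ?_ (sum_two_pow_neg_rpow_le (by positivity) V hy))
    (by positivity)
  refine Finset.sum_le_sum_of_subset_of_nonneg (fun v hv => ?_) fun _ _ _ => by positivity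
  have := Finset.mem_filter.1 hv
  exact Finset.mem_filter.2 ⟨this.1, this.2.1⟩

/-- The hulls of successive subsets of an interval have total length at most that of the
interval. -/
lemma exists_hull_length {n s ℓ : ℕ} {J : Finset ℕ} (hJ : J ⊆ Finset.Ico s (s + ℓ))
    {E : Fin n → Finset ℕ} (hE : Successive E) : ∃ t m : Fin n → ℕ,
      (∀ j, J ∩ E j ⊆ Finset.Ico (t j) (t j + m j)) ∧ ∑ j, m j ≤ ℓ := by
  classical
  have h : ∀ j, ∃ a b, a ≤ b ∧ J ∩ E j ⊆ Finset.Ico a b ∧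
      (a = b ∨ a ∈ J ∩ E j ∧ b - 1 ∈ J ∩ E j ∧ a < b) := by
    intro j
    rcases (J ∩ E j).eq_empty_or_nonempty with h | h
    · exact ⟨0, 0, le_rfl, by simp [h], Or.inl rfl⟩
    · refine ⟨(J ∩ E j).min' h, (J ∩ E j).max' h + 1, ?_, ?_, Or.inr ⟨Finset.min'_mem _ h, ?_, ?_⟩⟩
      · exact ((J ∩ E j).min'_le_max' h).trans (Nat.le_succ _)
      · exact fun i hi => Finset.mem_Ico.2 ⟨Finset.min'_le _ i hi,
          Nat.lt_succ_of_le (Finset.le_max' _ i hi)⟩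
      · exact Finset.max'_mem _ h
      · exact Nat.lt_succ_of_le ((J ∩ E j).min'_le_max' h)
  choose a b hab hsub hmem using h
  have hsubI : ∀ j, Finset.Ico (a j) (b j) ⊆ Finset.Ico s (s + ℓ) := by
    intro j i hi
    rw [Finset.mem_Ico] at hi ⊢
    rcases hmem j with h | ⟨h1, h2, h3⟩
    · omega
    · have h4 := Finset.mem_Ico.1 (hJ (Finset.mem_inter.1 h1).1)
      have h5 := Finset.mem_Ico.1 (hJ (Finset.mem_inter.1 h2).1)
      omega
  have hlt : ∀ i j, i < j → Disjoint (Finset.Ico (a i) (b i)) (Finset.Ico (a j) (b j)) := by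
    intro i j hij
    refine Finset.disjoint_left.2 fun k hk hk' => ?_
    rw [Finset.mem_Ico] at hk hk'
    rcases hmem i with h | ⟨-, h2, h3⟩
    · omega
    rcases hmem j with h | ⟨h4, -, h6⟩
    · omega
    have := hE i j hij _ (Finset.mem_inter.1 h2).2 _ (Finset.mem_inter.1 h4).2
    omega
  have hdisj : ((Finset.univ : Finset (Fin n)) : Set (Fin n)).PairwiseDisjoint
      fun j => Finset.Ico (a j) (b j) := by
    intro i _ j _ hij
    rcases lt_or_gt_of_ne hij with h | h
    · exact hlt i j h
    · exact (hlt j i h).symm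
  have hsum : ∑ j, (b j - a j) ≤ ℓ := by
    have := Finset.card_le_card (Finset.biUnion_subset.2 fun j (_ : j ∈ Finset.univ) => hsubI j)
    rw [Finset.card_biUnion hdisj] at this
    simpa using this
  refine ⟨a, fun j => b j - a j, fun j => ?_, hsum⟩
  rw [Nat.add_sub_cancel' (hab j)]
  exact hsub j

/-- The interleaved vector, with coordinate `i` about `|i|₂ ^ (-1 / p)` for the `2`-adic absolute
value, has on an interval of length at most `L` a norm of order `L ^ (1 / p)` when the levels `v`
with `2 ^ v > L` are removed. If it is split into `n` sets, the levels with `2 ^ v ≤ L / n` reproduce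
the situation on shorter intervals, and the other ones have a small `ℓ₁` norm. -/
theorem exists_nrm_dyadic_le (hγ : P.γ ≤ 1 / 4) : ∃ Q : ℝ, 0 < Q ∧ ∀ (V s ℓ : ℕ) (L : ℝ),
    0 < L → (ℓ : ℝ) ≤ L → ∀ J ⊆ Finset.Ico s (s + ℓ),
      P.nrm (vecOn J (P.dyadicWeight ((Finset.range V).filter fun v => (2 : ℝ) ^ v ≤ L))) ≤
        Q * L ^ (1 / P.p) := by
  have hp := P.p_pos
  have hq := P.q_pos
  have hγ0 := P.γ_pos
  set A : ℝ := (2 : ℝ) ^ (1 / P.p) / ((2 : ℝ) ^ (1 / P.p) - 1) with hA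
  set B : ℝ := 1 / (1 - (2 : ℝ) ^ (-(1 / P.q))) with hB
  have hA0 : 0 < A := by
    have : (1 : ℝ) < 2 ^ (1 / P.p) := Real.one_lt_rpow (by norm_num) (by positivity)
    exact div_pos (by positivity) (by linarith)
  have hB0 : 0 < B := by
    have : (2 : ℝ) ^ (-(1 / P.q)) < 1 :=
      Real.rpow_lt_one_of_one_lt_of_neg (by norm_num) (by simpa using hq)
    exact div_pos one_pos (by linarith)
  refine ⟨A + 2 * B, by positivity, fun V s ℓ L hL hℓ J hJ => ?_⟩
  refine P.nrm_le_of_iter_le fun m => ?_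
  have hsup : ∀ (L : ℝ) (J : Finset ℕ), 0 < L →
      c00Sup (vecOn J (P.dyadicWeight ((Finset.range V).filter fun v => (2 : ℝ) ^ v ≤ L))) ≤
        (A + 2 * B) * L ^ (1 / P.p) := by
    intro L J hL
    refine ciSup_le fun i => ?_
    have h0 : 0 ≤ (A + 2 * B) * L ^ (1 / P.p) := by positivity
    rw [vecOn_apply]
    split_ifs
    · rw [abs_of_nonneg (P.dyadicWeight_nonneg _ _)]
      refine (P.dyadicWeight_le_sum _ _).trans ((sum_two_pow_rpow_le (by positivity) V hL).trans ?_)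
      exact mul_le_mul_of_nonneg_right (by linarith) (by positivity)
    · simpa using h0
  induction m generalizing s ℓ L J with
  | zero => exact hsup L J hL
  | succ m ih =>
    refine P.iter_succ_le (hsup L J hL) fun n hn E hE => ?_
    have hn0 : (0 : ℝ) < n := by exact_mod_cast hn
    obtain ⟨t, len, hhull, hlen⟩ := exists_hull_length hJ hE.2
    set y := L / n with hy
    have hy0 : 0 < y := by positivity
    have hyL : y ≤ L := div_le_self hL.le (by exact_mod_cast hn)
    set L' : Fin n → ℝ := fun j => max (len j) y with hL'
    have hL'0 : ∀ j, 0 < L' j := fun j => lt_of_lt_of_le hy0 (le_max_right _ _)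
    set fine := (Finset.range V).filter fun v => (2 : ℝ) ^ v ≤ y with hfine
    set coarse := (Finset.range V).filter fun v => y < (2 : ℝ) ^ v ∧ (2 : ℝ) ^ v ≤ L with hcoarse
    set all := (Finset.range V).filter fun v => (2 : ℝ) ^ v ≤ L with hall
    have hle : ∀ i, P.dyadicWeight all i ≤ P.dyadicWeight fine i + P.dyadicWeight coarse i := by
      intro i
      have hsub : all ⊆ fine ∪ coarse := by
        intro v hv
        have hv := Finset.mem_filter.1 hv
        rcases le_or_gt ((2 : ℝ) ^ v) y with h | h
        · exact Finset.mem_union_left _ (Finset.mem_filter.2 ⟨hv.1, h⟩)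
        · exact Finset.mem_union_right _ (Finset.mem_filter.2 ⟨hv.1, h, hv.2⟩)
      refine (P.dyadicWeight_mono hsub i).trans_eq ?_
      rw [dyadicWeight, Finset.filter_union, Finset.sum_union]
      · rfl
      · refine Finset.disjoint_left.2 fun v hv hv' => ?_
        have h1 := (Finset.mem_filter.1 (Finset.mem_filter.1 hv).1).2
        have h2 := (Finset.mem_filter.1 (Finset.mem_filter.1 hv').1).2.1
        linarith
    have hj : ∀ j, tirilmanIter P.p P.γ m (c00Restrict (E j) (vecOn J (P.dyadicWeight all))) ≤
        (A + 2 * B) * L' j ^ (1 / P.p) + ∑ i ∈ J ∩ E j, P.dyadicWeight coarse i := by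
      intro j
      rw [c00Restrict_vecOn]
      set fine' := (Finset.range V).filter fun v => (2 : ℝ) ^ v ≤ L' j with hfine'
      have hff : fine ⊆ fine' := fun v hv => Finset.mem_filter.2
        ⟨(Finset.mem_filter.1 hv).1, (Finset.mem_filter.1 hv).2.trans (le_max_right _ _)⟩
      have h1 : tirilmanIter P.p P.γ m (vecOn (J ∩ E j) (P.dyadicWeight all)) ≤
          tirilmanIter P.p P.γ m (vecOn (J ∩ E j) (P.dyadicWeight fine') +
            vecOn (J ∩ E j) (P.dyadicWeight coarse)) := by
        refine P.iter_mono_abs m fun i => ?_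
        rw [Finsupp.add_apply, vecOn_apply, vecOn_apply, vecOn_apply]
        split_ifs
        · have a1 := P.dyadicWeight_nonneg all i
          have a2 := P.dyadicWeight_nonneg fine' i
          have a3 := P.dyadicWeight_nonneg coarse i
          rw [abs_of_nonneg a1, abs_of_nonneg (by linarith)]
          linarith [hle i, P.dyadicWeight_mono hff i]
        · simp
      refine h1.trans ((P.iter_add m _ _).trans (add_le_add ?_ ?_))
      · exact ih (t j) (len j) (L' j) (hL'0 j) (le_max_left _ _) _ (hhull j)
      · refine (P.iter_le_c00L1 m _).trans_eq ?_
        rw [c00L1_vecOn]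
        exact Finset.sum_congr rfl fun i _ => abs_of_nonneg (P.dyadicWeight_nonneg _ _)
    have hfineSum : ∑ j, L' j ^ (1 / P.p) ≤ (n : ℝ) ^ (1 / P.q) * (2 * L ^ (1 / P.p)) := by
      refine (P.sum_rpow_le Finset.univ fun j _ => (hL'0 j).le).trans ?_
      rw [Finset.card_univ, Fintype.card_fin]
      refine mul_le_mul_of_nonneg_left ?_ (by positivity)
      have h1 : ∑ j, L' j ≤ 2 * L := by
        calc ∑ j, L' j ≤ ∑ j, ((len j : ℝ) + y) :=
              Finset.sum_le_sum fun j _ => max_le_add_of_nonneg (by positivity) hy0.le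
          _ = ∑ j, (len j : ℝ) + n * y := by
              rw [Finset.sum_add_distrib, Finset.sum_const, Finset.card_univ, Fintype.card_fin,
                nsmul_eq_mul]
          _ ≤ L + L := by
              refine add_le_add (le_trans ?_ hℓ) (by rw [hy]; field_simp; exact le_rfl)
              exact_mod_cast hlen
          _ = 2 * L := by ring
      have h2 : (2 : ℝ) ^ (1 / P.p) ≤ 2 := by
        refine (Real.rpow_le_rpow_of_exponent_le (by norm_num) (y := 1 / P.p) (z := 1) ?_).trans_eq
          (Real.rpow_one 2)
        rw [div_le_one hp]
        exact P.one_lt_p.le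
      calc (∑ j, L' j) ^ (1 / P.p) ≤ (2 * L) ^ (1 / P.p) :=
            Real.rpow_le_rpow (Finset.sum_nonneg fun j _ => (hL'0 j).le) h1 (by positivity)
        _ = (2 : ℝ) ^ (1 / P.p) * L ^ (1 / P.p) := Real.mul_rpow (by norm_num) hL.le
        _ ≤ _ := mul_le_mul_of_nonneg_right h2 (by positivity)
    have hcoarseSum : ∑ j, ∑ i ∈ J ∩ E j, P.dyadicWeight coarse i ≤
        (n : ℝ) ^ (1 / P.q) * (2 * B * L ^ (1 / P.p)) := by
      have h1 : ∑ j, ∑ i ∈ J ∩ E j, P.dyadicWeight coarse i ≤ ∑ i ∈ J, P.dyadicWeight coarse i := by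
        have h2 := sum_c00L1_restrict_le hE (vecOn J (P.dyadicWeight coarse))
        simp only [c00Restrict_vecOn, c00L1_vecOn, abs_of_nonneg (P.dyadicWeight_nonneg _ _)] at h2
        exact h2
      refine h1.trans ((P.sum_dyadicWeight_le hy0 hℓ hJ).trans_eq ?_)
      have h3 : y ^ (-(1 / P.q)) = (n : ℝ) ^ (1 / P.q) * (L ^ (1 / P.p) / L) := by
        rw [hy, Real.div_rpow hL.le hn0.le, Real.rpow_neg hn0.le, div_inv_eq_mul,
          show -(1 / P.q) = 1 / P.p - 1 by linarith [P.one_div_p_add_q], Real.rpow_sub hL,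
          Real.rpow_one, mul_comm]
      rw [h3, ← hB]
      field_simp
    calc _ ≤ P.γ * ∑ j, ((A + 2 * B) * L' j ^ (1 / P.p) +
          ∑ i ∈ J ∩ E j, P.dyadicWeight coarse i) :=
          mul_le_mul_of_nonneg_left (Finset.sum_le_sum fun j _ => hj j) hγ0.le
      _ = P.γ * ((A + 2 * B) * ∑ j, L' j ^ (1 / P.p) +
          ∑ j, ∑ i ∈ J ∩ E j, P.dyadicWeight coarse i) := by
          rw [Finset.sum_add_distrib, Finset.mul_sum]
      _ ≤ 1 / 4 * ((A + 2 * B) * ((n : ℝ) ^ (1 / P.q) * (2 * L ^ (1 / P.p))) +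
          (n : ℝ) ^ (1 / P.q) * (2 * B * L ^ (1 / P.p))) := by
          refine mul_le_mul hγ (add_le_add (mul_le_mul_of_nonneg_left hfineSum (by positivity))
            hcoarseSum) ?_ (by norm_num)
          refine add_nonneg (mul_nonneg (by positivity) (Finset.sum_nonneg fun j _ =>
            Real.rpow_nonneg (hL'0 j).le _)) (Finset.sum_nonneg fun j _ =>
            Finset.sum_nonneg fun i _ => P.dyadicWeight_nonneg _ _)
      _ = (n : ℝ) ^ (1 / P.q) * ((A / 2 + 3 / 2 * B) * L ^ (1 / P.p)) := by ring
      _ ≤ _ := by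
          refine mul_le_mul_of_nonneg_left (mul_le_mul_of_nonneg_right ?_ (by positivity))
            (by positivity)
          linarith

/-! ### Rearrangements of the basis -/

/-- A vector with many large coordinates has a large norm. -/
lemma le_nrm_of_flat {T : Finset ℕ} {a : ℕ →₀ ℝ} {c : ℝ} (h : ∀ i ∈ T, c ≤ |a i|) :
    P.γ * (T.card : ℝ) ^ (1 / P.p) * c ≤ P.nrm a := by
  have hp := P.p_pos
  rcases T.eq_empty_or_nonempty with rfl | hT
  · rw [Finset.card_empty, Nat.cast_zero, Real.zero_rpow (by positivity),
      mul_zero, zero_mul]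
    exact P.nrm_nonneg a
  have hc : (0 : ℝ) < T.card := by exact_mod_cast Finset.card_pos.2 hT
  have h1 := P.sum_nrm_restrict_le T (E := fun i => {i}) (fun i _ j _ hij k hk l hl => by
    rw [Finset.mem_singleton.1 hk, Finset.mem_singleton.1 hl]; exact hij) a
  have h2 : (T.card : ℝ) * c ≤ ∑ i ∈ T, P.nrm (c00Restrict {i} a) := by
    rw [← nsmul_eq_mul]
    refine Finset.card_nsmul_le_sum _ _ _ fun i hi => (h i hi).trans ?_
    refine le_trans (le_of_eq ?_) (P.abs_le_nrm _ i)
    rw [c00Restrict_apply, if_pos (Finset.mem_singleton_self i)]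
  have h3 : (T.card : ℝ) = (T.card : ℝ) ^ (1 / P.q) * (T.card : ℝ) ^ (1 / P.p) := by
    rw [← Real.rpow_add hc, add_comm, P.one_div_p_add_q, Real.rpow_one]
  have hw : 0 < (T.card : ℝ) ^ (1 / P.q) := Real.rpow_pos_of_pos hc _
  refine le_of_mul_le_mul_left ?_ hw
  calc _ = P.γ * ((T.card : ℝ) ^ (1 / P.q) * (T.card : ℝ) ^ (1 / P.p) * c) := by ring
    _ = P.γ * (T.card * c) := by rw [← h3]
    _ ≤ _ := (mul_le_mul_of_nonneg_left h2 P.γ_pos.le).trans h1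

/-- The Tirilman norm is not symmetric, not even up to equivalence: sorting the levels of the
interleaved vector on `[2 ^ R, 2 ^ (R + 1))` turns its norm of order `2 ^ (R / p)` into one of order
`R ^ (1 / p) * 2 ^ (R / p)`. -/
theorem exists_perm_not_dominated (hγ : P.γ ≤ 1 / 4) : ∃ σ : Equiv.Perm ℕ,
    ¬ ∃ C : ℝ, ∀ b : ℕ →₀ ℝ, P.nrm b ≤ C * P.nrm (Finsupp.mapDomain σ b) := by
  have hp := P.p_pos
  have hγ0 := P.γ_pos
  obtain ⟨σ, hσ⟩ := exists_perm_unsort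
  obtain ⟨Q, hQ0, hQ⟩ := P.exists_nrm_dyadic_le hγ
  refine ⟨σ, ?_⟩
  rintro ⟨C, hC⟩
  have key : ∀ R : ℕ, 0 < R →
      P.γ * (P.γ * (R : ℝ) ^ (1 / P.p)) ≤ |C| * Q * (2 : ℝ) ^ (1 / P.p) := by
    intro R hR
    have hR0 : (0 : ℝ) < R := by exact_mod_cast hR
    set I : ℕ → Finset ℕ := fun t => Finset.Ico (2 ^ R + 2 ^ t) (2 ^ R + 2 ^ (t + 1)) with hI
    set c : ℕ → ℝ := fun t => ((2 : ℝ) ^ (R - 1 - t)) ^ (1 / P.p) with hc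
    have hc0 : ∀ t, 0 ≤ c t := fun t => by positivity
    set b : ℕ →₀ ℝ := ∑ t ∈ Finset.range R, vecOn (I t) fun _ => c t with hb
    have hIsucc : ∀ i j : ℕ, i < j → ∀ k ∈ I i, ∀ l ∈ I j, k < l := by
      intro i j hij k hk l hl
      rw [Finset.mem_Ico] at hk hl
      have : 2 ^ (i + 1) ≤ 2 ^ j := Nat.pow_le_pow_right two_pos hij
      omega
    have hbI : ∀ t ∈ Finset.range R, ∀ k ∈ I t, b k = c t := by
      intro t ht k hk
      rw [hb, Finsupp.finsetSum_apply, Finset.sum_eq_single_of_mem t ht]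
      · rw [vecOn_apply, if_pos hk]
      · intro s _ hs
        rw [vecOn_apply, if_neg]
        intro hk'
        rcases lt_or_gt_of_ne hs with h | h
        · exact lt_irrefl _ (hIsucc s t h k hk' k hk)
        · exact lt_irrefl _ (hIsucc t s h k hk k hk')
    have hb0 : ∀ k, (∀ t ∈ Finset.range R, k ∉ I t) → b k = 0 := by
      intro k hk
      rw [hb, Finsupp.finsetSum_apply]
      exact Finset.sum_eq_zero fun t ht => by rw [vecOn_apply, if_neg (hk t ht)]
    set M : ℝ := ((2 : ℝ) ^ (R - 1)) ^ (1 / P.p) with hM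
    have hM0 : 0 < M := by positivity
    have hlevel : ∀ t ∈ Finset.range R, P.γ * M ≤ P.nrm (c00Restrict (I t) b) := by
      intro t ht
      refine le_trans (le_of_eq ?_) (P.le_nrm_of_flat (T := I t) (c := c t) fun i hi => ?_)
      · have h1 : (I t).card = 2 ^ t := by
          rw [Nat.card_Ico, pow_succ]; omega
        rw [h1, hM, hc, mul_assoc, Nat.cast_pow, Nat.cast_ofNat,
          ← Real.mul_rpow (by positivity) (by positivity), ← pow_add]
        congr 4
        have := Finset.mem_range.1 ht
        omega
      · rw [c00Restrict_apply, if_pos hi, hbI t ht i hi]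
        exact le_abs_self _
    have hlow : P.γ * (P.γ * (R : ℝ) ^ (1 / P.p)) * M ≤ P.nrm b := by
      have h1 := P.sum_nrm_restrict_le (Finset.range R) (fun i _ j _ hij => hIsucc i j hij) b
      rw [Finset.card_range] at h1
      have h2 : (R : ℝ) * (P.γ * M) ≤ ∑ t ∈ Finset.range R, P.nrm (c00Restrict (I t) b) := by
        have := Finset.card_nsmul_le_sum _ _ _ hlevel
        rwa [Finset.card_range, nsmul_eq_mul] at this
      have h3 : (R : ℝ) = (R : ℝ) ^ (1 / P.q) * (R : ℝ) ^ (1 / P.p) := by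
        rw [← Real.rpow_add hR0, add_comm, P.one_div_p_add_q, Real.rpow_one]
      have hw : 0 < (R : ℝ) ^ (1 / P.q) := by positivity
      refine le_of_mul_le_mul_left ?_ hw
      calc _ = P.γ * ((R : ℝ) ^ (1 / P.q) * (R : ℝ) ^ (1 / P.p) * (P.γ * M)) := by ring
        _ = P.γ * (R * (P.γ * M)) := by rw [← h3]
        _ ≤ _ := (mul_le_mul_of_nonneg_left h2 hγ0.le).trans h1
    have hup : P.nrm (Finsupp.mapDomain σ b) ≤ Q * ((2 : ℝ) ^ R) ^ (1 / P.p) := by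
      refine le_trans (P.nrm_mono_abs fun i => ?_) (hQ R (2 ^ R) (2 ^ R) ((2 : ℝ) ^ R)
        (by positivity) (by push_cast; exact le_rfl) _ subset_rfl)
      obtain ⟨k, rfl⟩ := σ.surjective i
      rw [Finsupp.mapDomain_apply σ.injective, vecOn_apply]
      by_cases hk : ∃ t ∈ Finset.range R, k ∈ I t
      · obtain ⟨t, ht, hkt⟩ := hk
        have htR := Finset.mem_range.1 ht
        obtain ⟨h1, h2, h3⟩ := hσ R t k htR (Finset.mem_Ico.1 hkt).1 (Finset.mem_Ico.1 hkt).2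
        rw [hbI t ht k hkt, if_pos (Finset.mem_Ico.2 ⟨h1, h2⟩), abs_of_nonneg (hc0 t),
          abs_of_nonneg (P.dyadicWeight_nonneg _ _)]
        refine Finset.single_le_sum (f := fun v : ℕ => ((2 : ℝ) ^ v) ^ (1 / P.p))
          (fun _ _ => by positivity) (Finset.mem_filter.2 ⟨Finset.mem_filter.2
            ⟨Finset.mem_range.2 (by omega), ?_⟩, h3⟩)
        exact pow_le_pow_right₀ (by norm_num) (by omega)
      · push Not at hk
        rw [hb0 k hk, abs_zero]
        exact abs_nonneg _
    have h2R : ((2 : ℝ) ^ R) ^ (1 / P.p) = (2 : ℝ) ^ (1 / P.p) * M := by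
      rw [hM, ← Real.mul_rpow (by norm_num) (by positivity), ← pow_succ', Nat.sub_add_cancel hR]
    refine le_of_mul_le_mul_right ?_ hM0
    calc _ ≤ P.nrm b := hlow
      _ ≤ C * P.nrm (Finsupp.mapDomain σ b) := hC b
      _ ≤ |C| * (Q * ((2 : ℝ) ^ R) ^ (1 / P.p)) :=
          mul_le_mul (le_abs_self C) hup (P.nrm_nonneg _) (abs_nonneg C)
      _ = _ := by rw [h2R]; ring
  have ht : Tendsto (fun R : ℕ => P.γ * (P.γ * (R : ℝ) ^ (1 / P.p))) atTop atTop :=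
    (((tendsto_rpow_atTop (by positivity)).comp tendsto_natCast_atTop_atTop).const_mul_atTop
      hγ0).const_mul_atTop hγ0
  obtain ⟨R, hR, hR0⟩ := ((ht.eventually_gt_atTop (|C| * Q * (2 : ℝ) ^ (1 / P.p))).and
    (eventually_gt_atTop 0)).exists
  exact absurd (key R hR0) (not_le.2 hR)

/-! ### Functionals on the Tirilman space -/

/-- The inclusion of `c₀₀` in the Tirilman space. -/
def ofC00 : (ℕ →₀ ℝ) →ₗ[ℝ] TirilmanSpace P where
  toFun b := ((show P.C00 from b : P.C00) : UniformSpace.Completion P.C00)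
  map_add' a b := UniformSpace.Completion.coe_add (show P.C00 from a) (show P.C00 from b)
  map_smul' c a := UniformSpace.Completion.coe_smul c (show P.C00 from a)

lemma norm_ofC00 (b : ℕ →₀ ℝ) : ‖P.ofC00 b‖ = P.nrm b :=
  UniformSpace.Completion.norm_coe (show P.C00 from b)

lemma ofC00_single (i : ℕ) (c : ℝ) : P.ofC00 (Finsupp.single i c) = c • tirilmanBasis P i := by
  have : Finsupp.single i c = c • Finsupp.single i (1 : ℝ) := by simp
  rw [this, map_smul]
  rfl

/-- The `i`-th coefficient of a functional. -/
def coef (f : DualTirilmanSpace P) (i : ℕ) : ℝ := f (tirilmanBasis P i)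

/-- The functional with finitely many nonzero coefficients `a i`. -/
def ofCoef : (ℕ →₀ ℝ) →ₗ[ℝ] DualTirilmanSpace P :=
  Finsupp.linearCombination ℝ (dualTirilmanBasis P)

lemma apply_ofC00 (f : DualTirilmanSpace P) {S : Finset ℕ} {b : ℕ →₀ ℝ} (h : b.support ⊆ S) :
    f (P.ofC00 b) = ∑ i ∈ S, b i * P.coef f i := by
  have h1 : b = ∑ i ∈ S, Finsupp.single i (b i) := by
    ext i
    have := vecOn_apply S b i
    rw [vecOn] at this
    rw [this]
    split_ifs with hi
    · rfl
    · exact Finsupp.notMem_support_iff.1 fun h' => hi (h h')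
  conv_lhs => rw [h1]
  rw [map_sum, map_sum]
  exact Finset.sum_congr rfl fun i _ => by rw [ofC00_single, map_smul]; rfl

lemma coef_ofCoef (a : ℕ →₀ ℝ) (i : ℕ) : P.coef (P.ofCoef a) i = a i := by
  classical
  simp only [coef, ofCoef, Finsupp.linearCombination_apply, Finsupp.sum]
  rw [_root_.sum_apply]
  simp only [_root_.smul_apply, dualTirilmanBasis_basis, smul_eq_mul, mul_ite,
    mul_one, mul_zero]
  rw [Finset.sum_ite_eq]
  split_ifs with h
  · rfl
  · exact (Finsupp.notMem_support_iff.1 h).symm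

lemma norm_le_of_forall_c00 {f : DualTirilmanSpace P} {C : ℝ} (hC : 0 ≤ C)
    (h : ∀ b, |f (P.ofC00 b)| ≤ C * P.nrm b) : ‖f‖ ≤ C := by
  refine f.opNorm_le_bound hC fun x => ?_
  induction x using UniformSpace.Completion.induction_on with
  | hp => exact isClosed_le (by fun_prop) (by fun_prop)
  | ih a =>
    exact (h a).trans_eq (congrArg (C * ·) (P.norm_ofC00 a).symm)

lemma abs_apply_ofC00_le (f : DualTirilmanSpace P) (b : ℕ →₀ ℝ) :
    |f (P.ofC00 b)| ≤ ‖f‖ * P.nrm b := by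
  rw [← norm_ofC00]; exact f.le_opNorm _

/-- The dual norm is a lattice norm. -/
lemma norm_le_of_abs_coef_le {f g : DualTirilmanSpace P}
    (h : ∀ i, |P.coef f i| ≤ |P.coef g i|) : ‖f‖ ≤ ‖g‖ := by
  refine P.norm_le_of_forall_c00 (norm_nonneg _) fun b => ?_
  set b' : ℕ →₀ ℝ := vecOn b.support fun i => SignType.sign (P.coef g i) * |b i| with hb'
  have hb'le : ∀ i, |b' i| ≤ |b i| := by
    intro i
    rw [hb', vecOn_apply]
    split_ifs
    · rw [abs_mul, abs_abs]
      refine mul_le_of_le_one_left (abs_nonneg _) ?_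
      rcases lt_trichotomy (P.coef g i) 0 with h | h | h <;> simp [h]
    · simp
  have hsupp : b'.support ⊆ b.support := by
    intro i hi
    by_contra h'
    rw [Finsupp.mem_support_iff, hb', vecOn_apply, if_neg h'] at hi
    exact hi rfl
  calc |f (P.ofC00 b)| ≤ ∑ i ∈ b.support, |b i| * |P.coef g i| := by
        rw [P.apply_ofC00 f subset_rfl]
        refine (Finset.abs_sum_le_sum_abs _ _).trans (Finset.sum_le_sum fun i _ => ?_)
        rw [abs_mul]
        exact mul_le_mul_of_nonneg_left (h i) (abs_nonneg _)
    _ = g (P.ofC00 b') := by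
        rw [P.apply_ofC00 g hsupp]
        refine Finset.sum_congr rfl fun i hi => ?_
        rw [hb', vecOn_apply, if_pos hi, mul_comm _ |b i|, mul_assoc, sign_mul_self]
    _ ≤ ‖g‖ * P.nrm b' := (le_abs_self _).trans (P.abs_apply_ofC00_le g b')
    _ ≤ ‖g‖ * P.nrm b := mul_le_mul_of_nonneg_left (P.nrm_mono_abs hb'le) (norm_nonneg _)

lemma coef_sub (f g : DualTirilmanSpace P) (i : ℕ) :
    P.coef (f - g) i = P.coef f i - P.coef g i := rfl

lemma abs_coef_le (f : DualTirilmanSpace P) (i : ℕ) : |P.coef f i| ≤ ‖f‖ := by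
  have := P.abs_apply_ofC00_le f (Finsupp.single i 1)
  rwa [nrm_single, abs_one, mul_one, ofC00_single, one_smul] at this

lemma norm_ofCoef_le_of_abs_le {a b : ℕ →₀ ℝ} (h : ∀ i, |a i| ≤ |b i|) :
    ‖P.ofCoef a‖ ≤ ‖P.ofCoef b‖ :=
  P.norm_le_of_abs_coef_le fun i => by rw [coef_ofCoef, coef_ofCoef]; exact h i

lemma norm_ofCoef_single (i : ℕ) (c : ℝ) : ‖P.ofCoef (Finsupp.single i c)‖ = |c| := by
  refine le_antisymm (P.norm_le_of_forall_c00 (abs_nonneg c) fun b => ?_) ?_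
  · classical
    have h1 : P.ofCoef (Finsupp.single i c) (P.ofC00 b) = c * b i := by
      rw [P.apply_ofC00 _ (Finset.subset_insert i b.support)]
      simp only [coef_ofCoef]
      rw [Finset.sum_eq_single_of_mem i (Finset.mem_insert_self _ _)
        (fun j _ hj => by rw [Finsupp.single_eq_of_ne hj, mul_zero])]
      rw [Finsupp.single_eq_same, mul_comm]
    rw [h1, abs_mul]
    exact mul_le_mul_of_nonneg_left (P.abs_le_nrm b i) (abs_nonneg _)
  · have := P.abs_coef_le (P.ofCoef (Finsupp.single i c)) i
    rwa [coef_ofCoef, Finsupp.single_eq_same] at this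

lemma exists_lt_apply {f : DualTirilmanSpace P} {r : ℝ} (hr : r < ‖f‖) :
    ∃ b : ℕ →₀ ℝ, P.nrm b ≤ 1 ∧ r < f (P.ofC00 b) := by
  by_contra! h
  have hr0 : 0 ≤ r := by simpa using h 0 (by rw [P.nrm_zero]; exact zero_le_one)
  refine absurd (P.norm_le_of_forall_c00 hr0 fun b => ?_) (not_le.2 hr)
  have hpos : ∀ b, f (P.ofC00 b) ≤ r * P.nrm b := by
    intro b
    rcases eq_or_lt_of_le (P.nrm_nonneg b) with h0 | h0
    · have := P.abs_apply_ofC00_le f b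
      rw [← h0, mul_zero] at this ⊢
      exact (le_abs_self _).trans this
    · have := h ((P.nrm b)⁻¹ • b) (by
        rw [nrm_smul, abs_of_pos (inv_pos.2 h0), inv_mul_cancel₀ h0.ne'])
      rwa [map_smul, map_smul, smul_eq_mul, inv_mul_le_iff₀ h0, mul_comm] at this
  refine abs_le.2 ⟨?_, hpos b⟩
  have := hpos (-b)
  rw [map_neg, map_neg, ← neg_one_smul ℝ b, nrm_smul] at this
  simp only [abs_neg, abs_one, one_mul] at this
  linarith

lemma exists_lt_ofCoef_apply {a : ℕ →₀ ℝ} {r : ℝ} (hr : r < ‖P.ofCoef a‖) :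
    ∃ b : ℕ →₀ ℝ, P.nrm b ≤ 1 ∧ b.support ⊆ a.support ∧ r < P.ofCoef a (P.ofC00 b) := by
  obtain ⟨b, hb1, hb⟩ := P.exists_lt_apply hr
  refine ⟨c00Restrict a.support b, (P.nrm_restrict_le _ _).trans hb1, ?_, ?_⟩
  · rw [c00Restrict_support]
    exact fun i hi => (Finset.mem_filter.1 hi).2
  · classical
    refine hb.trans_eq ?_
    rw [P.apply_ofC00 _ (Finset.subset_union_left (s₁ := b.support) (s₂ := a.support)),
      P.apply_ofC00 _ (S := b.support ∪ a.support) (b := c00Restrict a.support b)]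
    · refine Finset.sum_congr rfl fun i _ => ?_
      rw [coef_ofCoef, c00Restrict_apply]
      split_ifs with h
      · rfl
      · rw [Finsupp.notMem_support_iff.1 h, mul_zero, mul_zero]
    · rw [c00Restrict_support]
      exact (Finset.filter_subset _ _).trans Finset.subset_union_left

/-- A functional is unchanged if the vector is restricted to the support of the coefficients. -/
lemma ofCoef_apply_restrict {a : ℕ →₀ ℝ} {E : Finset ℕ} (h : a.support ⊆ E) (b : ℕ →₀ ℝ) :
    P.ofCoef a (P.ofC00 (c00Restrict E b)) = P.ofCoef a (P.ofC00 b) := by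
  rw [P.apply_ofC00 _ (S := b.support) (b := c00Restrict E b), P.apply_ofC00 _ subset_rfl]
  · refine Finset.sum_congr rfl fun i _ => ?_
    rw [coef_ofCoef, c00Restrict_apply]
    split_ifs with hi
    · rfl
    · rw [Finsupp.notMem_support_iff.1 fun h' => hi (h h'), mul_zero, mul_zero]
  · rw [c00Restrict_support]
    exact Finset.filter_subset _ _

lemma abs_ofCoef_apply_le (a b : ℕ →₀ ℝ) :
    |P.ofCoef a (P.ofC00 b)| ≤ ‖P.ofCoef a‖ * P.nrm (c00Restrict a.support b) := by
  rw [← P.ofCoef_apply_restrict subset_rfl b]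
  exact P.abs_apply_ofC00_le _ _

lemma ofCoef_apply_eq_zero {a b : ℕ →₀ ℝ} (h : Disjoint a.support b.support) :
    P.ofCoef a (P.ofC00 b) = 0 := by
  rw [← P.ofCoef_apply_restrict subset_rfl b, c00Restrict_eq_zero, map_zero, map_zero]
  intro i hi
  exact Finsupp.notMem_support_iff.1 fun h' => Finset.disjoint_left.1 h hi h'

/-- Upper estimate in the dual: `n` successive functionals of norm at most `δ` have a sum of norm at
most `n ^ (1 / q) * δ / γ`. -/
lemma norm_ofCoef_sum_le {ι : Type*} [LinearOrder ι] (J : Finset ι) {α : ι → ℕ →₀ ℝ}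
    (hα : ∀ i ∈ J, ∀ j ∈ J, i < j → ∀ k ∈ (α i).support, ∀ l ∈ (α j).support, k < l) {δ : ℝ}
    (hδ : 0 ≤ δ) (h : ∀ j ∈ J, ‖P.ofCoef (α j)‖ ≤ δ) :
    ‖P.ofCoef (∑ j ∈ J, α j)‖ ≤ P.γ⁻¹ * (J.card : ℝ) ^ (1 / P.q) * δ := by
  have hγ := P.γ_pos
  refine P.norm_le_of_forall_c00 (by positivity) fun b => ?_
  have h1 := P.sum_nrm_restrict_le J hα b
  calc |P.ofCoef (∑ j ∈ J, α j) (P.ofC00 b)| = |∑ j ∈ J, P.ofCoef (α j) (P.ofC00 b)| := by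
        rw [map_sum, _root_.sum_apply]
    _ ≤ ∑ j ∈ J, δ * P.nrm (c00Restrict (α j).support b) := by
        refine (Finset.abs_sum_le_sum_abs _ _).trans (Finset.sum_le_sum fun j hj => ?_)
        exact (P.abs_ofCoef_apply_le _ _).trans
          (mul_le_mul_of_nonneg_right (h j hj) (P.nrm_nonneg _))
    _ = P.γ⁻¹ * δ * (P.γ * ∑ j ∈ J, P.nrm (c00Restrict (α j).support b)) := by
        rw [← Finset.mul_sum]; field_simp
    _ ≤ P.γ⁻¹ * δ * ((J.card : ℝ) ^ (1 / P.q) * P.nrm b) :=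
        mul_le_mul_of_nonneg_left h1 (by positivity)
    _ = _ := by ring

/-- Pairing of a combination of blocks in the dual with a combination of vectors supported by these
blocks. -/
lemma ofCoef_sum_apply_sum {α u : ℕ → ℕ →₀ ℝ} (hα : IsBlockSeq α)
    (hu : ∀ k, (u k).support ⊆ (α k).support) (S : Finset ℕ) (a b : ℕ → ℝ) :
    P.ofCoef (∑ k ∈ S, a k • α k) (P.ofC00 (∑ k ∈ S, b k • u k)) =
      ∑ k ∈ S, a k * b k * P.ofCoef (α k) (P.ofC00 (u k)) := by
  have h0 : ∀ k l, k ≠ l → P.ofCoef (α k) (P.ofC00 (u l)) = 0 := by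
    intro k l hkl
    refine P.ofCoef_apply_eq_zero (Finset.disjoint_left.2 fun i hi hi' => hkl ?_)
    exact hα.eq_of_apply_ne_zero (Finsupp.mem_support_iff.1 hi)
      (Finsupp.mem_support_iff.1 (hu l hi'))
  rw [map_sum, _root_.sum_apply]
  refine Finset.sum_congr rfl fun k hk => ?_
  rw [map_sum, map_sum, Finset.sum_eq_single_of_mem k hk]
  · rw [map_smul, map_smul, map_smul, _root_.smul_apply, smul_eq_mul, smul_eq_mul]; ring
  · intro l _ hl
    rw [map_smul, map_smul, map_smul, _root_.smul_apply, h0 k l hl.symm, smul_zero, smul_zero]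

/-- Lower estimate in the dual: the number of successive functionals of norm larger than `δ` is
controlled by the norm of their sum. -/
lemma card_rpow_mul_le_norm (hγ : P.γ ≤ 1 / 2) {α : ℕ → ℕ →₀ ℝ} (hα : IsBlockSeq α) (J : Finset ℕ)
    {δ : ℝ} (h : ∀ j ∈ J, δ < ‖P.ofCoef (α j)‖) :
    (J.card : ℝ) ^ (1 / P.q) * δ ≤ 4 * ‖P.ofCoef (∑ j ∈ J, α j)‖ := by
  have hp := P.p_pos
  have hq := P.q_pos
  rcases J.eq_empty_or_nonempty with rfl | hJ
  · rw [Finset.card_empty, Nat.cast_zero, Real.zero_rpow (one_div_pos.2 hq).ne', zero_mul]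
    positivity
  have hc : (0 : ℝ) < J.card := by exact_mod_cast Finset.card_pos.2 hJ
  have hex : ∀ j, ∃ u : ℕ →₀ ℝ, P.nrm u ≤ 1 ∧ u.support ⊆ (α j).support ∧
      (j ∈ J → δ < P.ofCoef (α j) (P.ofC00 u)) := by
    intro j
    by_cases hj : j ∈ J
    · obtain ⟨u, h1, h2, h3⟩ := P.exists_lt_ofCoef_apply (h j hj)
      exact ⟨u, h1, h2, fun _ => h3⟩
    · exact ⟨0, by rw [P.nrm_zero]; exact zero_le_one, by simp, fun h => absurd h hj⟩
  choose u hu1 hu2 hu3 using hex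
  have h1 := P.ofCoef_sum_apply_sum hα hu2 J (fun _ => 1) (fun _ => 1)
  have h2 := P.nrm_sum_block_le hγ (hα.mono hu2) hu1 J (fun _ => 1)
  simp only [one_smul, one_mul] at h1 h2
  have h3 : coeffNorm P.p J (fun _ => 1) = (J.card : ℝ) ^ (1 / P.p) := by
    simp [coeffNorm]
  rw [h3] at h2
  have h4 : (J.card : ℝ) * δ ≤ ∑ j ∈ J, P.ofCoef (α j) (P.ofC00 (u j)) := by
    rw [← nsmul_eq_mul]
    exact Finset.card_nsmul_le_sum _ _ _ fun j hj => (hu3 j hj).le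
  have h5 : (J.card : ℝ) = (J.card : ℝ) ^ (1 / P.p) * (J.card : ℝ) ^ (1 / P.q) := by
    rw [← Real.rpow_add hc, P.one_div_p_add_q, Real.rpow_one]
  have hw : 0 < (J.card : ℝ) ^ (1 / P.p) := Real.rpow_pos_of_pos hc _
  refine le_of_mul_le_mul_left ?_ hw
  calc _ = (J.card : ℝ) ^ (1 / P.p) * (J.card : ℝ) ^ (1 / P.q) * δ := by ring
    _ = J.card * δ := by rw [← h5]
    _ ≤ P.ofCoef (∑ j ∈ J, α j) (P.ofC00 (∑ j ∈ J, u j)) := h4.trans_eq h1.symm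
    _ ≤ ‖P.ofCoef (∑ j ∈ J, α j)‖ * (4 * (J.card : ℝ) ^ (1 / P.p)) :=
        (le_abs_self _).trans ((P.abs_apply_ofC00_le _ _).trans
          (mul_le_mul_of_nonneg_left h2 (norm_nonneg _)))
    _ = _ := by ring

/-- The dual basis dominates every block sequence in the dual unit ball. -/
lemma norm_ofCoef_sum_block_le {α : ℕ → ℕ →₀ ℝ} (hα : IsBlockSeq α)
    (hα1 : ∀ k, ‖P.ofCoef (α k)‖ ≤ 1) (S : Finset ℕ) (a : ℕ → ℝ) :
    ‖P.ofCoef (∑ k ∈ S, a k • α k)‖ ≤ ‖P.ofCoef (vecOn S a)‖ := by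
  refine P.norm_le_of_forall_c00 (norm_nonneg _) fun b => ?_
  set z : ℕ →₀ ℝ := ∑ k ∈ S, Finsupp.single k (P.nrm (c00Restrict (α k).support b)) with hz
  have hz1 : P.nrm z ≤ P.nrm b := P.nrm_sum_single_restrict_le hα S b
  have hz2 : z = vecOn S fun k => P.nrm (c00Restrict (α k).support b) := rfl
  calc |P.ofCoef (∑ k ∈ S, a k • α k) (P.ofC00 b)|
      ≤ ∑ k ∈ S, |a k| * P.nrm (c00Restrict (α k).support b) := by
        rw [map_sum, _root_.sum_apply]
        refine (Finset.abs_sum_le_sum_abs _ _).trans (Finset.sum_le_sum fun k _ => ?_)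
        rw [map_smul, _root_.smul_apply, smul_eq_mul, abs_mul]
        refine mul_le_mul_of_nonneg_left ((P.abs_ofCoef_apply_le _ _).trans ?_) (abs_nonneg _)
        exact mul_le_of_le_one_left (P.nrm_nonneg _) (hα1 k)
    _ = P.ofCoef (vecOn S fun k => |a k|) (P.ofC00 z) := by
        have hsupp : z.support ⊆ S := by
          intro i hi
          by_contra h
          rw [Finsupp.mem_support_iff, hz2, vecOn_apply, if_neg h] at hi
          exact hi rfl
        rw [P.apply_ofC00 _ hsupp]
        refine Finset.sum_congr rfl fun k hk => ?_
        rw [coef_ofCoef, hz2, vecOn_apply, vecOn_apply, if_pos hk, if_pos hk, mul_comm]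
    _ ≤ ‖P.ofCoef (vecOn S fun k => |a k|)‖ * P.nrm z :=
        (le_abs_self _).trans (P.abs_apply_ofC00_le _ _)
    _ ≤ ‖P.ofCoef (vecOn S a)‖ * P.nrm b := by
        refine mul_le_mul (P.norm_ofCoef_le_of_abs_le fun i => ?_) hz1 (P.nrm_nonneg _)
          (norm_nonneg _)
        rw [vecOn_apply, vecOn_apply]
        split_ifs <;> simp

lemma ofCoef_mapDomain_apply {φ : ℕ → ℕ} (hφ : Function.Injective φ) (a b : ℕ →₀ ℝ) :
    P.ofCoef (Finsupp.mapDomain φ a) (P.ofC00 (Finsupp.mapDomain φ b)) =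
      P.ofCoef a (P.ofC00 b) := by
  classical
  rw [P.apply_ofC00 _ (Finsupp.mapDomain_support (f := φ) (s := b)), P.apply_ofC00 _ subset_rfl,
    Finset.sum_image fun _ _ _ _ h => hφ h]
  refine Finset.sum_congr rfl fun i _ => ?_
  rw [coef_ofCoef, coef_ofCoef, Finsupp.mapDomain_apply hφ, Finsupp.mapDomain_apply hφ]

/-- The dual basis is dominated by each of its subsequences. -/
lemma norm_ofCoef_le_mapDomain {φ : ℕ → ℕ} (hφ : StrictMono φ) (a : ℕ →₀ ℝ) :
    ‖P.ofCoef a‖ ≤ ‖P.ofCoef (Finsupp.mapDomain φ a)‖ := by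
  refine P.norm_le_of_forall_c00 (norm_nonneg _) fun b => ?_
  rw [← P.ofCoef_mapDomain_apply hφ.injective]
  exact (P.abs_apply_ofC00_le _ _).trans
    (mul_le_mul_of_nonneg_left (P.nrm_mapDomain_le hφ b) (norm_nonneg _))

end TirilmanParam

/-! ### Recursive construction of block sequences -/

/-- Recursive construction of a block sequence together with a subsequence of the indices. -/
lemma exists_blockSeq_strictMono {p : ℕ → ℕ → (ℕ →₀ ℝ) → Prop}
    (h : ∀ k N, ∃ n, N ≤ n ∧ ∃ x : ℕ →₀ ℝ, (∀ i ∈ x.support, N ≤ i) ∧ p k n x) :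
    ∃ (φ : ℕ → ℕ) (x : ℕ → ℕ →₀ ℝ), StrictMono φ ∧ IsBlockSeq x ∧ ∀ k, p k (φ k) (x k) := by
  choose n hn x hx hp using h
  set N : ℕ → ℕ := fun k => Nat.rec 0
    (fun k N => max (n k N + 1) ((x k N).support.sup id + 1)) k with hN
  have hsucc : ∀ k, N (k + 1) = max (n k (N k) + 1) ((x k (N k)).support.sup id + 1) :=
    fun k => rfl
  have hmono : StrictMono N := by
    refine strictMono_nat_of_lt_succ fun k => ?_
    rw [hsucc]
    exact lt_of_lt_of_le (Nat.lt_succ_of_le (hn k (N k))) (le_max_left _ _)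
  refine ⟨fun k => n k (N k), fun k => x k (N k), ?_, ?_, fun k => hp k _⟩
  · refine strictMono_nat_of_lt_succ fun k => ?_
    refine lt_of_lt_of_le (Nat.lt_succ_self _) (le_trans ?_ (hn (k + 1) (N (k + 1))))
    rw [hsucc]
    exact le_max_left _ _
  · intro k l hkl i hi j hj
    have h1 : i ≤ (x k (N k)).support.sup id := Finset.le_sup (f := id) hi
    have h2 : (x k (N k)).support.sup id + 1 ≤ N (k + 1) := by rw [hsucc]; exact le_max_right _ _
    have h3 : N (k + 1) ≤ N l := hmono.monotone hkl
    have h4 := hx l (N l) j hj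
    omega

lemma exists_blockSeq {p : ℕ → (ℕ →₀ ℝ) → Prop}
    (h : ∀ k N, ∃ x : ℕ →₀ ℝ, (∀ i ∈ x.support, N ≤ i) ∧ p k x) :
    ∃ x : ℕ → ℕ →₀ ℝ, IsBlockSeq x ∧ ∀ k, p k (x k) := by
  obtain ⟨-, x, -, hx, hp⟩ := exists_blockSeq_strictMono (p := fun k _ x => p k x)
    fun k N => ⟨N, le_rfl, h k N⟩
  exact ⟨x, hx, hp⟩

namespace TirilmanParam

variable (P : TirilmanParam)

/-! ### The coordinate functionals are a Schauder basis of the dual -/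

/-- The partial sum of the expansion of `f` along the coordinate functionals. -/
def partialSum (f : DualTirilmanSpace P) (n : ℕ) : DualTirilmanSpace P :=
  P.ofCoef (vecOn (Finset.range n) (P.coef f))

lemma coef_partialSum (f : DualTirilmanSpace P) (n i : ℕ) :
    P.coef (P.partialSum f n) i = if i < n then P.coef f i else 0 := by
  rw [partialSum, coef_ofCoef, vecOn_apply]
  simp only [Finset.mem_range]

lemma norm_sub_partialSum_antitone (f : DualTirilmanSpace P) :
    Antitone fun n => ‖f - P.partialSum f n‖ := by
  intro m n hmn
  refine P.norm_le_of_abs_coef_le fun i => ?_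
  rw [coef_sub, coef_sub, coef_partialSum, coef_partialSum]
  by_cases h1 : i < m
  · rw [if_pos h1, if_pos (by omega)]
  · rw [if_neg h1]
    split_ifs <;> simp

/-- The basis of the Tirilman space is shrinking: otherwise a functional would be bounded below on a
normalized block sequence, which contradicts the upper `p`-estimate. -/
theorem tendsto_partialSum (hγ : P.γ ≤ 1 / 2) (f : DualTirilmanSpace P) :
    Tendsto (P.partialSum f) atTop (𝓝 f) := by
  rw [tendsto_iff_norm_sub_tendsto_zero]
  simp only [norm_sub_rev _ f]
  by_contra hcon
  obtain ⟨δ, hδ, hδn⟩ : ∃ δ > 0, ∀ n, δ ≤ ‖f - P.partialSum f n‖ := by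
    by_contra! h
    refine hcon (Metric.tendsto_atTop.2 fun ε hε => ?_)
    obtain ⟨N, hN⟩ := h ε hε
    refine ⟨N, fun n hn => ?_⟩
    rw [Real.dist_eq, sub_zero, abs_of_nonneg (norm_nonneg _)]
    exact (P.norm_sub_partialSum_antitone f hn).trans_lt hN
  obtain ⟨x, hx, hp⟩ := exists_blockSeq (p := fun _ x => P.nrm x ≤ 1 ∧ δ / 2 ≤ f (P.ofC00 x))
    fun _ N => by
      obtain ⟨b, hb1, hb⟩ := P.exists_lt_apply (lt_of_lt_of_le (half_lt_self hδ) (hδn N))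
      set c : ℕ →₀ ℝ := vecOn (b.support.filter (N ≤ ·)) b with hc
      have hcsupp : c.support ⊆ b.support.filter (N ≤ ·) := by
        intro i hi
        by_contra h
        rw [Finsupp.mem_support_iff, hc, vecOn_apply, if_neg h] at hi
        exact hi rfl
      refine ⟨c, fun i hi => (Finset.mem_filter.1 (hcsupp hi)).2, ?_, ?_⟩
      · refine (P.nrm_mono_abs fun i => ?_).trans hb1
        rw [hc, vecOn_apply]
        split_ifs <;> simp
      · refine hb.le.trans_eq ?_
        rw [P.apply_ofC00 _ subset_rfl,
          P.apply_ofC00 f (hcsupp.trans (Finset.filter_subset _ _))]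
        refine Finset.sum_congr rfl fun i hi => ?_
        rw [coef_sub, coef_partialSum, hc, vecOn_apply]
        simp only [Finset.mem_filter]
        by_cases h : i < N
        · rw [if_pos h, if_neg (by omega)]; ring
        · rw [if_neg h, if_pos ⟨hi, by omega⟩]; ring
  have key : ∀ K : ℕ, 0 < K → (K : ℝ) ^ (1 / P.q) * (δ / 2) ≤ 4 * ‖f‖ := by
    intro K hK
    have hK0 : (0 : ℝ) < K := by exact_mod_cast hK
    have h1 := P.nrm_sum_block_le hγ hx (fun k => (hp k).1) (Finset.range K) fun _ => 1
    have h2 : coeffNorm P.p (Finset.range K) (fun _ => 1) = (K : ℝ) ^ (1 / P.p) := by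
      simp [coeffNorm]
    simp only [one_smul] at h1
    rw [h2] at h1
    have h3 : (K : ℝ) * (δ / 2) ≤ f (P.ofC00 (∑ k ∈ Finset.range K, x k)) := by
      rw [map_sum, map_sum]
      have := Finset.card_nsmul_le_sum (Finset.range K) (fun k => f (P.ofC00 (x k))) (δ / 2)
        fun k _ => (hp k).2
      rwa [Finset.card_range, nsmul_eq_mul] at this
    have h5 : (K : ℝ) = (K : ℝ) ^ (1 / P.p) * (K : ℝ) ^ (1 / P.q) := by
      rw [← Real.rpow_add hK0, P.one_div_p_add_q, Real.rpow_one]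
    have hw : 0 < (K : ℝ) ^ (1 / P.p) := Real.rpow_pos_of_pos hK0 _
    refine le_of_mul_le_mul_left ?_ hw
    calc _ = (K : ℝ) ^ (1 / P.p) * (K : ℝ) ^ (1 / P.q) * (δ / 2) := by ring
      _ = K * (δ / 2) := by rw [← h5]
      _ ≤ ‖f‖ * (4 * (K : ℝ) ^ (1 / P.p)) := h3.trans ((le_abs_self _).trans
          ((P.abs_apply_ofC00_le _ _).trans (mul_le_mul_of_nonneg_left h1 (norm_nonneg _))))
      _ = _ := by ring
  have ht : Tendsto (fun K : ℕ => (K : ℝ) ^ (1 / P.q) * (δ / 2)) atTop atTop :=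
    ((tendsto_rpow_atTop (one_div_pos.2 P.q_pos)).comp tendsto_natCast_atTop_atTop).atTop_mul_const
      (half_pos hδ)
  obtain ⟨K, hK, hK0⟩ := ((ht.eventually_gt_atTop (4 * ‖f‖)).and (eventually_gt_atTop 0)).exists
  exact absurd (key K hK0) (not_le.2 hK)

lemma ofCoef_vecOn (S : Finset ℕ) (a : ℕ → ℝ) :
    P.ofCoef (vecOn S a) = ∑ j ∈ S, a j • dualTirilmanBasis P j := by
  rw [vecOn, map_sum]
  exact Finset.sum_congr rfl fun i _ => Finsupp.linearCombination_single _ _ _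

/-- The Schauder basis of the dual that consists of the coordinate functionals. -/
def dualSchauderBasis (hγ : P.γ ≤ 1 / 2) : SchauderBasis ℝ (DualTirilmanSpace P) where
  basis := dualTirilmanBasis P
  coord i := ContinuousLinearMap.apply ℝ ℝ (tirilmanBasis P i)
  ortho i j := by
    simp [ContinuousLinearMap.apply_apply, dualTirilmanBasis_basis, Pi.single_apply]
  expansion f := by
    rw [HasSum, SummationFilter.conditional_filter_eq_map_range, tendsto_map'_iff]
    exact (P.tendsto_partialSum hγ f).congr fun n => P.ofCoef_vecOn _ _

/-! ### An upper `ℓ_q` estimate for flat functionals -/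

/-- A functional whose coefficients are at most `δ` is a sum of successive pieces, all of norm at
most `2 δ` and all but the last of norm larger than `δ`. -/
lemma exists_pieces {δ : ℝ} (hδ : 0 < δ) (a : ℕ →₀ ℝ) (ha : ∀ i, |a i| ≤ δ) :
    ∃ (s : ℕ) (β : ℕ → ℕ →₀ ℝ), IsBlockSeq β ∧ (∀ j, (β j).support ⊆ a.support) ∧
      ∑ j ∈ Finset.range (s + 1), β j = a ∧ (∀ j, ‖P.ofCoef (β j)‖ ≤ 2 * δ) ∧
      ∀ j < s, δ < ‖P.ofCoef (β j)‖ := by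
  classical
  induction hc : a.support.card using Nat.strong_induction_on generalizing a with
  | _ c ih =>
    by_cases hsmall : ‖P.ofCoef a‖ ≤ 2 * δ
    · refine ⟨0, fun j => if j = 0 then a else 0, ?_, ?_, by simp, ?_, by simp⟩
      · intro i j hij k _ l hl
        simp only [show j ≠ 0 by omega, if_false, Finsupp.support_zero] at hl
        simp at hl
      · intro j; dsimp only; split_ifs <;> simp
      · intro j; dsimp only; split_ifs
        · exact hsmall
        · rw [map_zero, norm_zero]; positivity
    · -- cut at the first place where the initial piece has norm larger than `δ`
      have hex : ∃ m, δ < ‖P.ofCoef (c00Restrict (Finset.range m) a)‖ := by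
        refine ⟨a.support.sup id + 1, ?_⟩
        rw [c00Restrict_eq_self fun i hi =>
          Finset.mem_range.2 (Nat.lt_succ_of_le (Finset.le_sup (f := id) hi))]
        linarith
      set m := Nat.find hex with hm
      have hm1 : δ < ‖P.ofCoef (c00Restrict (Finset.range m) a)‖ := Nat.find_spec hex
      set b := c00Restrict (Finset.range m) a with hb
      have hm0 : m ≠ 0 := by
        intro h0
        rw [hb, h0, c00Restrict_eq_zero (by simp), map_zero, norm_zero] at hm1
        linarith
      have hb2 : ‖P.ofCoef b‖ ≤ 2 * δ := by
        have h1 := Nat.find_min hex (m := m - 1) (by omega)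
        rw [not_lt] at h1
        have h2 : b = c00Restrict (Finset.range (m - 1)) a + Finsupp.single (m - 1) (a (m - 1)) := by
          ext i
          rw [Finsupp.add_apply, hb, c00Restrict_apply, c00Restrict_apply, Finsupp.single_apply]
          simp only [Finset.mem_range]
          rcases lt_trichotomy i (m - 1) with h | h | h
          · rw [if_pos (by omega), if_pos h, if_neg (by omega), add_zero]
          · rw [if_pos (by omega), if_neg (by omega), if_pos h.symm, zero_add, h]
          · rw [if_neg (by omega), if_neg (by omega), if_neg (by omega), add_zero]
        rw [h2, map_add]
        refine (norm_add_le _ _).trans ?_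
        rw [norm_ofCoef_single]
        linarith [ha (m - 1)]
      have hb0 : b ≠ 0 := by
        intro h0; rw [h0, map_zero, norm_zero] at hm1; linarith
      set a' := a - b with ha'
      have ha'app : ∀ i, a' i = if i < m then 0 else a i := by
        intro i
        rw [ha', Finsupp.sub_apply, hb, c00Restrict_apply]
        simp only [Finset.mem_range]
        split_ifs <;> simp
      have hsub : a'.support ⊆ a.support := by
        intro i hi
        rw [Finsupp.mem_support_iff, ha'app] at hi
        split_ifs at hi with h
        · exact absurd rfl hi
        · exact Finsupp.mem_support_iff.2 hi
      have hbsub : b.support ⊆ a.support := by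
        rw [hb, c00Restrict_support]; exact Finset.filter_subset _ _
      have hlt : a'.support.card < c := by
        rw [← hc]
        refine Finset.card_lt_card ⟨hsub, fun h => ?_⟩
        obtain ⟨i, hi⟩ := Finsupp.support_nonempty_iff.2 hb0
        have h1 := h (hbsub hi)
        rw [Finsupp.mem_support_iff, ha'app] at h1
        rw [hb, c00Restrict_support, Finset.mem_filter, Finset.mem_range] at hi
        rw [if_pos hi.2] at h1
        exact h1 rfl
      obtain ⟨s, β, h1, h2, h3, h4, h5⟩ := ih _ hlt a' (fun i => by
        rw [ha'app]; split_ifs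
        · simpa using hδ.le
        · exact ha i) rfl
      refine ⟨s + 1, fun j => Nat.casesOn j b β, ?_, ?_, ?_, ?_, ?_⟩
      · intro i j hij k hk l hl
        rcases j with _ | j
        · omega
        rcases i with _ | i
        · have hk' : k ∈ b.support := hk
          have hl' := h2 j hl
          rw [Finsupp.mem_support_iff, ha'app] at hl'
          rw [hb, c00Restrict_support, Finset.mem_filter, Finset.mem_range] at hk'
          split_ifs at hl' with h
          · exact absurd rfl hl'
          · omega
        · exact h1 i j (by omega) k hk l hl
      · intro j
        rcases j with _ | j
        · exact hbsub
        · exact (h2 j).trans hsub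
      · rw [Finset.sum_range_succ']
        change ∑ k ∈ Finset.range (s + 1), β k + b = a
        rw [h3, ha', sub_add_cancel]
      · intro j
        rcases j with _ | j
        · exact hb2
        · exact h4 j
      · intro j hj
        rcases j with _ | j
        · exact hm1
        · exact h5 j (by omega)

/-- The number of pieces is controlled by the lower estimate in the dual. -/
lemma exists_few_pieces (hγ : P.γ ≤ 1 / 2) {δ : ℝ} (hδ : 0 < δ) (a : ℕ →₀ ℝ)
    (ha : ∀ i, |a i| ≤ δ) :
    ∃ (s : ℕ) (β : ℕ → ℕ →₀ ℝ), IsBlockSeq β ∧ (∀ j, (β j).support ⊆ a.support) ∧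
      ∑ j ∈ Finset.range s, β j = a ∧ (∀ j, ‖P.ofCoef (β j)‖ ≤ 2 * δ) ∧
      (s : ℝ) ≤ 1 + (4 * ‖P.ofCoef a‖ / δ) ^ P.q := by
  have hq := P.q_pos
  obtain ⟨s, β, h1, h2, h3, h4, h5⟩ := P.exists_pieces hδ a ha
  refine ⟨s + 1, β, h1, h2, h3, h4, ?_⟩
  have h6 := P.card_rpow_mul_le_norm hγ h1 (Finset.range s) fun j hj => h5 j (Finset.mem_range.1 hj)
  rw [Finset.card_range] at h6
  have h7 : ‖P.ofCoef (∑ j ∈ Finset.range s, β j)‖ ≤ ‖P.ofCoef a‖ := by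
    refine P.norm_ofCoef_le_of_abs_le fun i => ?_
    rw [← h3, Finset.sum_range_succ, Finsupp.add_apply]
    by_cases h : β s i = 0
    · rw [h, add_zero]
    · have : (∑ j ∈ Finset.range s, β j) i = 0 := by
        have := h1.sum_apply (Finset.range s) (fun _ => 1) h
        simpa using this
      rw [this, abs_zero]
      exact abs_nonneg _
  have h8 : (s : ℝ) ^ (1 / P.q) ≤ 4 * ‖P.ofCoef a‖ / δ := by
    rw [le_div_iff₀ hδ]; linarith
  have h9 : (s : ℝ) ≤ (4 * ‖P.ofCoef a‖ / δ) ^ P.q := by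
    rw [one_div, Real.rpow_inv_le_iff_of_pos (by positivity) (by positivity) hq] at h8
    exact h8
  push_cast
  linarith

/-- Blocks in the dual unit ball with sufficiently small coefficients satisfy an upper `ℓ_q`
estimate for a given finite combination. -/
theorem exists_norm_sum_flat_le (hγ : P.γ ≤ 1 / 2) (J : Finset ℕ) (a : ℕ → ℝ)
    (ha : ∑ k ∈ J, |a k| ^ P.q ≤ 1) : ∃ ε > 0, ∀ α : ℕ → ℕ →₀ ℝ, IsBlockSeq α →
      (∀ k, ‖P.ofCoef (α k)‖ ≤ 1) → (∀ k ∈ J, ∀ i, |α k i| ≤ ε) →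
        ‖P.ofCoef (∑ k ∈ J, a k • α k)‖ ≤ P.γ⁻¹ * 16 := by
  classical
  have hq := P.q_pos
  have hγ0 := P.γ_pos
  have hpow : ∀ k, 0 ≤ |a k| ^ P.q := fun k => Real.rpow_nonneg (abs_nonneg _) _
  have ha1 : ∀ k ∈ J, |a k| ≤ 1 := by
    intro k hk
    have h1 := (Finset.single_le_sum (f := fun k => |a k| ^ P.q) (fun k _ => hpow k) hk).trans ha
    by_contra! h
    exact absurd h1 (not_le.2 (Real.one_lt_rpow h hq))
  set m : ℝ := J.card + 1 with hm
  have hm0 : 0 < m := by positivity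
  set δ : ℝ := (m ^ (1 / P.q))⁻¹ with hδ
  have hδ0 : 0 < δ := by positivity
  have hδq : (1 / δ) ^ P.q = m := by
    rw [hδ, one_div, inv_inv, one_div, Real.rpow_inv_rpow hm0.le hq.ne']
  refine ⟨δ, hδ0, fun α hα hα1 hαε => ?_⟩
  have hex : ∀ k, ∃ (s : ℕ) (β : ℕ → ℕ →₀ ℝ), IsBlockSeq β ∧
      (∀ j, (β j).support ⊆ (α k).support) ∧ (k ∈ J → ∑ j ∈ Finset.range s, β j = a k • α k) ∧
      (∀ j, ‖P.ofCoef (β j)‖ ≤ 2 * δ) ∧ (k ∈ J → (s : ℝ) ≤ 1 + (4 / δ * |a k|) ^ P.q) := by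
    intro k
    by_cases hk : k ∈ J
    · obtain ⟨s, β, h1, h2, h3, h4, h5⟩ := P.exists_few_pieces hγ hδ0 (a k • α k) fun i => by
        rw [Finsupp.smul_apply, smul_eq_mul, abs_mul]
        exact (mul_le_of_le_one_left (abs_nonneg _) (ha1 k hk)).trans (hαε k hk i)
      refine ⟨s, β, h1, fun j => (h2 j).trans Finsupp.support_smul, fun _ => h3, h4,
        fun _ => h5.trans ?_⟩
      gcongr
      rw [map_smul, norm_smul, Real.norm_eq_abs]
      have := mul_le_of_le_one_right (abs_nonneg (a k)) (hα1 k)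
      rw [div_mul_eq_mul_div]
      gcongr
    · exact ⟨0, fun _ => 0, fun i j _ k hk => by simp at hk, fun j => by simp,
        fun h => absurd h hk, fun j => by rw [map_zero, norm_zero]; positivity,
        fun h => absurd h hk⟩
  choose s β hβ1 hβ2 hβ3 hβ4 hβ5 using hex
  -- All pieces of all blocks, in lexicographic order.
  set I : Finset (ℕ ×ₗ ℕ) := J.biUnion fun k => (Finset.range (s k)).image fun j => toLex (k, j)
    with hI
  set B : ℕ ×ₗ ℕ → ℕ →₀ ℝ := fun x => β (ofLex x).1 (ofLex x).2 with hB
  have hsum : ∑ x ∈ I, B x = ∑ k ∈ J, a k • α k := by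
    rw [hI, Finset.sum_biUnion]
    · refine Finset.sum_congr rfl fun k hk => ?_
      rw [Finset.sum_image, ← hβ3 k hk]
      · rfl
      · intro i _ j _ hij
        exact (Prod.ext_iff.1 (toLex.injective hij)).2
    · intro k _ l _ hkl
      refine Finset.disjoint_left.2 fun x hx hx' => hkl ?_
      obtain ⟨i, -, rfl⟩ := Finset.mem_image.1 hx
      obtain ⟨j, -, hj⟩ := Finset.mem_image.1 hx'
      exact (Prod.ext_iff.1 (toLex.injective hj)).1.symm
  have hcard : (I.card : ℝ) ≤ 2 * 4 ^ P.q * m := by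
    have h1 : I.card ≤ ∑ k ∈ J, s k :=
      Finset.card_biUnion_le.trans (Finset.sum_le_sum fun k _ =>
        Finset.card_image_le.trans_eq (Finset.card_range _))
    have h4q : (1 : ℝ) ≤ 4 ^ P.q := Real.one_le_rpow (by norm_num) hq.le
    calc (I.card : ℝ) ≤ ∑ k ∈ J, (s k : ℝ) := by exact_mod_cast h1
      _ ≤ ∑ k ∈ J, (1 + (4 / δ * |a k|) ^ P.q) := Finset.sum_le_sum fun k hk => hβ5 k hk
      _ = J.card + 4 ^ P.q * m * ∑ k ∈ J, |a k| ^ P.q := by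
          rw [Finset.sum_add_distrib, Finset.sum_const, nsmul_eq_mul, mul_one, Finset.mul_sum]
          congr 1
          refine Finset.sum_congr rfl fun k _ => ?_
          rw [Real.mul_rpow (by positivity) (abs_nonneg _), show 4 / δ = 4 * (1 / δ) by ring,
            Real.mul_rpow (by norm_num) (by positivity), hδq]
      _ ≤ 4 ^ P.q * m + 4 ^ P.q * m * 1 := by
          refine add_le_add ?_ (mul_le_mul_of_nonneg_left ha (by positivity))
          nlinarith
      _ = _ := by ring
  have hroot : (I.card : ℝ) ^ (1 / P.q) * (2 * δ) ≤ 16 := by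
    have h1 : (I.card : ℝ) ^ (1 / P.q) ≤ 2 * 4 * m ^ (1 / P.q) := by
      refine (Real.rpow_le_rpow (by positivity) hcard (by positivity)).trans ?_
      rw [Real.mul_rpow (by positivity) hm0.le, Real.mul_rpow (by norm_num) (by positivity),
        one_div, Real.rpow_rpow_inv (by norm_num) hq.ne']
      gcongr
      refine (Real.rpow_le_rpow_of_exponent_le (by norm_num) (y := P.q⁻¹) (z := 1) ?_).trans_eq
        (Real.rpow_one 2)
      exact inv_le_one_of_one_le₀ P.one_lt_q.le
    calc _ ≤ 2 * 4 * m ^ (1 / P.q) * (2 * δ) := mul_le_mul_of_nonneg_right h1 (by positivity)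
      _ = 16 := by rw [hδ]; field_simp; norm_num
  rw [← hsum]
  refine (P.norm_ofCoef_sum_le I (α := B) ?_ (δ := 2 * δ) (by positivity)
    fun x _ => hβ4 _ _).trans ?_
  · intro x _ y _ hxy k hk l hl
    rcases Prod.Lex.lt_iff.1 hxy with h | ⟨h1, h2⟩
    · exact hα _ _ h k (hβ2 _ _ hk) l (hβ2 _ _ hl)
    · simp only [hB] at hk hl
      rw [← h1] at hl
      exact hβ1 _ _ _ h2 k hk l hl
  · rw [mul_assoc]
    exact mul_le_mul_of_nonneg_left hroot (by positivity)

end TirilmanParam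

/-! ### No block sequence in the dual has an upper `ℓ_q` estimate -/

/-- The combination `∑ a k • α k` of vectors in `c₀₀`. -/
def comb (α : ℕ → ℕ →₀ ℝ) : (ℕ →₀ ℝ) →ₗ[ℝ] ℕ →₀ ℝ := Finsupp.linearCombination ℝ α

lemma comb_eq_sum (α : ℕ → ℕ →₀ ℝ) {S : Finset ℕ} {a : ℕ →₀ ℝ} (h : a.support ⊆ S) :
    comb α a = ∑ k ∈ S, a k • α k := by
  rw [comb, Finsupp.linearCombination_apply, Finsupp.sum]
  exact Finset.sum_subset h fun k _ hk => by
    rw [Finsupp.notMem_support_iff.1 hk, zero_smul]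

lemma comb_single (α : ℕ → ℕ →₀ ℝ) (k : ℕ) (c : ℝ) : comb α (Finsupp.single k c) = c • α k :=
  Finsupp.linearCombination_single _ _ _

/-- The `ℓ_r` norm of a finitely supported sequence. -/
def c00Norm (r : ℝ) (a : ℕ →₀ ℝ) : ℝ := coeffNorm r a.support a

lemma c00Norm_eq {r : ℝ} (hr : 0 < r) {S : Finset ℕ} {a : ℕ →₀ ℝ} (h : a.support ⊆ S) :
    c00Norm r a = coeffNorm r S a := by
  rw [c00Norm, coeffNorm, coeffNorm, Finset.sum_subset h fun i _ hi => by
    rw [Finsupp.notMem_support_iff.1 hi, abs_zero, Real.zero_rpow hr.ne']]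

lemma c00Norm_smul {r : ℝ} (hr : 0 < r) (c : ℝ) (a : ℕ →₀ ℝ) :
    c00Norm r (c • a) = |c| * c00Norm r a := by
  rw [c00Norm_eq hr Finsupp.support_smul, c00Norm, ← coeffNorm_smul hr]
  rfl

lemma c00Norm_pos {r : ℝ} (hr : 0 < r) {a : ℕ →₀ ℝ} (ha : a ≠ 0) : 0 < c00Norm r a := by
  obtain ⟨i, hi⟩ := Finsupp.support_nonempty_iff.2 ha
  exact (abs_pos.2 (Finsupp.mem_support_iff.1 hi)).trans_le (abs_le_coeffNorm hr a hi)

/-- The blocks formed from successive coefficient vectors and a block sequence are a block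
sequence. -/
lemma IsBlockSeq.comb {α a : ℕ → ℕ →₀ ℝ} (hα : IsBlockSeq α) (ha : IsBlockSeq a) :
    IsBlockSeq fun k => comb α (a k) := by
  have key : ∀ k i, i ∈ (_root_.comb α (a k)).support → ∃ j ∈ (a k).support, i ∈ (α j).support := by
    intro k i hi
    rw [Finsupp.mem_support_iff, comb_eq_sum α subset_rfl, Finsupp.finsetSum_apply] at hi
    obtain ⟨j, hj, hne⟩ := Finset.exists_ne_zero_of_sum_ne_zero hi
    refine ⟨j, hj, Finsupp.mem_support_iff.2 fun h => hne ?_⟩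
    rw [Finsupp.smul_apply, h, smul_zero]
  intro k l hkl i hi i' hi'
  obtain ⟨j, hj, hij⟩ := key k i hi
  obtain ⟨j', hj', hij'⟩ := key l i' hi'
  exact hα j j' (ha k l hkl j hj j' hj') i hij i' hij'

/-- The `ℓ_r` norm of a combination of successive vectors in the unit ball of `ℓ_r`. -/
lemma c00Norm_comb_le {r : ℝ} (hr : 0 < r) {a : ℕ → ℕ →₀ ℝ} (ha : IsBlockSeq a)
    (ha1 : ∀ k, c00Norm r (a k) ≤ 1) (S : Finset ℕ) (c : ℕ → ℝ) :
    c00Norm r (∑ k ∈ S, c k • a k) ≤ coeffNorm r S c := by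
  classical
  have hsub : (∑ k ∈ S, c k • a k).support ⊆ S.biUnion fun k => (a k).support := by
    intro i hi
    rw [Finsupp.mem_support_iff, Finsupp.finsetSum_apply] at hi
    obtain ⟨k, hk, hne⟩ := Finset.exists_ne_zero_of_sum_ne_zero hi
    refine Finset.mem_biUnion.2 ⟨k, hk, Finsupp.mem_support_iff.2 fun h => hne ?_⟩
    rw [Finsupp.smul_apply, h, smul_zero]
  rw [c00Norm_eq hr hsub]
  refine Real.rpow_le_rpow (Finset.sum_nonneg fun _ _ => Real.rpow_nonneg (abs_nonneg _) _) ?_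
    (by positivity)
  rw [Finset.sum_biUnion]
  · refine Finset.sum_le_sum fun k hk => ?_
    have h1 : ∑ i ∈ (a k).support, |a k i| ^ r ≤ 1 := by
      have h2 := ha1 k
      rw [c00Norm, coeffNorm, one_div, Real.rpow_inv_le_iff_of_pos
        (Finset.sum_nonneg fun _ _ => Real.rpow_nonneg (abs_nonneg _) _) zero_le_one hr,
        Real.one_rpow] at h2
      exact h2
    calc ∑ i ∈ (a k).support, |(∑ l ∈ S, c l • a l) i| ^ r
        = ∑ i ∈ (a k).support, |c k| ^ r * |a k i| ^ r := by
          refine Finset.sum_congr rfl fun i hi => ?_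
          rw [ha.sum_apply S c (Finsupp.mem_support_iff.1 hi), if_pos hk, abs_mul,
            Real.mul_rpow (abs_nonneg _) (abs_nonneg _)]
      _ ≤ |c k| ^ r := by
          rw [← Finset.mul_sum]
          exact mul_le_of_le_one_right (Real.rpow_nonneg (abs_nonneg _) _) h1
  · intro k _ l _ hkl
    refine Finset.disjoint_left.2 fun i hi hi' => hkl ?_
    exact ha.eq_of_apply_ne_zero (Finsupp.mem_support_iff.1 hi) (Finsupp.mem_support_iff.1 hi')

namespace TirilmanParam

variable (P : TirilmanParam)

/-- No block sequence in the dual that is bounded below satisfies an upper `ℓ_q` estimate. For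
functionals `g i` that almost attain the best constant `M` in such an estimate on normalized `ℓ_q`
combinations, norming vectors `u i` have an `ℓ_p` combination of norm at most `8 γ`, and pairing it
with the corresponding `ℓ_q` combination of the `g i` shows that the constant is larger than `M`. -/
theorem not_upper_q_estimate (hγ : P.γ < 1 / 32) {α : ℕ → ℕ →₀ ℝ} (hα : IsBlockSeq α) {δ : ℝ}
    (hδ : 0 < δ) (hα1 : ∀ k, δ ≤ ‖P.ofCoef (α k)‖) (D : ℝ) (N : ℕ) :
    ∃ a : ℕ →₀ ℝ, (∀ k ∈ a.support, N ≤ k) ∧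
      D * c00Norm P.q a < ‖P.ofCoef (comb α a)‖ := by
  have hq := P.q_pos
  have hp := P.p_pos
  have hγ0 := P.γ_pos
  by_contra! hcon
  have hD : 0 ≤ D := by
    have := hcon (Finsupp.single N 1) (fun k hk => by
      have := Finset.mem_singleton.1 (Finsupp.support_single_subset hk); omega)
    have h1 : c00Norm P.q (Finsupp.single N 1) = 1 := by
      rw [c00Norm_eq hq Finsupp.support_single_subset]
      simp [coeffNorm]
    rw [h1, mul_one] at this
    exact (norm_nonneg _).trans this
  set V : ℕ → Set ℝ := fun k => {r | ∃ a : ℕ →₀ ℝ, (∀ j ∈ a.support, N + k ≤ j) ∧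
    c00Norm P.q a ≤ 1 ∧ r = ‖P.ofCoef (comb α a)‖} with hV
  have hVb : ∀ k, BddAbove (V k) := by
    refine fun k => ⟨D, ?_⟩
    rintro r ⟨a, h1, h2, rfl⟩
    exact (hcon a fun j hj => by have := h1 j hj; omega).trans (mul_le_of_le_one_right hD h2)
  have hVδ : ∀ k, δ ≤ sSup (V k) := by
    intro k
    refine le_csSup_of_le (hVb k) ⟨Finsupp.single (N + k) 1, fun j hj => ?_, ?_, rfl⟩ ?_
    · have := Finset.mem_singleton.1 (Finsupp.support_single_subset hj); omega
    · rw [c00Norm_eq hq Finsupp.support_single_subset]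
      simp [coeffNorm]
    · rw [comb_single, one_smul]; exact hα1 _
  set M : ℝ := ⨅ k, sSup (V k) with hM
  have hMb : BddBelow (Set.range fun k => sSup (V k)) := ⟨δ, by rintro _ ⟨k, rfl⟩; exact hVδ k⟩
  have hM0 : 0 < M := hδ.trans_le (le_ciInf hVδ)
  obtain ⟨k₁, hk₁⟩ := exists_lt_of_ciInf_lt (show M < 2 * M by linarith)
  obtain ⟨a, ha, hpa⟩ := exists_blockSeq (p := fun _ a => (∀ j ∈ a.support, N + k₁ ≤ j) ∧
    c00Norm P.q a ≤ 1 ∧ M / 2 < ‖P.ofCoef (comb α a)‖) fun _ n => by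
      have h1 : M / 2 < sSup (V (k₁ + n)) := by
        have := ciInf_le hMb (k₁ + n)
        linarith
      obtain ⟨r, ⟨a, h2, h3, rfl⟩, h4⟩ := exists_lt_of_lt_csSup
        (by by_contra h
            rw [Set.not_nonempty_iff_eq_empty] at h
            rw [h, Real.sSup_empty] at h1
            linarith) h1
      exact ⟨a, fun i hi => by have := h2 i hi; omega, fun i hi => by have := h2 i hi; omega, h3, h4⟩
  have hg : IsBlockSeq fun i => comb α (a i) := hα.comb ha
  choose u hu1 hu2 hu3 using fun i => P.exists_lt_ofCoef_apply (hpa i).2.2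
  obtain ⟨S, β, hβ0, hβ1, hβ⟩ := P.exists_combination_nrm_le (by linarith) (hg.mono hu2) hu1
  set A : ℕ →₀ ℝ := ∑ i ∈ S, (β i ^ (P.p - 1)) • a i with hA
  have hAsupp : ∀ j ∈ A.support, N + k₁ ≤ j := by
    intro j hj
    rw [Finsupp.mem_support_iff, hA, Finsupp.finsetSum_apply] at hj
    obtain ⟨i, -, hne⟩ := Finset.exists_ne_zero_of_sum_ne_zero hj
    refine (hpa i).1 j (Finsupp.mem_support_iff.2 fun h => hne ?_)
    rw [Finsupp.smul_apply, h, smul_zero]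
  have hAnorm : c00Norm P.q A ≤ 1 := by
    refine (c00Norm_comb_le hq ha (fun k => (hpa k).2.1) S _).trans_eq ?_
    have h1 : ∀ i ∈ S, |β i ^ (P.p - 1)| ^ P.q = β i ^ P.p := by
      intro i _
      rw [abs_of_nonneg (Real.rpow_nonneg (hβ0 i) _), ← Real.rpow_mul (hβ0 i),
        P.holder.sub_one_mul_conj]
    rw [coeffNorm, Finset.sum_congr rfl h1, hβ1, Real.one_rpow]
  have hup : ‖P.ofCoef (comb α A)‖ ≤ 2 * M :=
    (le_csSup (hVb k₁) ⟨A, hAsupp, hAnorm, rfl⟩).trans hk₁.le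
  have hcombA : comb α A = ∑ i ∈ S, (β i ^ (P.p - 1)) • comb α (a i) := by
    rw [hA, map_sum]
    exact Finset.sum_congr rfl fun i _ => map_smul _ _ _
  have hpair : M / 2 ≤ P.ofCoef (comb α A) (P.ofC00 (∑ k ∈ S, β k • u k)) := by
    rw [hcombA, P.ofCoef_sum_apply_sum hg hu2]
    calc M / 2 = ∑ i ∈ S, β i ^ P.p * (M / 2) := by rw [← Finset.sum_mul, hβ1, one_mul]
      _ ≤ _ := Finset.sum_le_sum fun i _ => by
          have h1 : β i ^ (P.p - 1) * β i = β i ^ P.p := by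
            rcases eq_or_lt_of_le (hβ0 i) with h | h
            · rw [← h, mul_zero, Real.zero_rpow hp.ne']
            · rw [Real.rpow_sub_one h.ne']; field_simp
          rw [h1]
          exact mul_le_mul_of_nonneg_left (hu3 i).le (Real.rpow_nonneg (hβ0 i) _)
  have h1 : M / 2 ≤ 2 * M * (8 * P.γ) :=
    hpair.trans ((le_abs_self _).trans ((P.abs_apply_ofC00_le _ _).trans
      (mul_le_mul hup hβ (P.nrm_nonneg _) (by linarith))))
  nlinarith

end TirilmanParam

/-! ### Series and basic sequences in Banach spaces -/

section Sequences

variable {X Y : Type*} [NormedAddCommGroup X] [NormedAddCommGroup Y]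

lemma seriesConverges_iff [CompleteSpace X] {x : ℕ → X} :
    SeriesConverges x ↔ ∀ ε > 0, ∃ N, ∀ m n, N ≤ m → m ≤ n → ‖∑ k ∈ Finset.Ico m n, x k‖ < ε := by
  constructor
  · rintro ⟨s, hs⟩ ε hε
    obtain ⟨N, hN⟩ := Metric.cauchySeq_iff.1 hs.cauchySeq ε hε
    refine ⟨N, fun m n hm hmn => ?_⟩
    rw [Finset.sum_Ico_eq_sub _ hmn, ← dist_eq_norm]
    exact hN n (hm.trans hmn) m hm
  · intro h
    refine cauchySeq_tendsto_of_complete (Metric.cauchySeq_iff'.2 fun ε hε => ?_)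
    obtain ⟨N, hN⟩ := h ε hε
    refine ⟨N, fun n hn => ?_⟩
    rw [dist_eq_norm, ← Finset.sum_Ico_eq_sub _ hn]
    exact hN N n le_rfl hn

lemma SeriesConverges.of_norm_le [CompleteSpace X] [CompleteSpace Y] {x : ℕ → X} {y : ℕ → Y} (C : ℝ)
    (h : ∀ m n, ‖∑ k ∈ Finset.Ico m n, y k‖ ≤ C * ‖∑ k ∈ Finset.Ico m n, x k‖)
    (hx : SeriesConverges x) : SeriesConverges y := by
  rw [seriesConverges_iff] at hx ⊢
  intro ε hε
  obtain ⟨N, hN⟩ := hx (ε / (|C| + 1)) (by positivity)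
  refine ⟨N, fun m n hm hmn => ?_⟩
  have h1 := hN m n hm hmn
  rw [lt_div_iff₀ (by positivity)] at h1
  have h2 := h m n
  have h3 : C * ‖∑ k ∈ Finset.Ico m n, x k‖ ≤ |C| * ‖∑ k ∈ Finset.Ico m n, x k‖ :=
    mul_le_mul_of_nonneg_right (le_abs_self C) (norm_nonneg _)
  nlinarith [norm_nonneg (∑ k ∈ Finset.Ico m n, x k)]

lemma SeriesConverges.add {x y : ℕ → X} (hx : SeriesConverges x) (hy : SeriesConverges y) :
    SeriesConverges fun k => x k + y k := by
  obtain ⟨s, hs⟩ := hx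
  obtain ⟨t, ht⟩ := hy
  refine ⟨s + t, (hs.add ht).congr fun n => ?_⟩
  rw [← Finset.sum_add_distrib]

lemma SeriesConverges.tendsto_zero {x : ℕ → X} (hx : SeriesConverges x) :
    Tendsto x atTop (𝓝 0) := by
  obtain ⟨s, hs⟩ := hx
  have h1 := ((tendsto_add_atTop_iff_nat 1).2 hs).sub hs
  rw [sub_self] at h1
  refine h1.congr fun n => ?_
  rw [Finset.sum_range_succ, add_sub_cancel_left]

lemma seriesConverges_of_summable {x : ℕ → X} (hx : Summable x) : SeriesConverges x :=
  ⟨_, hx.hasSum.tendsto_sum_nat⟩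

variable [NormedSpace ℝ X] [NormedSpace ℝ Y]

lemma SeqEquivalent.symm {x : ℕ → X} {y : ℕ → Y} (h : SeqEquivalent x y) : SeqEquivalent y x :=
  fun a => (h a).symm

lemma SeqEquivalent.trans {Z : Type*} [NormedAddCommGroup Z] [NormedSpace ℝ Z] {x : ℕ → X}
    {y : ℕ → Y} {z : ℕ → Z} (h : SeqEquivalent x y) (h' : SeqEquivalent y z) : SeqEquivalent x z :=
  fun a => (h a).trans (h' a)

/-- If `a k • x k` is null and `‖x k‖` is bounded below, then `a` is bounded. -/
lemma exists_bound_of_tendsto_zero {x : ℕ → X} {m : ℝ} (hm : 0 < m) (hx : ∀ k, m ≤ ‖x k‖)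
    {a : ℕ → ℝ} (h : Tendsto (fun k => a k • x k) atTop (𝓝 0)) : ∃ B, ∀ k, |a k| ≤ B := by
  obtain ⟨B, hB⟩ := isBounded_iff_forall_norm_le.1 (Metric.isBounded_range_of_tendsto _ h)
  refine ⟨B / m, fun k => ?_⟩
  rw [le_div_iff₀ hm]
  have := hB _ (Set.mem_range_self k)
  rw [norm_smul, Real.norm_eq_abs] at this
  exact (mul_le_mul_of_nonneg_left (hx k) (abs_nonneg _)).trans this

/-- Small perturbations of a sequence that is bounded below are equivalent to it. -/
lemma SeqEquivalent.of_summable_sub [CompleteSpace X] {x y : ℕ → X} {m : ℝ} (hm : 0 < m)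
    (hx : ∀ k, m ≤ ‖x k‖) (hy : ∀ k, m ≤ ‖y k‖) (h : Summable fun k => ‖x k - y k‖) :
    SeqEquivalent x y := by
  have key : ∀ {x y : ℕ → X}, (∀ k, m ≤ ‖x k‖) → (Summable fun k => ‖x k - y k‖) → ∀ a : ℕ → ℝ,
      SeriesConverges (fun k => a k • x k) → SeriesConverges (fun k => a k • y k) := by
    intro x y hx h a ha
    obtain ⟨B, hB⟩ := exists_bound_of_tendsto_zero hm hx ha.tendsto_zero
    have h1 : Summable fun k => a k • (y k - x k) := by
      refine Summable.of_norm_bounded (g := fun k => B * ‖x k - y k‖) (h.mul_left B) fun k => ?_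
      rw [norm_smul, Real.norm_eq_abs, norm_sub_rev]
      exact mul_le_mul_of_nonneg_right (hB k) (norm_nonneg _)
    have h2 := ha.add (seriesConverges_of_summable h1)
    refine (funext fun k => ?_ : (fun k => a k • x k + a k • (y k - x k)) = fun k => a k • y k) ▸ h2
    rw [← smul_add, add_sub_cancel]
  exact fun a => ⟨key hx h a, key hy (by simpa only [norm_sub_rev] using h) a⟩

lemma SeqEquivalent.smul_right (x : ℕ → X) {c : ℝ} (hc : c ≠ 0) :
    SeqEquivalent x fun k => c • x k := by
  have key : ∀ (c : ℝ) (y : ℕ → X), SeriesConverges y → SeriesConverges fun k => c • y k := by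
    rintro c y ⟨s, hs⟩
    refine ⟨c • s, (hs.const_smul c).congr fun n => ?_⟩
    rw [Finset.smul_sum]
  intro a
  constructor
  · intro h
    have := key c _ h
    simpa only [smul_comm c] using this
  · intro h
    have := key c⁻¹ _ h
    simpa only [smul_comm (a _) c, inv_smul_smul₀ hc] using this

/-- The uniform boundedness principle for the expansions along a basic sequence `x`: if some family
of finite sums of `a k • y k` is bounded whenever `∑ a k • x k` converges, then these sums are
bounded by a multiple of the norm of the expansion. -/
lemma IsBasicSequence.exists_bound [CompleteSpace X] {x : ℕ → X} (hx : IsBasicSequence x)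
    {y : ℕ → Y} {ι : Type*} (F : ι → Finset ℕ)
    (h : ∀ a : ℕ → ℝ, SeriesConverges (fun k => a k • x k) → ∃ C, ∀ i, ‖∑ k ∈ F i, a k • y k‖ ≤ C) :
    ∃ C, ∀ (a : ℕ → ℝ) (n : ℕ) (i : ι), F i ⊆ Finset.range n →
      ‖∑ k ∈ F i, a k • y k‖ ≤ C * ‖∑ k ∈ Finset.range n, a k • x k‖ := by
  have hcl := Submodule.isClosed_topologicalClosure (Submodule.span ℝ (Set.range x))
  unfold IsBasicSequence at hx
  generalize (Submodule.span ℝ (Set.range x)).topologicalClosure = Z at hx hcl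
  obtain ⟨b, hb⟩ := hx
  have : CompleteSpace Z := hcl.completeSpace_coe
  set T : ι → Z →L[ℝ] Y := fun i => ∑ k ∈ F i, (b.coord k).smulRight (y k) with hT
  have hTapp : ∀ i z, T i z = ∑ k ∈ F i, b.coord k z • y k := by
    intro i z
    rw [hT, _root_.sum_apply]
    rfl
  obtain ⟨C, hC⟩ := banach_steinhaus (g := T) fun z => by
    have h1 : SeriesConverges fun k => b.coord k z • x k := by
      refine ⟨(z : X), ?_⟩
      have h2 := (Submodule.subtypeL Z).continuous.tendsto z |>.comp (SchauderBasis.tendsto_proj b z)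
      refine h2.congr fun n => ?_
      rw [Function.comp_apply, SchauderBasis.proj_apply, map_sum]
      refine Finset.sum_congr rfl fun k _ => ?_
      rw [map_smul]
      exact congrArg (b.coord k z • ·) (hb k)
    obtain ⟨C, hC⟩ := h _ h1
    exact ⟨C, fun i => by rw [hTapp]; exact hC i⟩
  refine ⟨C, fun a n i hi => ?_⟩
  set z : Z := ∑ k ∈ Finset.range n, a k • b k with hz
  have hcoord : ∀ k ∈ Finset.range n, b.coord k z = a k := by
    classical
    intro k hk
    rw [hz, map_sum, Finset.sum_eq_single_of_mem k hk]
    · rw [map_smul, b.ortho]; simp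
    · intro l _ hl
      rw [map_smul, b.ortho]; simp [hl.symm]
  have h1 : T i z = ∑ k ∈ F i, a k • y k := by
    rw [hTapp]
    exact Finset.sum_congr rfl fun k hk => by rw [hcoord k (hi hk)]
  have h2 : ‖z‖ = ‖∑ k ∈ Finset.range n, a k • x k‖ := by
    change ‖(z : X)‖ = _
    rw [hz, Submodule.coe_sum]
    simp only [Submodule.coe_smul, hb]
  rw [← h1, ← h2]
  exact ((T i).le_opNorm z).trans (mul_le_mul_of_nonneg_right (hC i) (norm_nonneg _))

lemma IsBasicSequence.ne_zero {x : ℕ → X} (hx : IsBasicSequence x) (k : ℕ) : x k ≠ 0 := by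
  obtain ⟨b, hb⟩ := hx
  intro h
  have h1 : b k = 0 := Subtype.ext (by rw [hb k, h]; rfl)
  have h2 := b.ortho k k
  rw [h1, map_zero] at h2
  simp at h2

/-- A domination of basic sequences holds with a uniform constant. -/
lemma IsBasicSequence.exists_dominates [CompleteSpace X] {x : ℕ → X} (hx : IsBasicSequence x)
    {y : ℕ → Y} (h : SeqEquivalent x y) :
    ∃ C, ∀ (a : ℕ → ℝ) (n : ℕ), ‖∑ k ∈ Finset.range n, a k • y k‖ ≤
      C * ‖∑ k ∈ Finset.range n, a k • x k‖ := by
  obtain ⟨C, hC⟩ := hx.exists_bound (y := y) Finset.range fun a ha => by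
    obtain ⟨s, hs⟩ := (h a).1 ha
    obtain ⟨C, hC⟩ := isBounded_iff_forall_norm_le.1 (Metric.isBounded_range_of_tendsto _ hs)
    exact ⟨C, fun i => hC _ (Set.mem_range_self i)⟩
  exact ⟨C, fun a n => hC a n n subset_rfl⟩

/-- The members of a subsymmetric basic sequence have norms bounded above and below. -/
lemma exists_norm_bounds_of_subseq {x : ℕ → X} [CompleteSpace X] (hx : IsBasicSequence x)
    (h : ∀ φ : ℕ → ℕ, StrictMono φ → SeqEquivalent x (x ∘ φ)) :
    ∃ m M : ℝ, 0 < m ∧ ∀ k, m ≤ ‖x k‖ ∧ ‖x k‖ ≤ M := by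
  have hpos : ∀ k, 0 < ‖x k‖ := fun k => norm_pos_iff.2 (hx.ne_zero k)
  have hgeom : Summable fun k : ℕ => ((1 : ℝ) / 2) ^ k := summable_geometric_two
  have hlow : ∃ m > 0, ∀ k, m ≤ ‖x k‖ := by
    by_contra! hcon
    have hfreq : ∀ n : ℕ, ∃ᶠ k in atTop, ‖x k‖ ≤ (1 / 2) ^ n * ‖x n‖ := by
      intro n
      rw [frequently_atTop]
      intro N
      have hne : (Finset.range (N + 1)).Nonempty := ⟨0, Finset.mem_range.2 N.succ_pos⟩
      obtain ⟨j, hj, hjmin⟩ := Finset.exists_min_image (Finset.range (N + 1)) (fun k => ‖x k‖) hne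
      obtain ⟨k, hk⟩ := hcon (min ‖x j‖ ((1 / 2) ^ n * ‖x n‖))
        (lt_min (hpos j) (mul_pos (by positivity) (hpos n)))
      refine ⟨k, ?_, (hk.trans_le (min_le_right _ _)).le⟩
      by_contra hkN
      have := hjmin k (Finset.mem_range.2 (by omega))
      exact absurd (hk.trans_le (min_le_left _ _)) (not_lt.2 this)
    obtain ⟨φ, hφ, hφx⟩ := extraction_forall_of_frequently hfreq
    have h1 : SeriesConverges fun k => (‖x k‖⁻¹ : ℝ) • (x ∘ φ) k := by
      refine seriesConverges_of_summable (Summable.of_norm_bounded hgeom fun k => ?_)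
      rw [norm_smul, norm_inv, norm_norm, inv_mul_le_iff₀ (hpos k), mul_comm]
      exact hφx k
    have h2 := ((h φ hφ _).2 h1).tendsto_zero.norm
    simp only [norm_smul, norm_inv, norm_norm, inv_mul_cancel₀ (hpos _).ne', norm_zero] at h2
    exact one_ne_zero (tendsto_nhds_unique tendsto_const_nhds h2)
  have hup : ∃ M, ∀ k, ‖x k‖ ≤ M := by
    by_contra! hcon
    have hfreq : ∀ n : ℕ, ∃ᶠ k in atTop, 2 ^ n * ‖x n‖ ≤ ‖x k‖ := by
      intro n
      rw [frequently_atTop]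
      intro N
      have hne : (Finset.range (N + 1)).Nonempty := ⟨0, Finset.mem_range.2 N.succ_pos⟩
      obtain ⟨j, hj, hjmax⟩ := Finset.exists_max_image (Finset.range (N + 1)) (fun k => ‖x k‖) hne
      obtain ⟨k, hk⟩ := hcon (max ‖x j‖ (2 ^ n * ‖x n‖))
      refine ⟨k, ?_, ((le_max_right _ _).trans_lt hk).le⟩
      by_contra hkN
      have := hjmax k (Finset.mem_range.2 (by omega))
      exact absurd ((le_max_left _ _).trans_lt hk) (not_lt.2 this)
    obtain ⟨φ, hφ, hφx⟩ := extraction_forall_of_frequently hfreq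
    have h1 : SeriesConverges fun k => ((1 / 2) ^ k * ‖x k‖⁻¹ : ℝ) • x k := by
      refine seriesConverges_of_summable (Summable.of_norm_bounded hgeom fun k => ?_)
      rw [norm_smul, norm_mul, norm_inv, norm_norm, mul_assoc, inv_mul_cancel₀ (hpos k).ne', mul_one,
        Real.norm_of_nonneg (by positivity)]
    have h2 := ((h φ hφ _).1 h1).tendsto_zero.norm
    rw [norm_zero] at h2
    refine absurd (ge_of_tendsto' h2 (b := (1 : ℝ)) fun k => ?_) (by norm_num)
    rw [norm_smul, norm_mul, norm_inv, norm_norm, Real.norm_of_nonneg (by positivity),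
      Function.comp_apply]
    calc (1 : ℝ) = (1 / 2) ^ k * ‖x k‖⁻¹ * (2 ^ k * ‖x k‖) := by
          have := (hpos k).ne'
          rw [one_div, inv_pow]
          field_simp
      _ ≤ _ := mul_le_mul_of_nonneg_left (hφx k) (by positivity)
  obtain ⟨m, hm, h1⟩ := hlow
  obtain ⟨M, h2⟩ := hup
  exact ⟨m, M, hm, fun k => ⟨h1 k, h2 k⟩⟩

/-- A subsequence of an unconditional basic sequence inherits unconditional convergence. -/
lemma IsUnconditionalBasicSequence.summable_comp [CompleteSpace X] {x : ℕ → X}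
    (hx : IsUnconditionalBasicSequence x) {φ : ℕ → ℕ} (hφ : StrictMono φ) {a : ℕ → ℝ}
    (ha : SeriesConverges fun k => a k • (x ∘ φ) k) : Summable fun k => a k • (x ∘ φ) k := by
  classical
  set b : ℕ → ℝ := Function.extend φ a 0 with hb
  have hb1 : ∀ k, b (φ k) = a k := fun k => hφ.injective.extend_apply _ _ _
  have hb0 : ∀ j, j ∉ Set.range φ → b j = 0 := fun j hj =>
    Function.extend_apply' _ _ _ fun ⟨k, hk⟩ => hj ⟨k, hk⟩
  have hconv : SeriesConverges fun j => b j • x j := by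
    rw [seriesConverges_iff] at ha ⊢
    intro ε hε
    obtain ⟨N, hN⟩ := ha ε hε
    refine ⟨φ N, fun m n hm hmn => ?_⟩
    -- the indices `k` with `m ≤ φ k < n` form an interval
    have hex : ∀ m, ∃ k, m ≤ φ k := fun m => ⟨m, hφ.id_le m⟩
    set k₁ := Nat.find (hex m) with hk₁
    set k₂ := Nat.find (hex n) with hk₂
    have hiff : ∀ m k, Nat.find (hex m) ≤ k ↔ m ≤ φ k := by
      intro m k
      constructor
      · intro h; exact (Nat.find_spec (hex m)).trans (hφ.monotone h)
      · intro h; exact Nat.find_min' _ h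
    have h1 : N ≤ k₁ := by
      by_contra h
      have h2 : φ k₁ < φ N := hφ (by omega)
      have h3 : m ≤ φ k₁ := Nat.find_spec (hex m)
      omega
    have h2 : k₁ ≤ k₂ := (hiff m k₂).2 (hmn.trans (Nat.find_spec (hex n)))
    have h3 : ∑ j ∈ Finset.Ico m n, b j • x j = ∑ k ∈ Finset.Ico k₁ k₂, a k • (x ∘ φ) k := by
      have himg : (Finset.Ico k₁ k₂).image φ ⊆ Finset.Ico m n := by
        intro j hj
        obtain ⟨k, hk, rfl⟩ := Finset.mem_image.1 hj
        rw [Finset.mem_Ico] at hk ⊢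
        refine ⟨(hiff m k).1 hk.1, ?_⟩
        by_contra h
        exact absurd ((hiff n k).2 (by omega)) (by omega)
      rw [← Finset.sum_subset himg]
      · rw [Finset.sum_image fun _ _ _ _ h => hφ.injective h]
        exact Finset.sum_congr rfl fun k _ => by rw [hb1]; rfl
      · intro j hj hj'
        rw [hb0, zero_smul]
        rintro ⟨k, rfl⟩
        rw [Finset.mem_Ico] at hj
        refine hj' (Finset.mem_image_of_mem _ (Finset.mem_Ico.2 ⟨(hiff m k).2 hj.1, ?_⟩))
        by_contra h
        exact absurd ((hiff n k).1 (by omega)) (by omega)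
    rw [h3]
    exact hN k₁ k₂ h1 h2
  have := (hx.2 b hconv).comp_injective hφ.injective
  refine this.congr fun k => ?_
  simp [hb1]

/-- If a functional is bounded below on a subsequence of a subsymmetric basic sequence, then that
sequence satisfies a lower `ℓ₁` estimate. -/
lemma IsSubsymmetric.exists_lower_l1 [CompleteSpace X] {x : ℕ → X} (hx : IsSubsymmetric x)
    (f : StrongDual ℝ X) {δ : ℝ} (hδ : 0 < δ) {φ : ℕ → ℕ} (hφ : StrictMono φ)
    (h : ∀ k, δ ≤ |f (x (φ k))|) :
    ∃ c > 0, ∀ (a : ℕ → ℝ) (n : ℕ),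
      c * ∑ k ∈ Finset.range n, |a k| ≤ ‖∑ k ∈ Finset.range n, a k • x k‖ := by
  obtain ⟨C, hC⟩ := hx.1.1.exists_bound (y := fun _ => (1 : ℝ)) (fun F : Finset ℕ => F) fun a ha => by
    have h1 := hx.1.summable_comp hφ ((hx.2 φ hφ a).1 ha)
    have h2 := (f.summable h1).abs
    have h3 : Summable fun k => |a k| := by
      refine Summable.of_nonneg_of_le (fun k => abs_nonneg _) (fun k => ?_) (h2.mul_left δ⁻¹)
      rw [Function.comp_apply, map_smul, smul_eq_mul, abs_mul, le_inv_mul_iff₀ hδ, mul_comm]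
      exact mul_le_mul_of_nonneg_left (h k) (abs_nonneg _)
    refine ⟨∑' k, |a k|, fun F => ?_⟩
    simp only [smul_eq_mul, mul_one]
    exact (Finset.abs_sum_le_sum_abs _ _).trans (h3.sum_le_tsum F fun k _ => abs_nonneg _)
  refine ⟨(2 * (|C| + 1))⁻¹, by positivity, fun a n => ?_⟩
  rw [inv_mul_le_iff₀ (by positivity)]
  set z := ‖∑ k ∈ Finset.range n, a k • x k‖
  have hz : 0 ≤ z := norm_nonneg _
  have h1 := hC a n ((Finset.range n).filter (0 ≤ a ·)) (Finset.filter_subset _ _)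
  have h2 := hC a n ((Finset.range n).filter (¬ 0 ≤ a ·)) (Finset.filter_subset _ _)
  simp only [smul_eq_mul, mul_one, Real.norm_eq_abs] at h1 h2
  have h3 : ∑ k ∈ Finset.range n, |a k| = ∑ k ∈ (Finset.range n).filter (0 ≤ a ·), a k -
      ∑ k ∈ (Finset.range n).filter (¬ 0 ≤ a ·), a k := by
    rw [← Finset.sum_filter_add_sum_filter_not (Finset.range n) (0 ≤ a ·), sub_eq_add_neg,
      ← Finset.sum_neg_distrib]
    congr 1
    · exact Finset.sum_congr rfl fun k hk => abs_of_nonneg (Finset.mem_filter.1 hk).2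
    · exact Finset.sum_congr rfl fun k hk => abs_of_neg (not_le.1 (Finset.mem_filter.1 hk).2)
  have h4 : C * z ≤ |C| * z := mul_le_mul_of_nonneg_right (le_abs_self C) hz
  have h5 := (le_abs_self _).trans h1
  have h6 := (neg_le_abs _).trans h2
  rw [h3]
  nlinarith

/-- A Schauder basis of the whole space is a basic sequence. -/
lemma SchauderBasis.isBasicSequence {x : ℕ → X} (b : SchauderBasis ℝ X) (hb : ∀ j, b j = x j) :
    IsBasicSequence x := by
  set Z := (Submodule.span ℝ (Set.range x)).topologicalClosure with hZ
  have hmem : ∀ j, x j ∈ Z := fun j =>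
    Submodule.le_topologicalClosure _ (Submodule.subset_span (Set.mem_range_self j))
  refine ⟨{ basis := fun j => ⟨x j, hmem j⟩
            coord := fun i => (b.coord i).comp Z.subtypeL
            ortho := fun i j => ?_
            expansion := fun z => ?_ }, fun j => rfl⟩
  · have := b.ortho i j
    rw [hb j] at this
    exact this
  · rw [HasSum, SummationFilter.conditional_filter_eq_map_range, tendsto_map'_iff,
      tendsto_subtype_rng]
    refine (SchauderBasis.tendsto_proj b (z : X)).congr fun n => ?_
    rw [SchauderBasis.proj_apply, Function.comp_apply, Submodule.coe_sum]
    exact Finset.sum_congr rfl fun j _ => by rw [hb j]; rfl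

end Sequences

namespace TirilmanParam

variable (P : TirilmanParam)

/-! ### The coordinate functionals are subsymmetric but not symmetric -/

lemma norm_sum_basis_mono {S T : Finset ℕ} (h : S ⊆ T) (a : ℕ → ℝ) :
    ‖∑ j ∈ S, a j • dualTirilmanBasis P j‖ ≤ ‖∑ j ∈ T, a j • dualTirilmanBasis P j‖ := by
  rw [← ofCoef_vecOn, ← ofCoef_vecOn]
  refine P.norm_ofCoef_le_of_abs_le fun i => ?_
  rw [vecOn_apply, vecOn_apply]
  by_cases hi : i ∈ S
  · rw [if_pos hi, if_pos (h hi)]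
  · rw [if_neg hi, abs_zero]
    exact abs_nonneg _

lemma isUnconditionalBasicSequence_dualBasis (hγ : P.γ ≤ 1 / 2) :
    IsUnconditionalBasicSequence (dualTirilmanBasis P) := by
  refine ⟨SchauderBasis.isBasicSequence (P.dualSchauderBasis hγ) fun _ => rfl, fun a ha => ?_⟩
  rw [summable_iff_vanishing_norm]
  intro ε hε
  obtain ⟨N, hN⟩ := seriesConverges_iff.1 ha ε hε
  refine ⟨Finset.range N, fun t ht => ?_⟩
  refine (P.norm_sum_basis_mono (T := Finset.Ico N (max N (t.sup id + 1))) (fun i hi => ?_) a).trans_lt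
    (hN N _ le_rfl (le_max_left _ _))
  have h1 : i ≤ t.sup id := Finset.le_sup (f := id) hi
  have h2 : ¬ i < N := fun h => Finset.disjoint_left.1 ht hi (Finset.mem_range.2 h)
  rw [Finset.mem_Ico]
  omega

lemma ofCoef_mapDomain_vecOn (φ : ℕ → ℕ) (S : Finset ℕ) (a : ℕ → ℝ) :
    P.ofCoef (Finsupp.mapDomain φ (vecOn S a)) = ∑ k ∈ S, a k • dualTirilmanBasis P (φ k) := by
  rw [vecOn, Finsupp.mapDomain_finsetSum, map_sum]
  refine Finset.sum_congr rfl fun k _ => ?_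
  rw [Finsupp.mapDomain_single]
  exact Finsupp.linearCombination_single _ _ _

/-- The basis of the dual is isometrically equivalent to its subsequences. -/
lemma norm_sum_basis_comp {φ : ℕ → ℕ} (hφ : StrictMono φ) (S : Finset ℕ) (a : ℕ → ℝ) :
    ‖∑ k ∈ S, a k • dualTirilmanBasis P (φ k)‖ = ‖∑ k ∈ S, a k • dualTirilmanBasis P k‖ := by
  refine le_antisymm ?_ ?_
  · have h := P.norm_ofCoef_sum_block_le (α := fun k => Finsupp.single (φ k) 1)
      (fun k l hkl i hi j hj => ?_) (fun k => by rw [norm_ofCoef_single, abs_one]) S a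
    · rw [ofCoef_vecOn, map_sum] at h
      refine le_of_eq_of_le ?_ h
      congr 1
      refine Finset.sum_congr rfl fun k _ => ?_
      rw [map_smul]
      congr 1
      rw [ofCoef, Finsupp.linearCombination_single, one_smul]
    · rw [Finset.mem_singleton.1 (Finsupp.support_single_subset hi),
        Finset.mem_singleton.1 (Finsupp.support_single_subset hj)]
      exact hφ hkl
  · rw [← ofCoef_vecOn, ← ofCoef_mapDomain_vecOn]
    exact P.norm_ofCoef_le_mapDomain hφ _

lemma seqEquivalent_dualBasis_comp {φ : ℕ → ℕ} (hφ : StrictMono φ) :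
    SeqEquivalent (dualTirilmanBasis P) (dualTirilmanBasis P ∘ φ) := fun a =>
  ⟨SeriesConverges.of_norm_le 1 fun m n => by
      rw [one_mul]; exact (P.norm_sum_basis_comp hφ _ a).le,
    SeriesConverges.of_norm_le 1 fun m n => by
      rw [one_mul]; exact (P.norm_sum_basis_comp hφ _ a).ge⟩

theorem isSubsymmetric_dualBasis (hγ : P.γ ≤ 1 / 2) : IsSubsymmetric (dualTirilmanBasis P) :=
  ⟨P.isUnconditionalBasicSequence_dualBasis hγ, fun _ hφ => P.seqEquivalent_dualBasis_comp hφ⟩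

/-- If `(e*_{σ k})` were dominated by `(e*_k)`, then by duality `(e_k)` would be dominated by
`(e_{σ k})`, which fails for a suitable permutation `σ`. -/
theorem not_isSymmetricSeq_dualBasis (hγ : P.γ ≤ 1 / 4) :
    ¬ IsSymmetricSeq (dualTirilmanBasis P) := by
  rintro ⟨hb, hsymm⟩
  obtain ⟨σ, hσ⟩ := P.exists_perm_not_dominated hγ
  obtain ⟨C, hC⟩ := hb.exists_dominates (hsymm σ)
  refine hσ ⟨|C|, fun b => ?_⟩
  obtain ⟨f, hf1, hf⟩ := exists_dual_vector'' ℝ (P.ofC00 b)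
  set n := b.support.sup id + 1 with hn
  have hsub : b.support ⊆ Finset.range n := fun i hi => by
    have h1 : i ≤ b.support.sup id := Finset.le_sup (f := id) hi
    rw [Finset.mem_range]
    omega
  set a := vecOn (Finset.range n) (P.coef f) with ha
  have ha1 : ‖P.ofCoef a‖ ≤ 1 := by
    refine (P.norm_le_of_abs_coef_le fun i => ?_).trans hf1
    rw [coef_ofCoef, ha, vecOn_apply]
    split_ifs
    · exact le_rfl
    · rw [abs_zero]; exact abs_nonneg _
  have h1 : P.ofCoef a (P.ofC00 b) = P.nrm b := by
    rw [← norm_ofC00]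
    refine Eq.trans ?_ hf
    rw [P.apply_ofC00 _ hsub, P.apply_ofC00 _ hsub]
    refine Finset.sum_congr rfl fun i hi => ?_
    rw [coef_ofCoef, ha, vecOn_apply, if_pos hi]
  have h2 : ‖P.ofCoef (Finsupp.mapDomain σ a)‖ ≤ |C| := by
    rw [ha, ofCoef_mapDomain_vecOn]
    refine (hC (P.coef f) n).trans ?_
    rw [← ofCoef_vecOn]
    exact (mul_le_mul (le_abs_self C) ha1 (norm_nonneg _) (abs_nonneg C)).trans_eq (mul_one _)
  rw [← h1, ← P.ofCoef_mapDomain_apply σ.injective]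
  exact ((le_abs_self _).trans (P.abs_apply_ofC00_le _ _)).trans
    (mul_le_mul_of_nonneg_right h2 (P.nrm_nonneg _))

/-! ### Coordinatewise null sequences and block sequences -/

/-- Gliding hump: a coordinatewise null sequence in the dual has a subsequence that is close to a
block sequence. -/
lemma exists_blockSeq_near (hγ : P.γ ≤ 1 / 2) {y : ℕ → DualTirilmanSpace P}
    (hy : ∀ i, Tendsto (fun n => P.coef (y n) i) atTop (𝓝 0)) {ε : ℕ → ℝ} (hε : ∀ k, 0 < ε k) :
    ∃ (φ : ℕ → ℕ) (α : ℕ → ℕ →₀ ℝ), StrictMono φ ∧ IsBlockSeq α ∧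
      ∀ k, ‖y (φ k) - P.ofCoef (α k)‖ ≤ ε k := by
  refine exists_blockSeq_strictMono (p := fun k n x => ‖y n - P.ofCoef x‖ ≤ ε k) fun k N => ?_
  have h1 : Tendsto (fun n => P.partialSum (y n) N) atTop (𝓝 0) := by
    simp only [partialSum, ofCoef_vecOn]
    rw [← Finset.sum_const_zero (s := Finset.range N)]
    refine tendsto_finsetSum _ fun j _ => ?_
    have := (hy j).smul_const (dualTirilmanBasis P j)
    rwa [zero_smul] at this
  obtain ⟨n, hn, hnN⟩ := (((tendsto_zero_iff_norm_tendsto_zero.1 h1).eventually_lt_const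
    (half_pos (hε k))).and (eventually_ge_atTop N)).exists
  obtain ⟨N', hN', hNN'⟩ := (((tendsto_iff_norm_sub_tendsto_zero.1
    (P.tendsto_partialSum hγ (y n))).eventually_lt_const (half_pos (hε k))).and
    (eventually_ge_atTop N)).exists
  refine ⟨n, hnN, vecOn (Finset.Ico N N') (P.coef (y n)), fun i hi => ?_, ?_⟩
  · rw [Finsupp.mem_support_iff, vecOn_apply] at hi
    exact (Finset.mem_Ico.1 (by_contra fun h => hi (if_neg h))).1
  · have h2 : P.ofCoef (vecOn (Finset.Ico N N') (P.coef (y n))) =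
        P.partialSum (y n) N' - P.partialSum (y n) N := by
      simp only [partialSum, ofCoef_vecOn]
      exact Finset.sum_Ico_eq_sub _ hNN'
    rw [h2, show y n - (P.partialSum (y n) N' - P.partialSum (y n) N) =
      P.partialSum (y n) N - (P.partialSum (y n) N' - y n) by abel]
    linarith [norm_sub_le (P.partialSum (y n) N) (P.partialSum (y n) N' - y n)]

/-- A bounded sequence in the dual has no lower `ℓ₁` estimate: the differences of a coordinatewise
convergent subsequence are close to a block sequence, and sums of `K` of them have norm of order at
most `K ^ (1 / q)`. -/
lemma not_lower_l1_estimate (hγ : P.γ ≤ 1 / 2) {x : ℕ → DualTirilmanSpace P} {M : ℝ}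
    (hM : ∀ k, ‖x k‖ ≤ M) {c : ℝ} (hc : 0 < c) : ¬ ∀ (a : ℕ → ℝ) (n : ℕ),
      c * ∑ k ∈ Finset.range n, |a k| ≤ ‖∑ k ∈ Finset.range n, a k • x k‖ := by
  intro h
  have hp := P.p_pos
  have hq := P.q_pos
  have hγ0 := P.γ_pos
  have hM0 : 0 ≤ M := (norm_nonneg _).trans (hM 0)
  obtain ⟨u, -, ψ, hψ, hu⟩ := (isCompact_univ_pi fun _ : ℕ => isCompact_Icc (a := -M) (b := M)).tendsto_subseq
    (x := fun n i => P.coef (x n) i)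
    fun n i _ => abs_le.1 ((P.abs_coef_le _ i).trans (hM n))
  rw [tendsto_pi_nhds] at hu
  set y : ℕ → DualTirilmanSpace P := fun k => x (ψ (2 * k + 1)) - x (ψ (2 * k)) with hy
  have hy0 : ∀ i, Tendsto (fun n => P.coef (y n) i) atTop (𝓝 0) := by
    intro i
    have h1 : Tendsto (fun k : ℕ => 2 * k + 1) atTop atTop :=
      tendsto_atTop_mono (fun k => (by omega : k ≤ _)) tendsto_id
    have h2 : Tendsto (fun k : ℕ => 2 * k) atTop atTop :=
      tendsto_atTop_mono (fun k => (by omega : k ≤ _)) tendsto_id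
    have h3 := ((hu i).comp h1).sub ((hu i).comp h2)
    rwa [sub_self] at h3
  obtain ⟨φ, α, hφ, hα, hφα⟩ := P.exists_blockSeq_near hγ hy0 (ε := fun k => (1 / 2) ^ k)
    fun k => by positivity
  have hyM : ∀ k, ‖y k‖ ≤ 2 * M := fun k =>
    (norm_sub_le _ _).trans (by linarith [hM (ψ (2 * k + 1)), hM (ψ (2 * k))])
  have hαM : ∀ k, ‖P.ofCoef (α k)‖ ≤ 2 * M + 1 := fun k => by
    have h1 : ((1 : ℝ) / 2) ^ k ≤ 1 := pow_le_one₀ (by norm_num) (by norm_num)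
    have h2 := norm_sub_norm_le (P.ofCoef (α k)) (y (φ k))
    rw [norm_sub_rev (P.ofCoef (α k))] at h2
    linarith [hφα k, hyM (φ k)]
  have hup : ∀ K : ℕ, ‖∑ k ∈ Finset.range K, y (φ k)‖ ≤
      P.γ⁻¹ * (K : ℝ) ^ (1 / P.q) * (2 * M + 1) + 2 := by
    intro K
    have h1 := P.norm_ofCoef_sum_le (Finset.range K) (α := α) (fun i _ j _ hij => hα i j hij)
      (by positivity) fun j _ => hαM j
    rw [Finset.card_range, map_sum] at h1
    have h2 : ‖∑ k ∈ Finset.range K, (y (φ k) - P.ofCoef (α k))‖ ≤ 2 :=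
      (norm_sum_le_of_le _ fun k _ => hφα k).trans (sum_geometric_two_le K)
    rw [Finset.sum_sub_distrib] at h2
    have h3 := norm_sub_norm_le (∑ k ∈ Finset.range K, y (φ k)) (∑ k ∈ Finset.range K, P.ofCoef (α k))
    linarith
  have hlow : ∀ K : ℕ, c * K ≤ ‖∑ k ∈ Finset.range K, y (φ k)‖ := by
    classical
    intro K
    set s : ℕ → ℕ := fun k => ψ (2 * φ k + 1) with hs
    set t : ℕ → ℕ := fun k => ψ (2 * φ k) with ht
    have hsi : Function.Injective s := fun k l hkl => hφ.injective (by
      have := hψ.injective hkl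
      omega)
    have hst : ∀ k l, s k ≠ t l := fun k l hkl => by
      have := hψ.injective hkl
      omega
    set a : ℕ → ℝ := fun j => ∑ k ∈ Finset.range K,
      ((if j = s k then (1 : ℝ) else 0) - if j = t k then (1 : ℝ) else 0) with ha
    set n := s K with hn
    have hsn : ∀ k < K, s k < n := fun k hk => hψ (by have := hφ hk; omega)
    have htn : ∀ k < K, t k < n := fun k hk => hψ (by have := hφ hk; omega)
    have h1 : ∑ j ∈ Finset.range n, a j • x j = ∑ k ∈ Finset.range K, y (φ k) := by
      simp only [ha, Finset.sum_smul, sub_smul, ite_smul, one_smul, zero_smul]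
      rw [Finset.sum_comm]
      refine Finset.sum_congr rfl fun k hk => ?_
      rw [Finset.sum_sub_distrib, Finset.sum_ite_eq', Finset.sum_ite_eq',
        if_pos (Finset.mem_range.2 (hsn k (Finset.mem_range.1 hk))),
        if_pos (Finset.mem_range.2 (htn k (Finset.mem_range.1 hk)))]
    have h2 : ∀ k ∈ Finset.range K, a (s k) = 1 := by
      intro k hk
      simp only [ha, hsi.eq_iff, hst, if_false, sub_zero]
      rw [Finset.sum_ite_eq, if_pos hk]
    have h3 : (K : ℝ) ≤ ∑ j ∈ Finset.range n, |a j| := by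
      calc (K : ℝ) = ∑ k ∈ Finset.range K, |a (s k)| := by
            rw [Finset.sum_congr rfl fun k hk => by rw [h2 k hk, abs_one]]
            simp
        _ = ∑ j ∈ (Finset.range K).image s, |a j| :=
            (Finset.sum_image (f := fun j => |a j|) fun _ _ _ _ h => hsi h).symm
        _ ≤ _ := Finset.sum_le_sum_of_subset_of_nonneg (fun j hj => by
            obtain ⟨k, hk, rfl⟩ := Finset.mem_image.1 hj
            exact Finset.mem_range.2 (hsn k (Finset.mem_range.1 hk))) fun _ _ _ => abs_nonneg _
    rw [← h1]
    exact (mul_le_mul_of_nonneg_left h3 hc.le).trans (h a n)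
  set A := P.γ⁻¹ * (2 * M + 1) + 2 with hA
  have h4 : Tendsto (fun K : ℕ => (K : ℝ) ^ (1 / P.p)) atTop atTop :=
    (tendsto_rpow_atTop (one_div_pos.2 hp)).comp tendsto_natCast_atTop_atTop
  obtain ⟨K, hK, hK1⟩ := ((h4.eventually_gt_atTop (A / c)).and (eventually_ge_atTop 1)).exists
  have hK1' : (1 : ℝ) ≤ K := by exact_mod_cast hK1
  have h5 : (1 : ℝ) ≤ (K : ℝ) ^ (1 / P.q) := Real.one_le_rpow hK1' (by positivity)
  have h6 : (K : ℝ) = (K : ℝ) ^ (1 / P.p) * (K : ℝ) ^ (1 / P.q) := by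
    rw [← Real.rpow_add (by linarith), P.one_div_p_add_q, Real.rpow_one]
  have h7 : c * K ≤ A * (K : ℝ) ^ (1 / P.q) := by
    have := (hlow K).trans (hup K)
    rw [hA]
    linarith
  have h8 : c * (K : ℝ) ^ (1 / P.p) ≤ A :=
    le_of_mul_le_mul_right (by rwa [mul_assoc, ← h6]) (zero_lt_one.trans_le h5)
  rw [div_lt_iff₀ hc] at hK
  linarith

/-- A subsymmetric basic sequence in the dual is coordinatewise null. -/
lemma tendsto_coef_of_isSubsymmetric (hγ : P.γ ≤ 1 / 2) {x : ℕ → DualTirilmanSpace P}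
    (hx : IsSubsymmetric x) (i : ℕ) : Tendsto (fun n => P.coef (x n) i) atTop (𝓝 0) := by
  by_contra hcon
  obtain ⟨_, M, -, hM⟩ := exists_norm_bounds_of_subseq hx.1.1 hx.2
  rw [tendsto_zero_iff_norm_tendsto_zero, Metric.tendsto_atTop] at hcon
  push Not at hcon
  obtain ⟨δ, hδ, hfreq⟩ := hcon
  obtain ⟨φ, hφ, hφδ⟩ := extraction_of_frequently_atTop (frequently_atTop.2 hfreq)
  obtain ⟨c, hc, h⟩ := hx.exists_lower_l1 (ContinuousLinearMap.apply ℝ ℝ (tirilmanBasis P i)) hδ hφ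
    fun k => by
      have := hφδ k
      rwa [dist_zero_right, norm_norm, Real.norm_eq_abs] at this
  exact P.not_lower_l1_estimate hγ (fun k => (hM k).2) hc h

/-! ### Subsymmetric block sequences -/

/-- A block sequence in the dual with coefficients that are not uniformly null has a subsequence
that dominates the basis. -/
lemma seriesConverges_of_not_flat {α : ℕ → ℕ →₀ ℝ} (hα : IsBlockSeq α) {ε : ℝ} (hε : 0 < ε)
    {ψ : ℕ → ℕ} (hψ : StrictMono ψ) (h : ∀ k, ∃ i, ε ≤ |α (ψ k) i|) {a : ℕ → ℝ}
    (ha : SeriesConverges fun k => a k • P.ofCoef (α (ψ k))) :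
    SeriesConverges fun k => a k • dualTirilmanBasis P k := by
  choose i hi using h
  have hne : ∀ k, α (ψ k) (i k) ≠ 0 := fun k h0 => by
    have := hi k
    rw [h0, abs_zero] at this
    linarith
  have hmono : StrictMono i := fun k l hkl =>
    hα _ _ (hψ hkl) _ (Finsupp.mem_support_iff.2 (hne k)) _ (Finsupp.mem_support_iff.2 (hne l))
  refine ha.of_norm_le ε⁻¹ fun m n => ?_
  rw [← P.norm_sum_basis_comp hmono]
  have h1 : ∑ k ∈ Finset.Ico m n, a k • dualTirilmanBasis P (i k) =
      P.ofCoef (∑ k ∈ Finset.Ico m n, a k • Finsupp.single (i k) 1) := by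
    rw [map_sum]
    refine Finset.sum_congr rfl fun k _ => ?_
    rw [map_smul, ofCoef, Finsupp.linearCombination_single, one_smul]
  have h2 : ε⁻¹ * ‖∑ k ∈ Finset.Ico m n, a k • P.ofCoef (α (ψ k))‖ =
      ‖P.ofCoef (∑ k ∈ Finset.Ico m n, a k • ε⁻¹ • α (ψ k))‖ := by
    rw [map_sum, ← Real.norm_of_nonneg (inv_pos.2 hε).le, ← norm_smul, Finset.smul_sum,
      Real.norm_of_nonneg (inv_pos.2 hε).le]
    congr 1
    refine Finset.sum_congr rfl fun k _ => ?_
    rw [map_smul, map_smul, smul_comm]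
  rw [h1, h2]
  refine P.norm_ofCoef_le_of_abs_le ((hα.comp hψ).mono (y := fun k => ε⁻¹ • α (ψ k))
    (fun k => Finsupp.support_smul) |>.abs_sum_apply_le (fun k j => ?_) subset_rfl fun _ _ => le_rfl)
  rw [Finsupp.smul_apply, smul_eq_mul, abs_mul, abs_of_pos (inv_pos.2 hε)]
  by_cases hj : i k = j
  · rw [← hj, Finsupp.single_eq_same, abs_one, ← div_eq_inv_mul, one_le_div hε]
    exact hi k
  · rw [Finsupp.single_eq_of_ne (Ne.symm hj), abs_zero]
    positivity

/-- A block sequence in the dual that is bounded below has successive coefficient vectors whose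
`ℓ_q` norms tend to `0` fast although the corresponding combinations have norm at least `1`. -/
lemma exists_small_coefficients (hγ : P.γ < 1 / 32) {α : ℕ → ℕ →₀ ℝ} (hα : IsBlockSeq α) {δ : ℝ}
    (hδ : 0 < δ) (hα1 : ∀ k, δ ≤ ‖P.ofCoef (α k)‖) : ∃ b : ℕ → ℕ →₀ ℝ, IsBlockSeq b ∧
      ∀ i, (∀ k ∈ (b i).support, i ≤ k) ∧ c00Norm P.q (b i) ≤ (1 / 2) ^ i ∧
        1 ≤ ‖P.ofCoef (comb α (b i))‖ := by
  have hq := P.q_pos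
  refine exists_blockSeq (p := fun i b => (∀ k ∈ b.support, i ≤ k) ∧
    c00Norm P.q b ≤ (1 / 2) ^ i ∧ 1 ≤ ‖P.ofCoef (comb α b)‖) fun i N => ?_
  obtain ⟨a, ha, h⟩ := P.not_upper_q_estimate hγ hα hδ hα1 (2 ^ i) (max i N)
  have ha0 : a ≠ 0 := by
    rintro rfl
    rw [map_zero, map_zero, norm_zero] at h
    exact absurd h (not_lt.2 (mul_nonneg (by positivity) (coeffNorm_nonneg _ _ _)))
  have hpos := c00Norm_pos hq ha0
  have hc : 0 < (1 / 2) ^ i * (c00Norm P.q a)⁻¹ := by positivity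
  refine ⟨((1 / 2) ^ i * (c00Norm P.q a)⁻¹) • a,
    fun k hk => (le_max_right _ _).trans (ha k (Finsupp.support_smul hk)),
    fun k hk => (le_max_left _ _).trans (ha k (Finsupp.support_smul hk)), ?_, ?_⟩
  · rw [c00Norm_smul hq, abs_of_pos hc, mul_assoc, inv_mul_cancel₀ hpos.ne', mul_one]
  · rw [map_smul, map_smul, norm_smul, Real.norm_of_nonneg hc.le]
    calc (1 : ℝ) = (1 / 2) ^ i * (c00Norm P.q a)⁻¹ * (2 ^ i * c00Norm P.q a) := by
          rw [one_div, inv_pow]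
          field_simp
      _ ≤ _ := mul_le_mul_of_nonneg_left h.le hc.le

/-- A block sequence in the dual that is bounded below and has uniformly null coefficients is not
equivalent to all its subsequences: coefficients that are small in `ℓ_q` but large on the sequence
itself give a convergent series along a sparse subsequence. -/
lemma not_flat_of_seqEquivalent (hγ : P.γ < 1 / 32) {α : ℕ → ℕ →₀ ℝ} (hα : IsBlockSeq α) {δ : ℝ}
    (hδ : 0 < δ) (hα0 : ∀ k, δ ≤ ‖P.ofCoef (α k)‖) (hα1 : ∀ k, ‖P.ofCoef (α k)‖ ≤ 1)
    (heq : ∀ ψ : ℕ → ℕ, StrictMono ψ →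
      SeqEquivalent (fun k => P.ofCoef (α k)) fun k => P.ofCoef (α (ψ k))) :
    ∃ ε > 0, ∃ᶠ k in atTop, ∃ i, ε ≤ |α k i| := by
  classical
  by_contra! hflat
  have hq := P.q_pos
  have hγ0 := P.γ_pos
  obtain ⟨b, hb, hb'⟩ := P.exists_small_coefficients hγ hα hδ hα0
  have hbq : ∀ i, ∑ k ∈ (b i).support, |2 ^ i * b i k| ^ P.q ≤ 1 := by
    intro i
    have h1 : c00Norm P.q ((2 : ℝ) ^ i • b i) ≤ 1 := by
      rw [c00Norm_smul hq, abs_of_pos (by positivity)]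
      refine (mul_le_mul_of_nonneg_left (hb' i).2.1 (by positivity)).trans_eq ?_
      rw [← mul_pow]; norm_num
    rw [c00Norm_eq hq Finsupp.support_smul, coeffNorm] at h1
    by_contra! h2
    exact absurd (Real.one_lt_rpow h2 (one_div_pos.2 hq)) (not_lt.2 h1)
  choose ε hε hflatb using fun i =>
    P.exists_norm_sum_flat_le (by linarith) (b i).support (fun k => 2 ^ i * b i k) (hbq i)
  obtain ⟨ψ, hψ, hψε⟩ := extraction_forall_of_eventually
    (P := fun k n => ∀ i ∈ Finset.range (k + 1), ∀ l, |α n l| ≤ ε i) fun k => by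
      rw [eventually_all_finset]
      intro i _
      exact (hflat (ε i) (hε i)).mono fun n hn l => (hn l).le
  -- the combination of `α ∘ ψ` with coefficients `b i` has norm at most `16 γ⁻¹ 2⁻ⁱ`
  have hsmall : ∀ i, ‖P.ofCoef (∑ k ∈ (b i).support, b i k • α (ψ k))‖ ≤
      P.γ⁻¹ * 16 * (1 / 2) ^ i := by
    intro i
    have h1 := hflatb i (α ∘ ψ) (hα.comp hψ) (fun k => hα1 _) fun k hk l =>
      hψε k i (Finset.mem_range.2 (Nat.lt_succ_of_le ((hb' i).1 k hk))) l
    have h2 : ∑ k ∈ (b i).support, (2 ^ i * b i k) • (α ∘ ψ) k =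
        (2 : ℝ) ^ i • ∑ k ∈ (b i).support, b i k • α (ψ k) := by
      rw [Finset.smul_sum]
      exact Finset.sum_congr rfl fun k _ => mul_smul _ _ _
    rw [h2, map_smul, norm_smul, Real.norm_of_nonneg (by positivity)] at h1
    rw [one_div, inv_pow, ← div_eq_mul_inv, le_div_iff₀ (by positivity), mul_comm]
    exact h1
  set A : ℕ → ℝ := fun k => ∑ i ∈ Finset.range (k + 1), b i k with hA
  have hb0 : ∀ i k, k < i → b i k = 0 := fun i k hki => by
    by_contra h
    exact absurd ((hb' i).1 k (Finsupp.mem_support_iff.2 h)) (by omega)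
  have hAb : ∀ i, ∀ k ∈ (b i).support, A k = b i k := by
    intro i k hk
    refine Finset.sum_eq_single_of_mem i
      (Finset.mem_range.2 (Nat.lt_succ_of_le ((hb' i).1 k hk))) fun j _ hji => ?_
    by_contra h
    exact hji (hb.eq_of_apply_ne_zero h (Finsupp.mem_support_iff.1 hk))
  have hAn : ∀ n k, k < n → A k = ∑ i ∈ Finset.range n, b i k := by
    intro n k hk
    refine Finset.sum_subset (Finset.range_subset_range.2 hk) fun i _ hi => hb0 i k ?_
    rw [Finset.mem_range] at hi
    omega
  have hdiv : ¬ SeriesConverges fun k => A k • P.ofCoef (α k) := by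
    intro h
    obtain ⟨N, hN⟩ := seriesConverges_iff.1 h 1 one_pos
    set n := max N ((b N).support.sup id + 1) with hn
    have hsub : (b N).support ⊆ Finset.Ico N n := fun k hk => by
      have h1 : k ≤ (b N).support.sup id := Finset.le_sup (f := id) hk
      rw [Finset.mem_Ico]
      exact ⟨(hb' N).1 k hk, by omega⟩
    have h1 := P.norm_ofCoef_le_of_abs_le
      (hα.abs_sum_apply_le (fun _ _ => le_rfl) hsub fun k hk => (congrArg abs (hAb N k hk).symm).le)
    rw [← comb_eq_sum α subset_rfl, map_sum] at h1
    have h2 := hN N n le_rfl (le_max_left _ _)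
    simp only [← map_smul] at h2
    linarith [(hb' N).2.2]
  refine hdiv ((heq ψ hψ A).2 (seriesConverges_iff.2 fun η hη => ?_))
  have htend : Tendsto (fun i : ℕ => P.γ⁻¹ * 16 * (2 * (1 / 2 : ℝ) ^ i)) atTop (𝓝 0) := by
    have := ((tendsto_pow_atTop_nhds_zero_of_lt_one (r := (1 / 2 : ℝ)) (by norm_num)
      (by norm_num)).const_mul 2).const_mul (P.γ⁻¹ * 16)
    rwa [mul_zero, mul_zero] at this
  obtain ⟨i₀, hi₀⟩ := (htend.eventually_lt_const hη).exists
  set N := (Finset.range i₀).sup (fun i => (b i).support.sup id + 1) with hN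
  refine ⟨N, fun m n hm hmn => ?_⟩
  set w : ℕ → DualTirilmanSpace P := fun i =>
    P.ofCoef (∑ k ∈ Finset.Ico m n, b i k • α (ψ k)) with hw
  have h1 : ∑ k ∈ Finset.Ico m n, A k • P.ofCoef (α (ψ k)) = ∑ i ∈ Finset.range n, w i := by
    simp only [hw, map_sum, map_smul]
    rw [Finset.sum_comm]
    refine Finset.sum_congr rfl fun k hk => ?_
    rw [hAn n k (Finset.mem_Ico.1 hk).2, Finset.sum_smul]
  have hw0 : ∀ i < i₀, w i = 0 := by
    intro i hi
    rw [hw]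
    simp only
    rw [Finset.sum_eq_zero, map_zero]
    intro k hk
    rw [Finsupp.notMem_support_iff.1, zero_smul]
    intro hk'
    have h2 : k ≤ (b i).support.sup id := Finset.le_sup (f := id) hk'
    have h3 : (b i).support.sup id + 1 ≤ N :=
      Finset.le_sup (f := fun i => (b i).support.sup id + 1) (Finset.mem_range.2 hi)
    have h4 := (Finset.mem_Ico.1 hk).1
    omega
  have hw1 : ∀ i, ‖w i‖ ≤ P.γ⁻¹ * 16 * (1 / 2) ^ i := by
    intro i
    refine le_trans ?_ (hsmall i)
    have h2 : ∑ k ∈ (b i).support, b i k • α (ψ k) =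
        ∑ k ∈ Finset.Ico m n ∪ (b i).support, b i k • α (ψ k) :=
      Finset.sum_subset Finset.subset_union_right fun k _ hk => by
        rw [Finsupp.notMem_support_iff.1 hk, zero_smul]
    rw [h2]
    exact P.norm_ofCoef_le_of_abs_le ((hα.comp hψ).abs_sum_apply_le (fun _ _ => le_rfl)
      Finset.subset_union_left fun _ _ => le_rfl)
  rw [h1]
  refine lt_of_le_of_lt ?_ hi₀
  calc ‖∑ i ∈ Finset.range n, w i‖ ≤ ∑ i ∈ Finset.range n, ‖w i‖ := norm_sum_le _ _
    _ ≤ ∑ i ∈ Finset.range n, P.γ⁻¹ * 16 * (if i₀ ≤ i then (1 / 2 : ℝ) ^ i else 0) := by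
        refine Finset.sum_le_sum fun i _ => ?_
        split_ifs with h
        · exact hw1 i
        · rw [hw0 i (by omega), norm_zero, mul_zero]
    _ = P.γ⁻¹ * 16 * ∑ i ∈ Finset.range n, if i₀ ≤ i then (1 / 2 : ℝ) ^ i else 0 := by
        rw [Finset.mul_sum]
    _ ≤ _ := by
        refine mul_le_mul_of_nonneg_left ?_ (by positivity)
        rw [← Finset.sum_filter]
        calc ∑ i ∈ (Finset.range n).filter (i₀ ≤ ·), (1 / 2 : ℝ) ^ i
            = ∑ i ∈ Finset.Ico i₀ n, (1 / 2 : ℝ) ^ i := by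
              congr 1
              ext i
              simp only [Finset.mem_filter, Finset.mem_range, Finset.mem_Ico, and_comm]
          _ = (1 / 2 : ℝ) ^ i₀ * ∑ i ∈ Finset.range (n - i₀), (1 / 2 : ℝ) ^ i := by
              rw [Finset.sum_Ico_eq_sum_range, Finset.mul_sum]
              exact Finset.sum_congr rfl fun i _ => pow_add _ _ _
          _ ≤ (1 / 2 : ℝ) ^ i₀ * 2 :=
              mul_le_mul_of_nonneg_left (sum_geometric_two_le _) (by positivity)
          _ = _ := mul_comm _ _

/-- A seminormalized block sequence in the dual that is equivalent to all its subsequences is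
equivalent to the basis. -/
lemma seqEquivalent_of_blockSeq (hγ : P.γ < 1 / 32) {α : ℕ → ℕ →₀ ℝ} (hα : IsBlockSeq α) {δ : ℝ}
    (hδ : 0 < δ) (hα0 : ∀ k, δ ≤ ‖P.ofCoef (α k)‖) (hα1 : ∀ k, ‖P.ofCoef (α k)‖ ≤ 1)
    (heq : ∀ ψ : ℕ → ℕ, StrictMono ψ →
      SeqEquivalent (fun k => P.ofCoef (α k)) fun k => P.ofCoef (α (ψ k))) :
    SeqEquivalent (fun k => P.ofCoef (α k)) (dualTirilmanBasis P) := by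
  obtain ⟨ε, hε, hfreq⟩ := P.not_flat_of_seqEquivalent hγ hα hδ hα0 hα1 heq
  obtain ⟨ψ, hψ, h⟩ := extraction_of_frequently_atTop hfreq
  refine fun a => ⟨fun ha => P.seriesConverges_of_not_flat hα hε hψ h ((heq ψ hψ a).1 ha),
    SeriesConverges.of_norm_le 1 fun m n => ?_⟩
  have := P.norm_ofCoef_sum_block_le hα hα1 (Finset.Ico m n) a
  rw [ofCoef_vecOn, map_sum] at this
  simpa only [map_smul, one_mul] using this

/-- Every subsymmetric basic sequence in the dual is equivalent to the basis: it is coordinatewise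
null, so a subsequence of a multiple of it is a small perturbation of a block sequence. -/
theorem seqEquivalent_dualBasis (hγ : P.γ < 1 / 32) {x : ℕ → DualTirilmanSpace P}
    (hx : IsSubsymmetric x) : SeqEquivalent x (dualTirilmanBasis P) := by
  obtain ⟨m, M, hm, hmM⟩ := exists_norm_bounds_of_subseq hx.1.1 hx.2
  have hM : 0 < M := hm.trans_le ((hmM 0).1.trans (hmM 0).2)
  set c := (2 * M)⁻¹ with hc
  have hc0 : 0 < c := by positivity
  set y : ℕ → DualTirilmanSpace P := fun k => c • x k with hy
  have hyn : ∀ k, ‖y k‖ = c * ‖x k‖ := fun k => by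
    rw [hy, norm_smul, Real.norm_of_nonneg hc0.le]
  have hxy : SeqEquivalent x y := SeqEquivalent.smul_right x hc0.ne'
  have hysub : ∀ ψ : ℕ → ℕ, StrictMono ψ → SeqEquivalent y (y ∘ ψ) := fun ψ hψ =>
    hxy.symm.trans ((hx.2 ψ hψ).trans (SeqEquivalent.smul_right (x ∘ ψ) hc0.ne'))
  set δ := c * m with hδ
  have hδ0 : 0 < δ := by positivity
  have hy0 : ∀ k, δ ≤ ‖y k‖ := fun k => by
    rw [hyn]; exact mul_le_mul_of_nonneg_left (hmM k).1 hc0.le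
  have hy1 : ∀ k, ‖y k‖ ≤ 1 / 2 := fun k => by
    rw [hyn]
    refine (mul_le_mul_of_nonneg_left (hmM k).2 hc0.le).trans_eq ?_
    rw [hc]
    field_simp
  have hcoef : ∀ i, Tendsto (fun n => P.coef (y n) i) atTop (𝓝 0) := fun i => by
    have := (P.tendsto_coef_of_isSubsymmetric (by linarith) hx i).const_mul c
    rwa [mul_zero] at this
  obtain ⟨φ, α, hφ, hα, hφα⟩ := P.exists_blockSeq_near (by linarith) hcoef
    (ε := fun k => δ / 2 * (1 / 2) ^ k) fun k => by positivity
  have hφα' : ∀ k, ‖y (φ k) - P.ofCoef (α k)‖ ≤ δ / 2 := fun k =>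
    (hφα k).trans (mul_le_of_le_one_right (by positivity) (pow_le_one₀ (by norm_num) (by norm_num)))
  have hα0 : ∀ k, δ / 2 ≤ ‖P.ofCoef (α k)‖ := fun k => by
    linarith [norm_sub_norm_le (y (φ k)) (P.ofCoef (α k)), hφα' k, hy0 (φ k)]
  have hα1 : ∀ k, ‖P.ofCoef (α k)‖ ≤ 1 := fun k => by
    have := norm_sub_norm_le (P.ofCoef (α k)) (y (φ k))
    rw [norm_sub_rev (P.ofCoef (α k))] at this
    linarith [hφα' k, hy1 (φ k), hy0 (φ k)]
  have hsum : Summable fun k => ‖y (φ k) - P.ofCoef (α k)‖ :=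
    Summable.of_nonneg_of_le (fun _ => norm_nonneg _) hφα (summable_geometric_two.mul_left _)
  have hnear : ∀ ψ : ℕ → ℕ, StrictMono ψ →
      SeqEquivalent (y ∘ φ ∘ ψ) fun k => P.ofCoef (α (ψ k)) := fun ψ hψ =>
    SeqEquivalent.of_summable_sub (half_pos hδ0) (fun k => by
      rw [Function.comp_apply]; linarith [hy0 ((φ ∘ ψ) k)]) (fun k => hα0 _)
      (hsum.comp_injective hψ.injective)
  have hyα : SeqEquivalent y fun k => P.ofCoef (α k) :=
    (hysub φ hφ).trans (hnear id strictMono_id)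
  refine hxy.trans (hyα.trans (P.seqEquivalent_of_blockSeq hγ hα (half_pos hδ0) hα0 hα1 ?_))
  exact fun ψ hψ => hyα.symm.trans ((hysub (φ ∘ ψ) (hφ.comp hψ)).trans (hnear ψ hψ))

end TirilmanParam

end

theorem theorem2p10 (p : ℝ) (hp : 1 < p) :
    ∃ γ₀ : ℝ, 0 < γ₀ ∧ ∀ (γ : ℝ) (hγ : 0 < γ) (hγ1 : γ < 1), γ < γ₀ →
      (∃ b : SchauderBasis ℝ (DualTirilmanSpace ⟨p, γ, hp, hγ, hγ1⟩),
        ∀ j, b j = dualTirilmanBasis ⟨p, γ, hp, hγ, hγ1⟩ j) ∧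
      IsSubsymmetric (dualTirilmanBasis ⟨p, γ, hp, hγ, hγ1⟩) ∧
      ¬ IsSymmetricSeq (dualTirilmanBasis ⟨p, γ, hp, hγ, hγ1⟩) ∧
      ∀ x : ℕ → DualTirilmanSpace ⟨p, γ, hp, hγ, hγ1⟩, IsSubsymmetric x →
        SeqEquivalent x (dualTirilmanBasis ⟨p, γ, hp, hγ, hγ1⟩) := by
  refine ⟨1 / 32, by norm_num, fun γ hγ hγ1 hlt => ?_⟩
  set P : TirilmanParam := ⟨p, γ, hp, hγ, hγ1⟩
  have hP : P.γ < 1 / 32 := hlt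
  exact ⟨⟨P.dualSchauderBasis (by linarith), fun _ => rfl⟩, P.isSubsymmetric_dualBasis (by linarith),
    P.not_isSymmetricSeq_dualBasis (by linarith), fun _ hx => P.seqEquivalent_dualBasis hP hx⟩
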